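/- **Theorem (Existence of the canonical Gibbs measure).** Let $L,m,\beta>0$, let $\mathbb T$ be the circle of circumference $L$, and let $\Omega=C(\mathbb T;\mathbb C)$ with the topology of uniform convergence, regarded as a real vector space. Then there is a Gaussian measure $\mu_\beta$ on $\Omega$ with mean zero and covariance $C=\beta^{-1}(m^2-\Delta)^{-1}$, that is, $\int \Re\langle h,\phi\rangle\,d\mu_\beta=0$ and $\int(\Re\langle h,\phi\rangle)^2\,d\mu_\beta(\phi)=\langle h,Ch\rangle$ for all $h\in L^2(\mathbb T)$. Put $N(\phi)=\|\phi\|_2^2$, and let $K_\ell(t)=\frac1\ell\sum_{k=0}^{\ell-1}\sum_{j=-k}^{k}e^{ijt}$ for $|t|\le\pi$, $K_\ell(t)=0$ for $|t|>\pi$ (Fejér kernel). For every $n>0$ the probability measures with density proportional to $K_\ell(n-N(\phi))$ with respect to $\mu_\beta$ converge weakly, as $\ell\to\infty$, to a probability measure $\nu_{n,\beta}$ on $\Omega$: the measure $\mu_\beta$ conditioned on $\|\phi\|_2^2=n$. These measures have the following properties. 1. For all $2<p<6$, all $\lambda\in\mathbb R$ and all $n>0$, $\int_\Omega e^{\frac{\lambda}{p}\|\phi\|_p^p}\,d\nu_{n,\beta}<\infty$;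 and the canonical Gibbs measure $Z^{-1}e^{\beta\left[\frac{\lambda}{p}\|\phi\|_p^p+\frac12m^2n\right]}d\nu_{n,\beta}$, where $Z$ is the integral of the exponential, is a well-defined probability measure. 2. For every $\alpha\in(0,\frac12)$ there are finite constants $C_1,C_2,C_3$ (depending only on $L,m,\beta,\alpha$) such that for all $p$ with $2<p<4\alpha+4$, all $\lambda\ge0$ and all $n>0$, $$\int_\Omega e^{\frac{\lambda}{p}\|\phi\|_p^p}\,d\nu_{n,\beta}<C_3\exp\Big(C_1\lambda n^{p/2}+C_2\lambda^{\frac{4\alpha+2}{4\alpha+4-p}}\,n^{\frac{2\alpha p+2}{4\alpha+4-p}}\Big),$$ while for $\lambda<0$ the integral is at most $1$. (Every $p\in(2,6)$ satisfies $p<4\alpha+4$ for some $\alpha\in(0,\frac12)$.) -/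

import Mathlib

open MeasureTheory ProbabilityTheory Filter Topology
open scoped BoundedContinuousFunction ComplexConjugate

noncomputable section

namespace FocusingNLS

/-- The space `Ω` of continuous complex fields on the circle of circumference `L`,
with the topology of uniform convergence. -/
abbrev Field (L : ℝ) : Type := C(AddCircle L, ℂ)

instance instMeasurableSpaceField (L : ℝ) : MeasurableSpace (Field L) := borel _

instance instBorelSpaceField (L : ℝ) : BorelSpace (Field L) := ⟨rfl⟩

section

variable (L : ℝ) [Fact (0 < L)]

/-- The complex `L²` inner product `⟨h, φ⟩ = ∫ conj (h x) φ x dx`, with respect to arc length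
(the total mass of the circle is `L`). -/
def innerL2 (h φ : AddCircle L → ℂ) : ℂ := ∫ x : AddCircle L, conj (h x) * φ x

/-- The orthonormal Fourier basis `u_k(x) = L^{-1/2} exp(2π i k x / L)`. -/
def mode (k : ℤ) (x : AddCircle L) : ℂ := ((Real.sqrt L)⁻¹ : ℝ) * fourier k x

/-- The quadratic form `⟨h, C h⟩` of the operator `C = β⁻¹ (m² - Δ)⁻¹`, expanded in the orthonormal
eigenbasis `u_k`, for which `-Δ u_k = (2πk/L)² u_k`. -/
def covForm (m β : ℝ) (h : AddCircle L → ℂ) : ℝ :=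
  ∑' k : ℤ, ‖innerL2 L (mode L k) h‖ ^ 2 / (β * ((2 * Real.pi * k / L) ^ 2 + m ^ 2))

/-- `μ` is the Gaussian measure `μ_β`, with mean zero and covariance `C = β⁻¹ (m² - Δ)⁻¹`. The fields
form a real vector space with inner product `Re ⟨h, φ⟩`, so the covariance
identity reads `∫ (Re ⟨h, φ⟩)² dμ(φ) = ⟨h, C h⟩` for all `h ∈ L²`. -/
structure IsReferenceMeasure (m β : ℝ) (μ : Measure (Field L)) : Prop where
  gaussian : IsGaussian μ
  mean_zero : ∀ h : AddCircle L → ℂ, MemLp h 2 volume →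
    ∫ φ, (innerL2 L h φ).re ∂μ = 0
  covariance : ∀ h : AddCircle L → ℂ, MemLp h 2 volume →
    ∫ φ, (innerL2 L h φ).re ^ 2 ∂μ = covForm L m β h

/-- `‖φ‖_p^p = ∫ |φ(x)|^p dx`. -/
def normPow (p : ℝ) (φ : Field L) : ℝ := ∫ x : AddCircle L, ‖φ x‖ ^ p

/-- `N(φ) = ‖φ‖₂²`. -/
def N (φ : Field L) : ℝ := normPow L 2 φ

/-- The Fejér kernel `K_ℓ(t) = ℓ⁻¹ ∑_{0 ≤ k < ℓ} ∑_{|j| ≤ k} e^{ijt}` on `[-π, π]`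
(the imaginary parts cancel in pairs `j`, `-j`), extended by zero to the real line. -/
def fejer (l : ℕ) (t : ℝ) : ℝ :=
  if |t| ≤ Real.pi then
    (1 / (l : ℝ)) * ∑ k ∈ Finset.range l, ∑ j ∈ Finset.Icc (-(k : ℤ)) (k : ℤ), Real.cos (j * t)
  else 0

/-- The measure `μ` weighted by `K_ℓ(n - N(φ))` and normalized. -/
def approxConditioned (μ : Measure (Field L)) (n : ℝ) (l : ℕ) : Measure (Field L) :=
  (∫⁻ φ, ENNReal.ofReal (fejer l (n - N L φ)) ∂μ)⁻¹ •
    μ.withDensity (fun φ => ENNReal.ofReal (fejer l (n - N L φ)))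

/-- `ν` is `μ` conditioned on the null event `N(φ) = n`: the weak limit, as `ℓ → ∞`, of the normalized
measures with density proportional to `K_ℓ(n - N(φ))`, an approximation of `δ(N(φ) - n)`. -/
def IsConditionedOnNorm (μ : Measure (Field L)) (n : ℝ) (ν : Measure (Field L)) : Prop :=
  IsProbabilityMeasure ν ∧
    ∀ f : Field L →ᵇ ℝ,
      Tendsto (fun l : ℕ => ∫ φ, f φ ∂(approxConditioned L μ n l)) atTop (𝓝 (∫ φ, f φ ∂ν))

/-- The canonical Gibbs measure
`Z⁻¹ exp (β [(λ/p) ‖φ‖_p^p + m² n / 2]) dν`, with `Z` the integral of the exponential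
(the definition gives the zero measure if that integral is infinite). -/
def canonicalGibbs (m β p lam n : ℝ) (ν : Measure (Field L)) : Measure (Field L) :=
  ν.tilted (fun φ => β * (lam / p * normPow L p φ + m ^ 2 * n / 2))

end

end FocusingNLS

end

/-! Write a field as `φ = z u_0 + ψ`, with zero mode `z` and remaining modes `ψ` independent under
`μ_β`. In polar coordinates the phase of `z` is uniform and, independently, `|z|²` is exponential
with mean `s = 2 / (β m²)`. By Parseval `N(φ) = |z|² + R`, where `R` is the mass of `ψ`.
Conditioning on `N = n` can therefore be done by hand: the phase stays uniform, `|z|²` is set to `n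
- R`, and the law of `ψ` acquires the density `exp (R / s)` on `R < n`, up to normalization. The
Fejér kernels are an approximate identity in the variable `|z|²`. The exponential density is
discontinuous only at `0`, and `R = n` has probability zero, so the inner integrals converge almost
surely; they are uniformly bounded, and weak convergence follows by domination.

For the exponential bound, `‖φ‖_p^p ≤ n ‖φ‖_∞^(p-2)` on the shell. Cut the frequencies at `2^J`: the
low part is of order `√(2^J n)`, the high part of order `2^(-αJ) y`, with `y` a Hölder-like norm of
order `α` of `ψ`. Optimizing `J` bounds `‖φ‖_∞` by a multiple of `√n (1 + (y/√n)^(1/(2α+1)))`. The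
resulting power `(p-2)/(2α+1)` of `y` is below `2` exactly when `p < 4α+4`, and Young's inequality
leaves `ε y²` plus the stated function of `λ` and `n`.

It remains to bound the mean of `exp (ε y²)` on the shell uniformly in `n`
(`exists_lintegral_exp_mul_shellWeight_le`). The norm `y` is defined so that `exp (ε₀ y²)` equals a
series of exponentials of squared block norms, each convex in every Gaussian coordinate. For `n ≤ 1`
the weight is comparable to the indicator of `R < n`, which decreases in the modulus of every
coordinate; a correlation inequality for independent symmetric variables shows that this
conditioning does not raise the mean. For `n > 1` the normalization is bounded below, and `exp (R /
s)` is absorbed by Hölder-type splitting, because the nonzero modes have strictly smaller variance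
than the zero mode and so `exp (q R / s)` is integrable for some `q > 1`.

The reference measure is constructed as the law of the random Fourier series, and it is the only
one: the covariance fixes the image in `L²`, into which `Ω` embeds. -/

noncomputable section
namespace FocusingNLS
open scoped ENNReal NNReal
set_option linter.unusedSectionVars false

/-! ### Independent Gaussian coordinates: resampling, correlation, moments -/

section GaussianProduct

variable {ι : Type*}

/-- The law of a family of independent standard real Gaussian variables. -/
abbrev whiteNoise (ι : Type*) : Measure (ι → ℝ) :=
  Measure.infinitePi fun _ : ι => gaussianReal 0 1

section Update

variable [DecidableEq ι]

theorem measurable_update_prod (i : ι) :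
    Measurable (fun p : (ι → ℝ) × ℝ => Function.update p.1 i p.2) := by
  refine measurable_pi_iff.2 fun k => ?_
  by_cases hk : k = i
  · subst hk; simpa using measurable_snd
  · simp only [Function.update_of_ne hk]; fun_prop

theorem map_update_whiteNoise (i : ι) :
    ((whiteNoise ι).prod (gaussianReal 0 1)).map
      (fun p : (ι → ℝ) × ℝ => Function.update p.1 i p.2) = whiteNoise ι := by
  refine Measure.eq_infinitePi _ fun s t ht => ?_
  rw [Measure.map_apply (measurable_update_prod i) (MeasurableSet.pi s.countable_toSet fun k _ => ht k)]
  by_cases hi : i ∈ s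
  · have : (fun p : (ι → ℝ) × ℝ => Function.update p.1 i p.2) ⁻¹' (Set.pi s t)
        = (Set.pi (s.erase i : Finset ι) t) ×ˢ (t i) := by
      ext p
      simp only [Set.mem_preimage, Set.mem_pi, Set.mem_prod, Finset.mem_coe, Finset.mem_erase]
      constructor
      · intro h
        refine ⟨fun k hk => ?_, by simpa using h i hi⟩
        have := h k hk.2
        rwa [Function.update_of_ne hk.1] at this
      · rintro ⟨h1, h2⟩ k hk
        by_cases hki : k = i
        · subst hki; simpa using h2
        · rw [Function.update_of_ne hki]; exact h1 k ⟨hki, hk⟩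
    rw [this, Measure.prod_prod, Measure.infinitePi_pi _ (fun k _ => ht k), mul_comm,
      Finset.mul_prod_erase s (fun k => (gaussianReal 0 1) (t k)) hi]
  · have : (fun p : (ι → ℝ) × ℝ => Function.update p.1 i p.2) ⁻¹' (Set.pi s t)
        = (Set.pi s t) ×ˢ Set.univ := by
      ext p
      simp only [Set.mem_preimage, Set.mem_pi, Set.mem_prod, Finset.mem_coe, Set.mem_univ, and_true]
      refine forall₂_congr fun k hk => ?_
      rw [Function.update_of_ne (by rintro rfl; exact hi hk)]
    rw [this, Measure.prod_prod, Measure.infinitePi_pi _ (fun k _ => ht k), measure_univ, mul_one]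

theorem measurePreserving_update_whiteNoise (i : ι) :
    MeasurePreserving (fun p : (ι → ℝ) × ℝ => Function.update p.1 i p.2)
      ((whiteNoise ι).prod (gaussianReal 0 1)) (whiteNoise ι) :=
  ⟨measurable_update_prod i, map_update_whiteNoise i⟩

/-- Overwriting one coordinate by a fresh Gaussian variable does not change the law. This is Fubini
in a single coordinate without splitting the index set, the tool for all coordinatewise arguments
below. -/
theorem lintegral_whiteNoise_update {f : (ι → ℝ) → ℝ≥0∞} (hf : Measurable f) (i : ι) :
    ∫⁻ ω, f ω ∂(whiteNoise ι) =
      ∫⁻ ω, ∫⁻ x, f (Function.update ω i x) ∂(gaussianReal 0 1) ∂(whiteNoise ι) := by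
  rw [← (measurePreserving_update_whiteNoise i).lintegral_comp hf]
  exact lintegral_prod _ (hf.comp (measurable_update_prod i)).aemeasurable

/-- The sum of the values at `±a` of every coordinate section increases with `|a|`. -/
def EvenMono (F : (ι → ℝ) → ℝ≥0∞) : Prop :=
  ∀ i ω a b, |a| ≤ |b| →
    F (Function.update ω i a) + F (Function.update ω i (-a)) ≤
      F (Function.update ω i b) + F (Function.update ω i (-b))

/-- Every coordinate section decreases with the absolute value of the coordinate. -/
def AbsAnti (H : (ι → ℝ) → ℝ≥0∞) : Prop :=
  ∀ i ω a b, |a| ≤ |b| → H (Function.update ω i b) ≤ H (Function.update ω i a)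

end Update

theorem lintegral_gaussianReal_neg {f : ℝ → ℝ≥0∞} (hf : Measurable f) :
    ∫⁻ x, f (-x) ∂(gaussianReal 0 1) = ∫⁻ x, f x ∂(gaussianReal 0 1) := by
  have h := gaussianReal_map_neg (μ := 0) (v := 1)
  rw [neg_zero] at h
  conv_rhs => rw [← h]
  rw [lintegral_map hf measurable_neg]

/-- The rearrangement inequality `(b - a) (c - d) ≥ 0`, expanded because subtraction in `ℝ≥0∞` is
truncated. -/
theorem mul_add_mul_le_of_le_of_le {a b c d : ℝ≥0∞} (h1 : a ≤ b) (h2 : d ≤ c) :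
    a * c + b * d ≤ a * d + b * c := by
  obtain ⟨e, rfl⟩ := exists_add_of_le h1
  have : e * d ≤ e * c := by gcongr
  calc a * c + (a + e) * d = a * c + a * d + e * d := by ring
    _ ≤ a * c + a * d + e * c := by gcongr
    _ = a * d + (a + e) * c := by ring

/-- Chebyshev's correlation inequality. Since `h` is even, `f` may be replaced by its symmetrization
`g`. Then `g` and `h` are oppositely ordered by `|x|`, so `(g x - g y) (h x - h y) ≤ 0`; integrate
over two independent copies. -/
theorem lintegral_mul_le_of_even_mono {f h : ℝ → ℝ≥0∞} (hf : Measurable f) (hh : Measurable h)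
    (hfm : ∀ a b, |a| ≤ |b| → f a + f (-a) ≤ f b + f (-b)) (hha : ∀ a b, |a| ≤ |b| → h b ≤ h a) :
    ∫⁻ x, f x * h x ∂(gaussianReal 0 1) ≤
      (∫⁻ x, f x ∂(gaussianReal 0 1)) * ∫⁻ x, h x ∂(gaussianReal 0 1) := by
  set γ := gaussianReal 0 1
  set g : ℝ → ℝ≥0∞ := fun x => f x + f (-x) with hg
  have hgm : Measurable g := by fun_prop
  have heven : ∀ x, h (-x) = h x := fun x =>
    le_antisymm (hha _ _ (by simp)) (hha _ _ (by simp))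
  have e1 : ∫⁻ x, g x ∂γ = 2 * ∫⁻ x, f x ∂γ := by
    rw [hg, lintegral_add_left hf, lintegral_gaussianReal_neg hf, two_mul]
  have e2 : ∫⁻ x, g x * h x ∂γ = 2 * ∫⁻ x, f x * h x ∂γ := by
    have : ∀ x, g x * h x = f x * h x + (fun y => f y * h y) (-x) := fun x => by
      simp only [hg, heven, add_mul]
    simp_rw [this]
    rw [lintegral_add_left (by fun_prop),
      lintegral_gaussianReal_neg (f := fun y => f y * h y) (by fun_prop), two_mul]
  have key : ∫⁻ x, ∫⁻ y, (g x * h x + g y * h y) ∂γ ∂γ ≤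
      ∫⁻ x, ∫⁻ y, (g x * h y + g y * h x) ∂γ ∂γ := by
    refine lintegral_mono fun x => lintegral_mono fun y => ?_
    rcases le_total |x| |y| with hxy | hxy
    · exact mul_add_mul_le_of_le_of_le (hfm x y hxy) (hha x y hxy)
    · rw [add_comm, add_comm (g x * h y)]
      exact mul_add_mul_le_of_le_of_le (hfm y x hxy) (hha y x hxy)
  have l1 : ∫⁻ x, ∫⁻ y, (g x * h x + g y * h y) ∂γ ∂γ = 2 * ∫⁻ x, g x * h x ∂γ := by
    have : ∀ x, ∫⁻ y, (g x * h x + g y * h y) ∂γ = g x * h x + ∫⁻ y, g y * h y ∂γ := fun x => by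
      rw [lintegral_add_left (by fun_prop), lintegral_const, measure_univ, mul_one]
    simp_rw [this]
    rw [lintegral_add_left (by fun_prop), lintegral_const, measure_univ, mul_one, two_mul]
  have l2 : ∫⁻ x, ∫⁻ y, (g x * h y + g y * h x) ∂γ ∂γ
      = 2 * ((∫⁻ x, g x ∂γ) * ∫⁻ x, h x ∂γ) := by
    have : ∀ x, ∫⁻ y, (g x * h y + g y * h x) ∂γ
        = g x * (∫⁻ y, h y ∂γ) + (∫⁻ y, g y ∂γ) * h x := fun x => by
      rw [lintegral_add_left (by fun_prop), lintegral_const_mul _ hh, lintegral_mul_const _ hgm]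
    simp_rw [this]
    rw [lintegral_add_left (by fun_prop), lintegral_mul_const _ hgm, lintegral_const_mul _ hh,
      two_mul]
  rw [l1, l2, e1, e2] at key
  have h2 : (2 : ℝ≥0∞) ≠ 0 := by norm_num
  have h2' : (2 : ℝ≥0∞) ≠ ∞ := by norm_num
  have := (ENNReal.mul_le_mul_iff_right h2 h2').1 key
  rw [mul_assoc] at this
  exact (ENNReal.mul_le_mul_iff_right h2 h2').1 this

section Harris

variable [DecidableEq ι]

theorem measurable_lintegral_update {F : (ι → ℝ) → ℝ≥0∞} (hF : Measurable F) (i : ι) :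
    Measurable fun ω => ∫⁻ x, F (Function.update ω i x) ∂(gaussianReal 0 1) :=
  Measurable.lintegral_prod_right (hF.comp (measurable_update_prod i))

theorem measurable_comp_update {F : (ι → ℝ) → ℝ≥0∞} (hF : Measurable F) (i : ι) (ω : ι → ℝ) :
    Measurable fun x => F (Function.update ω i x) :=
  hF.comp ((measurable_update_prod i).comp (by fun_prop : Measurable fun x : ℝ => (ω, x)))

theorem EvenMono.lintegral_update {F : (ι → ℝ) → ℝ≥0∞} (hF : Measurable F) (h : EvenMono F)
    (i : ι) : EvenMono fun ω => ∫⁻ x, F (Function.update ω i x) ∂(gaussianReal 0 1) := by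
  intro j ω a b hab
  by_cases hij : i = j
  · subst hij; simp
  · simp only [Function.update_comm (Ne.symm hij)]
    rw [← lintegral_add_left (measurable_comp_update
        (F := fun ω => F (Function.update ω j a)) ?_ i ω),
      ← lintegral_add_left (measurable_comp_update
        (F := fun ω => F (Function.update ω j b)) ?_ i ω)]
    · exact lintegral_mono fun x => h j _ a b hab
    all_goals
      exact hF.comp ((measurable_update_prod j).comp
        (by fun_prop : Measurable fun ω : ι → ℝ => (ω, _)))

theorem AbsAnti.lintegral_update {H : (ι → ℝ) → ℝ≥0∞} (h : AbsAnti H)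
    (i : ι) : AbsAnti fun ω => ∫⁻ x, H (Function.update ω i x) ∂(gaussianReal 0 1) := by
  intro j ω a b hab
  by_cases hij : i = j
  · subst hij; simp
  · simp only [Function.update_comm (Ne.symm hij)]
    exact lintegral_mono fun x => h j _ a b hab

/-- Correlation inequality for independent symmetric variables. -/
theorem lintegral_mul_le_of_evenMono_of_absAnti (s : Finset ι) {F H : (ι → ℝ) → ℝ≥0∞}
    (hF : Measurable F) (hH : Measurable H) (hFs : DependsOn F (s : Set ι))
    (hFm : EvenMono F) (hHa : AbsAnti H) :
    ∫⁻ ω, F ω * H ω ∂(whiteNoise ι) ≤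
      (∫⁻ ω, F ω ∂(whiteNoise ι)) * ∫⁻ ω, H ω ∂(whiteNoise ι) := by
  induction s using Finset.induction_on generalizing F H with
  -- The induction runs over the coordinates of `F` only; `H` may depend on infinitely many.
  | empty =>
    have hc : ∀ ω, F ω = F 0 := fun ω => hFs (by simp)
    simp_rw [hc]
    rw [lintegral_const_mul _ hH, lintegral_const, measure_univ, mul_one]
  | insert i s hi ih =>
    rw [lintegral_whiteNoise_update (f := fun ω => F ω * H ω) (hF.mul hH) i, lintegral_whiteNoise_update hF i,
      lintegral_whiteNoise_update hH i]
    -- Integrating out coordinate `i` by the one-dimensional inequality preserves both monotonicity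
    -- properties and removes `i` from the dependence of `F`.
    refine le_trans (lintegral_mono fun ω => ?_) (ih (measurable_lintegral_update hF i)
      (measurable_lintegral_update hH i) ?_ (hFm.lintegral_update hF i) (hHa.lintegral_update i))
    · exact lintegral_mul_le_of_even_mono (measurable_comp_update hF i ω)
        (measurable_comp_update hH i ω) (fun a b => hFm i ω a b) (fun a b => hHa i ω a b)
    · intro x y hxy
      refine lintegral_congr fun z => hFs fun k hk => ?_
      by_cases hki : k = i
      · subst hki; simp
      · rw [Function.update_of_ne hki, Function.update_of_ne hki]
        exact hxy k (by simpa [hki] using hk)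

/-- Both `a` and `-a` are convex combinations of `b` and `-b`, with the weights exchanged; add the
two convexity inequalities. This makes convex sections satisfy `EvenMono`. -/
theorem add_neg_le_of_convexOn {f : ℝ → ℝ} (hf : ConvexOn ℝ Set.univ f) {a b : ℝ}
    (hab : |a| ≤ |b|) : f a + f (-a) ≤ f b + f (-b) := by
  wlog hb : 0 ≤ b generalizing b
  · have := this (b := -b) (by simpa using hab) (by linarith)
    rw [neg_neg] at this; linarith
  rw [abs_of_nonneg hb, abs_le] at hab
  rcases eq_or_lt_of_le hb with rfl | hb
  · have : a = 0 := by linarith [hab.1, hab.2]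
    simp [this]
  have h2 : b ≠ 0 := hb.ne'
  have n1 : 0 ≤ (b + a) / (2 * b) := div_nonneg (by linarith) (by linarith)
  have n2 : 0 ≤ (b - a) / (2 * b) := div_nonneg (by linarith) (by linarith)
  have hs : (b + a) / (2 * b) + (b - a) / (2 * b) = 1 := by field_simp; ring
  have k1 := hf.2 (Set.mem_univ b) (Set.mem_univ (-b)) n1 n2 hs
  have k2 := hf.2 (Set.mem_univ (-b)) (Set.mem_univ b) n1 n2 hs
  simp only [smul_eq_mul] at k1 k2
  rw [show (b + a) / (2 * b) * b + (b - a) / (2 * b) * -b = a by field_simp; ring] at k1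
  rw [show (b + a) / (2 * b) * -b + (b - a) / (2 * b) * b = -a by field_simp; ring] at k2
  have : (b + a) / (2 * b) = 1 - (b - a) / (2 * b) := by linarith
  rw [this] at k1 k2
  linarith

end Harris

/-! ### Exponential moments -/

/-- The moment `∫ exp (t x²) dγ(x)` of the standard Gaussian measure. -/
def gaussSqMoment (t : ℝ) : ℝ≥0∞ := ∫⁻ x, ENNReal.ofReal (Real.exp (t * x ^ 2)) ∂(gaussianReal 0 1)

theorem gaussSqMoment_lt_top {t : ℝ} (ht : t < 1 / 2) : gaussSqMoment t < ∞ := by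
  unfold gaussSqMoment
  rw [gaussianReal_of_var_ne_zero _ one_ne_zero,
    lintegral_withDensity_eq_lintegral_mul _ (measurable_gaussianPDF 0 1) (by fun_prop)]
  have : ∀ x : ℝ, (gaussianPDF 0 1 * fun x => ENNReal.ofReal (Real.exp (t * x ^ 2))) x
      = ENNReal.ofReal ((√(2 * Real.pi))⁻¹ * Real.exp (-(1 / 2 - t) * x ^ 2)) := by
    intro x
    simp only [Pi.mul_apply, gaussianPDF, gaussianPDFReal]
    rw [← ENNReal.ofReal_mul (by positivity), mul_assoc, ← Real.exp_add]
    congr 2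
    · simp
    · congr 1; simp; ring
  simp_rw [this]
  exact ((integrable_exp_neg_mul_sq (by linarith : 0 < 1 / 2 - t)).const_mul _).lintegral_lt_top

theorem exp_mul_le_one_add {u z : ℝ} (hu : 0 ≤ u) (hu1 : u ≤ 1) :
    Real.exp (u * z) ≤ 1 + u * (Real.exp z - 1) := by
  have := convexOn_exp.2 (Set.mem_univ z) (Set.mem_univ 0) hu (sub_nonneg.2 hu1) (by ring)
  simp only [smul_eq_mul, mul_zero, add_zero, Real.exp_zero, mul_one] at this
  linarith

/-- Convexity of the exponential makes the excess of the moment over `1` at most linear in `t`. A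
bound of the form `exp (K t)` is what a product over many modes needs: it turns into `exp` of a sum.
-/
theorem lintegral_exp_mul_sq_le {t₀ t : ℝ} (h0 : 0 < t₀) (ht : 0 ≤ t) (htt : t ≤ t₀)
    (h : t₀ < 1 / 2) :
    gaussSqMoment t ≤ ENNReal.ofReal (Real.exp ((gaussSqMoment t₀).toReal * (t / t₀))) := by
  set A := (gaussSqMoment t₀).toReal
  have hu : 0 ≤ t / t₀ := by positivity
  have hu1 : t / t₀ ≤ 1 := (div_le_one h0).2 htt
  have hb : ∀ x : ℝ, ENNReal.ofReal (Real.exp (t * x ^ 2)) ≤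
      1 + ENNReal.ofReal (t / t₀) * ENNReal.ofReal (Real.exp (t₀ * x ^ 2)) := fun x => by
    rw [← ENNReal.ofReal_one, ← ENNReal.ofReal_mul hu, ← ENNReal.ofReal_add zero_le_one
      (by positivity)]
    apply ENNReal.ofReal_le_ofReal
    have := exp_mul_le_one_add (z := t₀ * x ^ 2) hu hu1
    rw [show t / t₀ * (t₀ * x ^ 2) = t * x ^ 2 by field_simp] at this
    nlinarith
  calc gaussSqMoment t ≤ 1 + ENNReal.ofReal (t / t₀) * gaussSqMoment t₀ := by
        refine (lintegral_mono hb).trans_eq ?_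
        rw [lintegral_add_left (by fun_prop), lintegral_const_mul _ (by fun_prop)]
        simp [gaussSqMoment]
    _ = ENNReal.ofReal (1 + t / t₀ * A) := by
        rw [ENNReal.ofReal_add zero_le_one (mul_nonneg hu ENNReal.toReal_nonneg),
          ENNReal.ofReal_mul hu, ENNReal.ofReal_toReal (gaussSqMoment_lt_top h).ne,
          ENNReal.ofReal_one]
    _ ≤ _ := by
        apply ENNReal.ofReal_le_ofReal
        have := Real.add_one_le_exp (A * (t / t₀))
        linarith

/-- A finite linear combination of independent standard Gaussian variables is Gaussian. -/
theorem map_sum_whiteNoise (s : Finset ι) (b : ι → ℝ) :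
    (whiteNoise ι).map (fun ω => ∑ i ∈ s, ω i * b i) =
      gaussianReal 0 (∑ i ∈ s, b i ^ 2).toNNReal := by
  classical
  have hind : iIndepFun (fun i (ω : ι → ℝ) => ω i * b i) (whiteNoise ι) :=
    iIndepFun_infinitePi (X := fun i x => x * b i) (fun i => by fun_prop)
  induction s using Finset.induction_on with
  | empty => simp [gaussianReal_zero_var]
  | insert i s hi ih =>
    have hI : IndepFun (fun ω : ι → ℝ => ω i * b i) (fun ω => ∑ i ∈ s, ω i * b i)
        (whiteNoise ι) := by
      have := (hind.indepFun_finsetSum_of_notMem (fun i => by fun_prop) hi).symm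
      convert! this using 1
      ext ω; simp
    have h1 : (whiteNoise ι).map (fun ω : ι → ℝ => ω i * b i)
        = gaussianReal 0 ((b i) ^ 2).toNNReal := by
      have : (fun ω : ι → ℝ => ω i * b i) = (fun x => x * b i) ∘ (fun ω : ι → ℝ => ω i) := rfl
      rw [this, ← Measure.map_map (by fun_prop) (by fun_prop), Measure.infinitePi_map_eval,
        gaussianReal_map_mul_const]
      congr 1
      · simp
      · ext; simp [Real.toNNReal_of_nonneg (sq_nonneg (b i))]
    have := gaussianReal_add_gaussianReal_of_indepFun hI h1 ih
    simp only [Finset.sum_insert hi]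
    rw [Real.toNNReal_add (sq_nonneg _) (Finset.sum_nonneg fun _ _ => sq_nonneg _)]
    convert! this using 1
    simp

theorem lintegral_exp_sq_sum_le (s : Finset ι) (b : ι → ℝ) {t : ℝ}
    (h : t * ∑ i ∈ s, b i ^ 2 ≤ 1 / 4) :
    ∫⁻ ω, ENNReal.ofReal (Real.exp (t * (∑ i ∈ s, ω i * b i) ^ 2)) ∂(whiteNoise ι) ≤
      gaussSqMoment (1 / 4) := by
  set v := ∑ i ∈ s, b i ^ 2
  have hv : 0 ≤ v := Finset.sum_nonneg fun _ _ => sq_nonneg _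
  have h1 : (whiteNoise ι).map (fun ω => ∑ i ∈ s, ω i * b i) =
      (gaussianReal 0 1).map (fun x => √v * x) := by
    rw [map_sum_whiteNoise, gaussianReal_map_const_mul]
    congr 1
    · simp
    · ext; simp [Real.toNNReal_of_nonneg hv, Real.sq_sqrt hv, v]
  rw [← lintegral_map (f := fun y => ENNReal.ofReal (Real.exp (t * y ^ 2)))
    (g := fun ω : ι → ℝ => ∑ i ∈ s, ω i * b i) (by fun_prop) (by fun_prop), h1,
    lintegral_map (by fun_prop) (by fun_prop)]
  refine lintegral_mono fun x => ENNReal.ofReal_le_ofReal (Real.exp_le_exp.2 ?_)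
  rw [mul_pow, Real.sq_sqrt hv, ← mul_assoc]
  gcongr

/-- The bound sees the modes only through the sum of the `c i`, so it is uniform in their number
when the coefficients are summable. -/
theorem lintegral_exp_sum_mul_sq_le (s : Finset ι) (c : ι → ℝ) (hc : ∀ i, 0 ≤ c i) {t₀ : ℝ}
    (h0 : 0 < t₀) (h1 : t₀ < 1 / 2) (hct : ∀ i, c i ≤ t₀) :
    ∫⁻ ω, ENNReal.ofReal (Real.exp (∑ i ∈ s, c i * ω i ^ 2)) ∂(whiteNoise ι) ≤
      ENNReal.ofReal (Real.exp ((gaussSqMoment t₀).toReal / t₀ * ∑ i ∈ s, c i)) := by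
  classical
  induction s using Finset.induction_on with
  | empty => simp
  | insert i s hi ih =>
    have hu : ∀ (ω : ι → ℝ) (x : ℝ), ENNReal.ofReal (Real.exp
        (∑ k ∈ insert i s, c k * Function.update ω i x k ^ 2)) =
        ENNReal.ofReal (Real.exp (c i * x ^ 2)) *
          ENNReal.ofReal (Real.exp (∑ i ∈ s, c i * ω i ^ 2)) := fun ω x => by
      rw [← ENNReal.ofReal_mul (by positivity), ← Real.exp_add, Finset.sum_insert hi]
      congr 3
      · simp
      · refine Finset.sum_congr rfl fun k hk => ?_
        rw [Function.update_of_ne (by rintro rfl; exact hi hk)]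
    rw [lintegral_whiteNoise_update (by fun_prop) i]
    simp_rw [hu]
    have : ∀ ω : ι → ℝ, ∫⁻ x, ENNReal.ofReal (Real.exp (c i * x ^ 2)) *
          ENNReal.ofReal (Real.exp (∑ i ∈ s, c i * ω i ^ 2)) ∂(gaussianReal 0 1) =
          gaussSqMoment (c i) * ENNReal.ofReal (Real.exp (∑ i ∈ s, c i * ω i ^ 2)) := fun ω => by
      rw [lintegral_mul_const _ (by fun_prop)]; rfl
    simp_rw [this]
    rw [lintegral_const_mul _ (by fun_prop), Finset.sum_insert hi, mul_add, Real.exp_add,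
      ENNReal.ofReal_mul (by positivity)]
    gcongr
    refine (lintegral_exp_mul_sq_le h0 (hc i) (hct i) h1).trans (le_of_eq ?_)
    congr 2; ring

end GaussianProduct

/-! ### Fourier modes, trigonometric polynomials and linear functionals -/

section Trigonometric

variable (L : ℝ) [hL : Fact (0 < L)]

/-- The basis function `mode L k` as a continuous field. -/
def modeField (k : ℤ) : Field L := ((Real.sqrt L)⁻¹ : ℂ) • fourier k

variable {L}

@[simp] theorem modeField_apply (k : ℤ) (x : AddCircle L) : modeField L k x = mode L k x := by
  simp [modeField, mode]

theorem norm_fourier_apply (k : ℤ) (x : AddCircle L) : ‖fourier k x‖ = 1 := by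
  rw [fourier_apply]; exact Circle.norm_coe _

theorem norm_mode_sq (k : ℤ) (x : AddCircle L) : ‖mode L k x‖ ^ 2 = L⁻¹ := by
  have := hL.out
  rw [mode, norm_mul, norm_fourier_apply, mul_one, Complex.norm_real, Real.norm_eq_abs,
    sq_abs, inv_pow, Real.sq_sqrt this.le]

theorem innerL2_mode (φ : AddCircle L → ℂ) (k : ℤ) :
    innerL2 L (mode L k) φ = (Real.sqrt L : ℂ) * fourierCoeff φ k := by
  have h0 : (0 : ℝ) < L := hL.out
  have hs : (Real.sqrt L : ℂ) ≠ 0 := by simpa using (Real.sqrt_pos.2 h0).ne'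
  have hss : (Real.sqrt L : ℂ) * Real.sqrt L = L := by
    rw [← Complex.ofReal_mul, Real.mul_self_sqrt h0.le]
  have h1 : ∀ x, conj (mode L k x) * φ x = (Real.sqrt L : ℂ)⁻¹ * (fourier (-k) x • φ x) := by
    intro x
    simp [mode, mul_assoc]
  unfold innerL2 fourierCoeff
  simp_rw [h1]
  rw [integral_const_mul, AddCircle.integral_haarAddCircle, Complex.real_smul]
  field_simp
  rw [pow_two, hss]
  have hLc : (L : ℂ) ≠ 0 := by exact_mod_cast h0.ne'
  push_cast
  field_simp

theorem integral_norm_sq_eq (φ : Field L) : N L φ = ∫ x : AddCircle L, ‖φ x‖ ^ 2 := by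
  simp [N, normPow]

theorem hasSum_norm_innerL2_mode_sq (φ : Field L) :
    HasSum (fun k : ℤ => ‖innerL2 L (mode L k) φ‖ ^ 2) (N L φ) := by
  have h0 : (0 : ℝ) < L := hL.out
  have h := hasSum_sq_fourierCoeff (ContinuousMap.toLp 2 AddCircle.haarAddCircle ℂ φ)
  simp_rw [fourierCoeff_toLp] at h
  have h2 : ∫ t : AddCircle L, ‖(ContinuousMap.toLp 2 AddCircle.haarAddCircle ℂ φ) t‖ ^ 2
      ∂AddCircle.haarAddCircle = L⁻¹ * N L φ := by
    rw [integral_norm_sq_eq, ← smul_eq_mul, ← AddCircle.integral_haarAddCircle]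
    refine integral_congr_ae ?_
    filter_upwards [ContinuousMap.coeFn_toLp (p := 2) (𝕜 := ℂ) AddCircle.haarAddCircle φ] with x hx
    rw [hx]
  rw [h2] at h
  have h3 := h.mul_left L
  rw [← mul_assoc, mul_inv_cancel₀ h0.ne', one_mul] at h3
  convert! h3 using 2 with k
  rw [innerL2_mode, norm_mul, mul_pow, Complex.norm_real, Real.norm_eq_abs, sq_abs,
    Real.sq_sqrt h0.le]

theorem innerL2_mode_mode (j k : ℤ) : innerL2 L (mode L j) (mode L k) = if j = k then 1 else 0 := by
  have h0 : (0 : ℝ) < L := hL.out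
  have hs : (Real.sqrt L : ℂ) ≠ 0 := by simpa using (Real.sqrt_pos.2 h0).ne'
  rw [innerL2_mode]
  have : (mode L k : AddCircle L → ℂ) = fun x => ((Real.sqrt L)⁻¹ : ℂ) * fourier k x := by
    ext x; simp [mode]
  rw [this, fourierCoeff.const_mul, fourierCoeff_fourier, ← mul_assoc, mul_inv_cancel₀ hs, one_mul,
    Pi.single_apply]

variable (L) in
/-- Trigonometric polynomials of degree at most `M`. -/
def trigPoly (M : ℕ) : Submodule ℂ (Field L) :=
  Submodule.span ℂ (fourier '' Set.Icc (-(M : ℤ)) M)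

theorem fourier_mem_trigPoly {M : ℕ} {k : ℤ} (hk : |k| ≤ M) : fourier k ∈ trigPoly L M :=
  Submodule.subset_span ⟨k, abs_le.1 hk, rfl⟩

theorem modeField_mem_trigPoly {M : ℕ} {k : ℤ} (hk : |k| ≤ M) : modeField L k ∈ trigPoly L M :=
  Submodule.smul_mem _ _ (fourier_mem_trigPoly hk)

theorem mul_mem_trigPoly {M M' : ℕ} {f g : Field L} (hf : f ∈ trigPoly L M)
    (hg : g ∈ trigPoly L M') : f * g ∈ trigPoly L (M + M') := by
  have h := Submodule.mul_mem_mul hf hg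
  rw [trigPoly, trigPoly, Submodule.span_mul_span] at h
  refine Submodule.span_le.2 ?_ h
  rintro _ ⟨_, ⟨i, hi, rfl⟩, _, ⟨j, hj, rfl⟩, rfl⟩
  refine Submodule.subset_span ⟨i + j, ?_, ?_⟩
  · simp only [Set.mem_Icc] at hi hj ⊢; push_cast; constructor <;> linarith [hi.1, hi.2, hj.1, hj.2]
  · ext x; simp

theorem pow_mem_trigPoly {M : ℕ} {f : Field L} (hf : f ∈ trigPoly L M) (q : ℕ) :
    f ^ q ∈ trigPoly L (q * M) := by
  induction q with
  | zero =>
    have : (1 : Field L) = fourier 0 := by ext x; simp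
    rw [pow_zero, this]
    exact fourier_mem_trigPoly (by simp)
  | succ q ih =>
    rw [pow_succ, add_mul, one_mul]
    exact mul_mem_trigPoly ih hf

theorem eq_sum_of_mem_trigPoly {M : ℕ} {f : Field L} (hf : f ∈ trigPoly L M) (x : AddCircle L) :
    f x = ∑ k ∈ Finset.Icc (-(M : ℤ)) M, innerL2 L (mode L k) f * mode L k x := by
  have h0 : (0 : ℝ) < L := hL.out
  have hs : (Real.sqrt L : ℂ) ≠ 0 := by simpa using (Real.sqrt_pos.2 h0).ne'
  simp_rw [innerL2_mode]
  have hint : ∀ f : Field L, Integrable f AddCircle.haarAddCircle := fun f =>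
    f.continuous.integrable_of_hasCompactSupport (HasCompactSupport.of_compactSpace _)
  refine Submodule.span_induction
    (p := fun (f : Field L) _ => f x = ∑ k ∈ Finset.Icc (-(M : ℤ)) M,
      (Real.sqrt L : ℂ) * fourierCoeff f k * mode L k x) ?_ ?_ ?_ ?_ hf
  · rintro _ ⟨j, hj, rfl⟩
    rw [fourierCoeff_fourier, Finset.sum_eq_single j]
    · simp [mode, ← mul_assoc, mul_inv_cancel₀ hs]
    · intro k _ hkj; simp [hkj]
    · intro h; exact absurd (Finset.mem_Icc.2 hj) h
  · simp [fourierCoeff]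
  · intro f g _ _ ihf ihg
    rw [ContinuousMap.add_apply, ihf, ihg, ← Finset.sum_add_distrib]
    refine Finset.sum_congr rfl fun k _ => ?_
    rw [ContinuousMap.coe_add, fourierCoeff.add (hint f) (hint g), Pi.add_apply]
    ring
  · intro c f _ ih
    rw [ContinuousMap.smul_apply, ih, Finset.smul_sum]
    refine Finset.sum_congr rfl fun k _ => ?_
    rw [ContinuousMap.coe_smul, fourierCoeff.const_smul]
    simp only [smul_eq_mul]; ring

/-- A finite Fourier sum is bounded by its coefficients. -/
theorem norm_sum_mode_sq_le (s : Finset ℤ) (c : ℤ → ℂ) (x : AddCircle L) :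
    ‖∑ k ∈ s, c k * mode L k x‖ ^ 2 ≤ s.card / L * ∑ k ∈ s, ‖c k‖ ^ 2 := by
  have h0 : (0 : ℝ) < L := hL.out
  calc ‖∑ k ∈ s, c k * mode L k x‖ ^ 2 ≤ (∑ k ∈ s, ‖c k * mode L k x‖) ^ 2 := by
        gcongr; exact norm_sum_le _ _
    _ ≤ s.card * ∑ k ∈ s, ‖c k * mode L k x‖ ^ 2 := sq_sum_le_card_mul_sum_sq
    _ = _ := by
        simp_rw [norm_mul, mul_pow, norm_mode_sq, ← Finset.sum_mul]; ring

/-- Nikolskii's inequality: Cauchy–Schwarz over the `2M + 1` frequencies, then Parseval. -/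
theorem norm_sq_le_of_mem_trigPoly {M : ℕ} {f : Field L} (hf : f ∈ trigPoly L M)
    (x : AddCircle L) : ‖f x‖ ^ 2 ≤ (2 * M + 1) / L * ∫ y : AddCircle L, ‖f y‖ ^ 2 := by
  have h0 : (0 : ℝ) < L := hL.out
  rw [eq_sum_of_mem_trigPoly hf x]
  refine (norm_sum_mode_sq_le _ _ x).trans ?_
  rw [← integral_norm_sq_eq]
  have hc : ((Finset.Icc (-(M : ℤ)) M).card : ℝ) = 2 * M + 1 := by
    rw [Int.card_Icc]
    have : ((M : ℤ) + 1 - -(M : ℤ)).toNat = 2 * M + 1 := by omega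
    rw [this]; push_cast; ring
  rw [hc]
  gcongr
  exact sum_le_hasSum _ (fun _ _ => by positivity) (hasSum_norm_innerL2_mode_sq f)

/-- Expand the exponential and apply the previous inequality to each `f ^ q`, of degree `q M`. Since
`2 q M + 1 ≤ (2 M + 1) 2 ^ q`, the growth in `q` only doubles the rate, and passing from the
supremum to a mean costs a factor linear in `M`. -/
theorem exp_mul_norm_sq_le_of_mem_trigPoly {M : ℕ} {f : Field L} (hf : f ∈ trigPoly L M)
    {η : ℝ} (hη : 0 ≤ η) :
    Real.exp (η * ‖f‖ ^ 2) ≤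
      (2 * M + 1) / L * ∫ y : AddCircle L, Real.exp (2 * η * ‖f y‖ ^ 2) := by
  have h0 : (0 : ℝ) < L := hL.out
  obtain ⟨x, -, hx⟩ := isCompact_univ.exists_isMaxOn (Set.univ_nonempty (α := AddCircle L))
    (f.continuous.norm.continuousOn)
  have hfx : ‖f‖ ≤ ‖f x‖ := (ContinuousMap.norm_le _ (norm_nonneg _)).2 fun y => hx (Set.mem_univ y)
  have hint : ∀ g : AddCircle L → ℝ, Continuous g → Integrable g := fun g hg =>
    hg.integrable_of_hasCompactSupport (HasCompactSupport.of_compactSpace _)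
  have hfc : Continuous f := f.continuous
  have hterm : ∀ q : ℕ, (η * ‖f x‖ ^ 2) ^ q / q.factorial ≤
      (2 * M + 1) / L * ∫ y : AddCircle L, (2 * η * ‖f y‖ ^ 2) ^ q / q.factorial := by
    intro q
    have h1 := norm_sq_le_of_mem_trigPoly (pow_mem_trigPoly hf q) x
    have h2 : (2 * (q * M : ℕ) + 1 : ℝ) ≤ (2 * M + 1) * 2 ^ q := by
      have hq : (q : ℝ) + 1 ≤ 2 ^ q := by exact_mod_cast Nat.lt_two_pow_self (n := q)
      have hM : (0 : ℝ) ≤ M := Nat.cast_nonneg M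
      have hq0 : (0 : ℝ) ≤ q := Nat.cast_nonneg q
      push_cast
      nlinarith [mul_nonneg hM hq0]
    have h3 : ∫ y : AddCircle L, (2 * η * ‖f y‖ ^ 2) ^ q / q.factorial =
        (2 * η) ^ q / q.factorial * ∫ y : AddCircle L, ‖(f ^ q) y‖ ^ 2 := by
      rw [← integral_const_mul]
      congr 1; ext y
      rw [ContinuousMap.pow_apply, norm_pow, mul_pow, ← pow_mul, ← pow_mul, mul_comm q 2]; ring
    rw [h3]
    have hI : 0 ≤ ∫ y : AddCircle L, ‖(f ^ q) y‖ ^ 2 := integral_nonneg fun _ => by positivity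
    calc (η * ‖f x‖ ^ 2) ^ q / q.factorial = η ^ q / q.factorial * ‖(f ^ q) x‖ ^ 2 := by
          rw [ContinuousMap.pow_apply, norm_pow, mul_pow, ← pow_mul, ← pow_mul, mul_comm q 2]; ring
      _ ≤ η ^ q / q.factorial * ((2 * M + 1) * 2 ^ q / L * ∫ y : AddCircle L, ‖(f ^ q) y‖ ^ 2) := by
          refine mul_le_mul_of_nonneg_left (h1.trans ?_) (by positivity)
          gcongr
      _ = _ := by rw [mul_pow]; ring
  have hpart : ∀ n : ℕ, ∑ q ∈ Finset.range n, (η * ‖f x‖ ^ 2) ^ q / q.factorial ≤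
      (2 * M + 1) / L * ∫ y : AddCircle L, Real.exp (2 * η * ‖f y‖ ^ 2) := by
    intro n
    refine (Finset.sum_le_sum fun q _ => hterm q).trans ?_
    rw [← Finset.mul_sum, ← integral_finsetSum _ (fun q _ => hint _ (by fun_prop))]
    gcongr
    · exact hint _ (by fun_prop)
    · exact hint _ (by fun_prop)
    · intro y
      exact Real.sum_le_exp_of_nonneg (by positivity) n
  calc Real.exp (η * ‖f‖ ^ 2) ≤ Real.exp (η * ‖f x‖ ^ 2) := by gcongr
    _ ≤ _ := by
      have h := NormedSpace.expSeries_div_hasSum_exp (𝔸 := ℝ) (η * ‖f x‖ ^ 2)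
      rw [← Real.exp_eq_exp_ℝ] at h
      exact le_of_tendsto' h.tendsto_sum_nat hpart

/-! ### The functionals `Re ⟨h, φ⟩` -/

theorem integrable_conj_mul {h : AddCircle L → ℂ} (hh : Integrable h) (φ : Field L) :
    Integrable fun x => conj (h x) * φ x := by
  have h1 : Integrable fun x => conj (h x) :=
    ((Complex.conjCLE : ℂ ≃L[ℝ] ℂ) : ℂ →L[ℝ] ℂ).integrable_comp hh
  exact h1.mul_bdd (c := ‖φ‖) φ.continuous.aestronglyMeasurable
    (ae_of_all _ fun x => φ.norm_coe_le_norm x)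

theorem norm_innerL2_le {h : AddCircle L → ℂ} (hh : Integrable h) (φ : Field L) :
    ‖innerL2 L h φ‖ ≤ (∫ x, ‖h x‖) * ‖φ‖ := by
  unfold innerL2
  rw [← integral_mul_const]
  refine (norm_integral_le_integral_norm _).trans
    (integral_mono (integrable_conj_mul hh φ).norm (hh.norm.mul_const _) fun x => ?_)
  simp only [norm_mul, RCLike.norm_conj]
  gcongr
  exact φ.norm_coe_le_norm x

/-- The continuous linear functional `φ ↦ ⟨h, φ⟩`. -/
def innerCLM (h : AddCircle L → ℂ) (hh : Integrable h) : Field L →L[ℂ] ℂ :=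
  LinearMap.mkContinuous
    { toFun := fun φ => innerL2 L h φ
      map_add' := fun φ ψ => by
        unfold innerL2
        rw [← integral_add (integrable_conj_mul hh φ) (integrable_conj_mul hh ψ)]
        congr 1; ext x; simp [mul_add]
      map_smul' := fun c φ => by
        unfold innerL2
        rw [RingHom.id_apply, smul_eq_mul, ← integral_const_mul]
        congr 1; ext x; simp; ring }
    (∫ x, ‖h x‖) (fun φ => norm_innerL2_le hh φ)

@[simp] theorem innerCLM_apply (h : AddCircle L → ℂ) (hh : Integrable h) (φ : Field L) :
    innerCLM h hh φ = innerL2 L h φ := rfl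

/-- The continuous real functional `φ ↦ Re ⟨h, φ⟩`. -/
def reInnerCLM (h : AddCircle L → ℂ) (hh : Integrable h) : Field L →L[ℝ] ℝ :=
  Complex.reCLM.comp ((innerCLM h hh).restrictScalars ℝ)

@[simp] theorem reInnerCLM_apply (h : AddCircle L → ℂ) (hh : Integrable h) (φ : Field L) :
    reInnerCLM h hh φ = (innerL2 L h φ).re := rfl

theorem integrable_mode (k : ℤ) : Integrable (mode L k) := by
  have : (mode L k) = fun x => modeField L k x := by ext x; simp
  rw [this]
  exact (modeField L k).continuous.integrable_of_hasCompactSupport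
    (HasCompactSupport.of_compactSpace _)

theorem innerL2_conj_symm (f g : AddCircle L → ℂ) : innerL2 L f g = conj (innerL2 L g f) := by
  unfold innerL2
  rw [← integral_conj]
  congr 1; ext x; simp [mul_comm]

end Trigonometric

/-! ### Dyadic blocks of the Gaussian series and their exponential moments -/

section RandomSeries

variable (L m β : ℝ) [hL : Fact (0 < L)]

/-- The square root of the eigenvalue of `β⁻¹ (m² - Δ)⁻¹` on the mode `k`. -/
def amp (k : ℤ) : ℝ := (Real.sqrt (β * ((2 * Real.pi * k / L) ^ 2 + m ^ 2)))⁻¹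

/-- The real directions of the Gaussian series: the eigenfunctions `u_k` and `i u_k`, scaled by the
standard deviation of their coefficient. -/
def dir (i : ℤ × Bool) : Field L :=
  ((amp L m β i.1 : ℂ) * (bif i.2 then Complex.I else 1)) • modeField L i.1

/-- The dyadic block of frequencies `2 ^ j ≤ |k| < 2 ^ (j + 1)`. -/
def block (j : ℕ) : Finset ℤ :=
  (Finset.Icc (-(2 ^ (j + 1) : ℤ)) (2 ^ (j + 1))).filter
    fun k => k ≠ 0 ∧ Nat.log 2 k.natAbs = j

/-- The part of the Gaussian series carried by a dyadic block. -/
def blockField (j : ℕ) (ω : ℤ × Bool → ℝ) : Field L :=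
  ∑ i ∈ block j ×ˢ Finset.univ, ω i • dir L m β i

/-- The Gaussian series without the zero mode. -/
def tailField (ω : ℤ × Bool → ℝ) : Field L := ∑' j, blockField L m β j ω

/-- The `L²` mass of the Gaussian series without the zero mode. -/
def tailMass (ω : ℤ × Bool → ℝ) : ℝ≥0∞ :=
  ∑' k : ℤ, if k = 0 then 0 else
    ENNReal.ofReal (amp L m β k ^ 2 * (ω (k, false) ^ 2 + ω (k, true) ^ 2))

/-- The rate of the exponential square moments of the blocks. -/
def expRate : ℝ := β / (128 * L)

/-- An integrable majorant of `exp (ε ‖Ψ‖²)` for a Hölder-like norm of order `α`. -/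
def expMajorant (α : ℝ) (ω : ℤ × Bool → ℝ) : ℝ≥0∞ :=
  ENNReal.ofReal (Real.exp (expRate L β)) +
    ∑' j : ℕ, ENNReal.ofReal
        (Real.exp (-(expRate L β * (((2 : ℝ) ^ (1 - 2 * α)) ^ j - 1)))) *
      ENNReal.ofReal (Real.exp (expRate L β * 2 ^ j * ‖blockField L m β j ω‖ ^ 2))

/-- The Hölder-like norm of order `α` whose exponential square is `expMajorant`. -/
def holderNorm (α : ℝ) (ω : ℤ × Bool → ℝ) : ℝ :=
  Real.sqrt (Real.log (expMajorant L m β α ω).toReal / expRate L β)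

theorem mem_block {j : ℕ} {k : ℤ} : k ∈ block j ↔ k ≠ 0 ∧ Nat.log 2 k.natAbs = j := by
  simp only [block, Finset.mem_filter, Finset.mem_Icc, and_iff_right_iff_imp]
  rintro ⟨hk, hj⟩
  have : k.natAbs < 2 ^ (j + 1) := by
    rw [← hj]; exact Nat.lt_pow_succ_log_self (by norm_num) _
  rw [← abs_le, Int.abs_eq_natAbs]
  exact_mod_cast this.le

theorem two_pow_le_of_mem_block {j : ℕ} {k : ℤ} (h : k ∈ block j) : (2 : ℝ) ^ j ≤ |(k : ℝ)| := by
  rw [mem_block] at h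
  have := Nat.pow_log_le_self 2 (Int.natAbs_ne_zero.2 h.1)
  rw [h.2] at this
  rw [← Int.cast_abs, Int.abs_eq_natAbs]
  exact_mod_cast this

theorem abs_le_of_mem_block {j : ℕ} {k : ℤ} (h : k ∈ block j) : |k| ≤ (2 ^ (j + 1) : ℕ) := by
  have h' : k ∈ Finset.Icc (-(2 ^ (j + 1) : ℤ)) (2 ^ (j + 1)) := (Finset.mem_filter.1 h).1
  rw [Finset.mem_Icc, ← abs_le] at h'
  exact_mod_cast h'

theorem card_block_le (j : ℕ) : ((block j).card : ℝ) ≤ 4 * 2 ^ j := by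
  have h : block j ⊆ (Finset.Icc (-(2 ^ (j + 1) : ℤ)) (2 ^ (j + 1))).erase 0 := fun k hk =>
    Finset.mem_erase.2 ⟨(mem_block.1 hk).1, (Finset.mem_filter.1 hk).1⟩
  have h2 := Finset.card_le_card h
  rw [Finset.card_erase_of_mem (by simp), Int.card_Icc] at h2
  have h3 : ((2 ^ (j + 1) : ℤ) + 1 - -(2 ^ (j + 1) : ℤ)).toNat - 1 = 4 * 2 ^ j := by
    have : ((2 ^ (j + 1) : ℤ) + 1 - -(2 ^ (j + 1) : ℤ)) = ((4 * 2 ^ j + 1 : ℕ) : ℤ) := by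
      push_cast; ring
    rw [this, Int.toNat_natCast]; rfl
  rw [h3] at h2
  exact_mod_cast h2

variable {L m β}

theorem weight_pos (hm : 0 < m) (hβ : 0 < β) (k : ℤ) :
    0 < β * ((2 * Real.pi * k / L) ^ 2 + m ^ 2) := by positivity

theorem amp_pos (hm : 0 < m) (hβ : 0 < β) (k : ℤ) : 0 < amp L m β k :=
  inv_pos.2 (Real.sqrt_pos.2 (weight_pos hm hβ k))

theorem amp_sq (hm : 0 < m) (hβ : 0 < β) (k : ℤ) :
    amp L m β k ^ 2 = (β * ((2 * Real.pi * k / L) ^ 2 + m ^ 2))⁻¹ := by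
  rw [amp, inv_pow, Real.sq_sqrt (weight_pos hm hβ k).le]

theorem amp_sq_le (hm : 0 < m) (hβ : 0 < β) {k : ℤ} (hk : k ≠ 0) :
    amp L m β k ^ 2 ≤ L ^ 2 / β * (1 / (k : ℝ) ^ 2) := by
  have h0 : (0 : ℝ) < L := hL.out
  have hk' : (0 : ℝ) < (k : ℝ) ^ 2 := by positivity
  rw [amp_sq hm hβ]
  have : L ^ 2 / β * (1 / (k : ℝ) ^ 2) = (β * ((k : ℝ) ^ 2 / L ^ 2))⁻¹ := by
    field_simp
  rw [this]
  have hpi : (1 : ℝ) ≤ 4 * Real.pi ^ 2 := by nlinarith [Real.pi_gt_three]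
  gcongr
  have e : (2 * Real.pi * k / L) ^ 2 = 4 * Real.pi ^ 2 * ((k : ℝ) ^ 2 / L ^ 2) := by ring
  rw [e]
  have : (0 : ℝ) ≤ (k : ℝ) ^ 2 / L ^ 2 := by positivity
  nlinarith [sq_nonneg m]

theorem norm_dir_apply_sq (i : ℤ × Bool) (x : AddCircle L) :
    ‖dir L m β i x‖ ^ 2 = amp L m β i.1 ^ 2 / L := by
  have : ‖(bif i.2 then Complex.I else 1)‖ = 1 := by cases i.2 <;> simp
  rw [dir, ContinuousMap.smul_apply, smul_eq_mul, norm_mul, norm_mul, this, mul_one,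
    modeField_apply, mul_pow, norm_mode_sq, Complex.norm_real, Real.norm_eq_abs, sq_abs]
  rfl

/-- At most `8 · 2 ^ j` real directions, each of squared size at most `L / (β 4 ^ j)`. -/
theorem sum_norm_dir_sq_le (hm : 0 < m) (hβ : 0 < β) (j : ℕ) (x : AddCircle L) :
    ∑ i ∈ block j ×ˢ (Finset.univ : Finset Bool), ‖dir L m β i x‖ ^ 2 ≤
      8 * L / β * (1 / 2 ^ j) := by
  have h0 : (0 : ℝ) < L := hL.out
  calc ∑ i ∈ block j ×ˢ (Finset.univ : Finset Bool), ‖dir L m β i x‖ ^ 2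
      ≤ ∑ i ∈ block j ×ˢ (Finset.univ : Finset Bool), L / β * (1 / (2 ^ j) ^ 2) := by
        refine Finset.sum_le_sum fun i hi => ?_
        have hb := (Finset.mem_product.1 hi).1
        rw [norm_dir_apply_sq, div_le_iff₀ h0]
        refine (amp_sq_le hm hβ (mem_block.1 hb).1).trans ?_
        have h1 : ((2 : ℝ) ^ j) ^ 2 ≤ (i.1 : ℝ) ^ 2 := by
          rw [← sq_abs (i.1 : ℝ)]
          gcongr; exact two_pow_le_of_mem_block hb
        calc L ^ 2 / β * (1 / (i.1 : ℝ) ^ 2) ≤ L ^ 2 / β * (1 / ((2 : ℝ) ^ j) ^ 2) := by gcongr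
          _ = _ := by ring
    _ ≤ (4 * 2 ^ j * 2) * (L / β * (1 / (2 ^ j) ^ 2)) := by
        rw [Finset.sum_const, nsmul_eq_mul, Finset.card_product]
        push_cast
        gcongr
        · exact card_block_le j
        · simp
    _ = _ := by field_simp; ring

theorem expRate_pos (hβ : 0 < β) : 0 < expRate L β := by
  have := hL.out; unfold expRate; positivity

theorem measurable_blockField (j : ℕ) : Measurable (blockField L m β j) := by
  unfold blockField
  fun_prop

theorem blockField_apply (j : ℕ) (ω : ℤ × Bool → ℝ) (x : AddCircle L) :
    blockField L m β j ω x = ∑ i ∈ block j ×ˢ Finset.univ, ω i • dir L m β i x := by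
  simp [blockField]

theorem dir_mem_trigPoly {i : ℤ × Bool} {M : ℕ} (h : |i.1| ≤ M) : dir L m β i ∈ trigPoly L M :=
  Submodule.smul_mem _ _ (modeField_mem_trigPoly h)

theorem blockField_mem_trigPoly (j : ℕ) (ω : ℤ × Bool → ℝ) :
    blockField L m β j ω ∈ trigPoly L (2 ^ (j + 1)) := by
  refine Submodule.sum_mem _ fun i hi => ?_
  exact Submodule.smul_of_tower_mem _ _
    (dir_mem_trigPoly (abs_le_of_mem_block (Finset.mem_product.1 hi).1))

/-- The real and imaginary parts at a point are finite Gaussian sums of variance of order `2 ^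
(-j)`. The squared modulus is at most twice the larger square, so no independence of the two parts
is needed. -/
theorem lintegral_exp_blockField_apply_le (hm : 0 < m) (hβ : 0 < β) (j : ℕ) (x : AddCircle L) :
    ∫⁻ ω, ENNReal.ofReal (Real.exp (2 * (expRate L β * 2 ^ j) * ‖blockField L m β j ω x‖ ^ 2))
      ∂(whiteNoise (ℤ × Bool)) ≤ 2 * gaussSqMoment (1 / 4) := by
  have h0 : (0 : ℝ) < L := hL.out
  set s : Finset (ℤ × Bool) := block j ×ˢ Finset.univ
  set t := 4 * (expRate L β * 2 ^ j)
  have ht : 0 ≤ t := by have := expRate_pos (L := L) hβ; positivity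
  have hv := sum_norm_dir_sq_le (L := L) hm hβ j x
  -- The denominator `128 = 4 · 8 · 4` of `expRate` is chosen to give exactly `1 / 4` here.
  have htv : t * (8 * L / β * (1 / 2 ^ j)) ≤ 1 / 4 := by
    simp only [t, expRate]; apply le_of_eq; field_simp; norm_num
  have hre : t * ∑ i ∈ s, (dir L m β i x).re ^ 2 ≤ 1 / 4 := by
    refine le_trans (mul_le_mul_of_nonneg_left (le_trans (Finset.sum_le_sum fun i _ => ?_) hv) ht)
      htv
    rw [← Complex.normSq_eq_norm_sq, Complex.normSq_apply]; nlinarith [sq_nonneg (dir L m β i x).im]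
  have him : t * ∑ i ∈ s, (dir L m β i x).im ^ 2 ≤ 1 / 4 := by
    refine le_trans (mul_le_mul_of_nonneg_left (le_trans (Finset.sum_le_sum fun i _ => ?_) hv) ht)
      htv
    rw [← Complex.normSq_eq_norm_sq, Complex.normSq_apply]; nlinarith [sq_nonneg (dir L m β i x).re]
  have h1 := lintegral_exp_sq_sum_le s (fun i => (dir L m β i x).re) hre
  have h2 := lintegral_exp_sq_sum_le s (fun i => (dir L m β i x).im) him
  refine le_trans ?_ ((add_le_add h1 h2).trans_eq (two_mul _).symm)
  rw [← lintegral_add_left (by fun_prop)]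
  refine lintegral_mono fun ω => ?_
  rw [← ENNReal.ofReal_add (by positivity) (by positivity)]
  apply ENNReal.ofReal_le_ofReal
  have hX : (blockField L m β j ω x).re = ∑ i ∈ s, ω i * (dir L m β i x).re := by
    rw [blockField_apply, Complex.re_sum]; simp [s]
  have hY : (blockField L m β j ω x).im = ∑ i ∈ s, ω i * (dir L m β i x).im := by
    rw [blockField_apply, Complex.im_sum]; simp [s]
  have hn : ‖blockField L m β j ω x‖ ^ 2 = (∑ i ∈ s, ω i * (dir L m β i x).re) ^ 2 +
      (∑ i ∈ s, ω i * (dir L m β i x).im) ^ 2 := by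
    rw [← hX, ← hY, ← Complex.normSq_eq_norm_sq, Complex.normSq_apply]; ring
  rw [hn]
  set X := (∑ i ∈ s, ω i * (dir L m β i x).re) ^ 2
  set Y := (∑ i ∈ s, ω i * (dir L m β i x).im) ^ 2
  rcases le_total X Y with h | h
  · refine le_trans (Real.exp_le_exp.2 ?_) (le_add_of_nonneg_left (Real.exp_pos _).le)
    simp only [t]; nlinarith
  · refine le_trans (Real.exp_le_exp.2 ?_) (le_add_of_nonneg_right (Real.exp_pos _).le)
    simp only [t]; nlinarith

/-- The block has degree at most `2 ^ (j + 1)`, so its supremum is replaced by a mean over the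
circle at the price `4 · 2 ^ j + 1 ≤ 5 · 2 ^ j`; Tonelli then reduces to the moment at a point. -/
theorem lintegral_exp_blockField_le (hm : 0 < m) (hβ : 0 < β) (j : ℕ) :
    ∫⁻ ω, ENNReal.ofReal (Real.exp (expRate L β * 2 ^ j * ‖blockField L m β j ω‖ ^ 2))
      ∂(whiteNoise (ℤ × Bool)) ≤ ENNReal.ofReal (5 * 2 ^ j) * (2 * gaussSqMoment (1 / 4)) := by
  have h0 : (0 : ℝ) < L := hL.out
  have hη : 0 ≤ expRate L β * 2 ^ j := by have := expRate_pos (L := L) hβ; positivity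
  set c : ℝ := (2 * (2 ^ (j + 1) : ℕ) + 1) / L
  have hc : 0 ≤ c := by positivity
  have hcont : ∀ f : Field L, Continuous f := fun f => f.continuous
  have hb : ∀ ω, ENNReal.ofReal (Real.exp (expRate L β * 2 ^ j * ‖blockField L m β j ω‖ ^ 2)) ≤
      ENNReal.ofReal c * ∫⁻ x : AddCircle L, ENNReal.ofReal
        (Real.exp (2 * (expRate L β * 2 ^ j) * ‖blockField L m β j ω x‖ ^ 2)) := fun ω => by
    have hco := hcont (blockField L m β j ω)
    rw [← ofReal_integral_eq_lintegral_ofReal, ← ENNReal.ofReal_mul hc]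
    · exact ENNReal.ofReal_le_ofReal
        (exp_mul_norm_sq_le_of_mem_trigPoly (blockField_mem_trigPoly j ω) hη)
    · refine Continuous.integrable_of_hasCompactSupport ?_ (HasCompactSupport.of_compactSpace _)
      fun_prop
    · exact ae_of_all _ fun x => (Real.exp_pos _).le
  have hmeas : Measurable (fun p : (ℤ × Bool → ℝ) × AddCircle L => ENNReal.ofReal
        (Real.exp (2 * (expRate L β * 2 ^ j) * ‖blockField L m β j p.1 p.2‖ ^ 2))) := by
    simp_rw [blockField_apply]
    have : ∀ i, Measurable (dir L m β i : AddCircle L → ℂ) := fun i => (hcont _).measurable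
    fun_prop
  refine (lintegral_mono hb).trans ?_
  rw [lintegral_const_mul _ (Measurable.lintegral_prod_right hmeas),
    lintegral_lintegral_swap hmeas.aemeasurable]
  calc _ ≤ ENNReal.ofReal c * ∫⁻ x : AddCircle L, 2 * gaussSqMoment (1 / 4) := by
        gcongr with x
        exact lintegral_exp_blockField_apply_le hm hβ j x
    _ = ENNReal.ofReal c * ENNReal.ofReal L * (2 * gaussSqMoment (1 / 4)) := by
        rw [lintegral_const, AddCircle.measure_univ]; ring
    _ ≤ _ := by
        rw [← ENNReal.ofReal_mul hc]
        refine mul_le_mul' (ENNReal.ofReal_le_ofReal ?_) le_rfl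
        simp only [c]
        rw [div_mul_cancel₀ _ h0.ne']
        push_cast
        have : (1 : ℝ) ≤ 2 ^ j := one_le_pow₀ (by norm_num)
        rw [pow_succ]; linarith

/-- Take `K` with `c ^ K > 2`; the inequality `exp (-x) ≤ K! / x ^ K` at `x = ε c ^ j` then beats `2
^ j` geometrically. -/
theorem summable_exp_neg_geometric {ε c : ℝ} (hε : 0 < ε) (hc : 1 < c) :
    Summable fun j : ℕ => Real.exp (-(ε * (c ^ j - 1))) * (5 * 2 ^ j) := by
  obtain ⟨K, hK⟩ := pow_unbounded_of_one_lt 2 hc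
  have hcK : 0 < c ^ K := by positivity
  have hgeo : Summable fun j : ℕ => (5 * Real.exp ε * K.factorial / ε ^ K) * (2 / c ^ K) ^ j :=
    (summable_geometric_of_lt_one (by positivity) ((div_lt_one hcK).2 hK)).mul_left _
  refine Summable.of_nonneg_of_le (fun j => by positivity) (fun j => ?_) hgeo
  have h1 : (ε * c ^ j) ^ K / K.factorial ≤ Real.exp (ε * c ^ j) :=
    Real.pow_div_factorial_le_exp _ (by positivity) K
  have h2 : Real.exp (-(ε * c ^ j)) ≤ K.factorial / (ε * c ^ j) ^ K := by
    rw [Real.exp_neg, ← inv_div]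
    exact inv_anti₀ (by positivity) h1
  calc Real.exp (-(ε * (c ^ j - 1))) * (5 * 2 ^ j)
      = Real.exp (-(ε * c ^ j)) * (Real.exp ε * (5 * 2 ^ j)) := by
        rw [← mul_assoc (Real.exp _) (Real.exp _), ← Real.exp_add]; congr 2; ring
    _ ≤ K.factorial / (ε * c ^ j) ^ K * (Real.exp ε * (5 * 2 ^ j)) := by gcongr
    _ = _ := by rw [mul_pow, div_pow, ← pow_mul, ← pow_mul, mul_comm j K]; field_simp

theorem measurable_expMajorant (α : ℝ) : Measurable (expMajorant L m β α) := by
  unfold expMajorant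
  have := fun j => measurable_blockField (L := L) (m := m) (β := β) j
  fun_prop

/-- For `α < 1/2` the base `2 ^ (1 - 2 α)` exceeds `1`, so the weights in the majorant decay doubly
exponentially and outweigh the block moments of order `2 ^ j`. -/
theorem lintegral_expMajorant_lt_top (hm : 0 < m) (hβ : 0 < β) {α : ℝ} (hα : α < 1 / 2) :
    ∫⁻ ω, expMajorant L m β α ω ∂(whiteNoise (ℤ × Bool)) < ∞ := by
  have hbm := fun j => measurable_blockField (L := L) (m := m) (β := β) j
  have hε := expRate_pos (L := L) hβ
  set c : ℝ := 2 ^ (1 - 2 * α)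
  have hc : 1 < c := Real.one_lt_rpow (by norm_num) (by linarith)
  have hG : 2 * gaussSqMoment (1 / 4) ≠ ∞ :=
    ENNReal.mul_ne_top (by norm_num) (gaussSqMoment_lt_top (by norm_num)).ne
  unfold expMajorant
  rw [lintegral_add_left (by fun_prop), lintegral_const, measure_univ, mul_one,
    lintegral_tsum (fun j => by fun_prop)]
  refine ENNReal.add_lt_top.2 ⟨ENNReal.ofReal_lt_top, ?_⟩
  have hle : ∀ j : ℕ, ∫⁻ ω, ENNReal.ofReal (Real.exp (-(expRate L β * (c ^ j - 1)))) *
      ENNReal.ofReal (Real.exp (expRate L β * 2 ^ j * ‖blockField L m β j ω‖ ^ 2))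
        ∂(whiteNoise (ℤ × Bool)) ≤
      ENNReal.ofReal (Real.exp (-(expRate L β * (c ^ j - 1))) * (5 * 2 ^ j)) *
        (2 * gaussSqMoment (1 / 4)) := fun j => by
    rw [lintegral_const_mul _ (by fun_prop), ENNReal.ofReal_mul (Real.exp_pos _).le, mul_assoc]
    gcongr
    exact lintegral_exp_blockField_le hm hβ j
  refine (ENNReal.tsum_le_tsum hle).trans_lt ?_
  rw [ENNReal.tsum_mul_right]
  refine ENNReal.mul_lt_top ?_ hG.lt_top
  rw [← ENNReal.ofReal_tsum_of_nonneg (fun j => by positivity) (summable_exp_neg_geometric hε hc)]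
  exact ENNReal.ofReal_lt_top

theorem ae_expMajorant_lt_top (hm : 0 < m) (hβ : 0 < β) {α : ℝ} (hα : α < 1 / 2) :
    ∀ᵐ ω ∂(whiteNoise (ℤ × Bool)), expMajorant L m β α ω < ∞ :=
  ae_lt_top (measurable_expMajorant α) (lintegral_expMajorant_lt_top hm hβ hα).ne

theorem one_le_expMajorant (hβ : 0 < β) (α : ℝ) (ω : ℤ × Bool → ℝ) :
    1 ≤ expMajorant L m β α ω := by
  refine le_trans ?_ le_self_add
  rw [← ENNReal.ofReal_one]
  exact ENNReal.ofReal_le_ofReal (Real.one_le_exp (expRate_pos hβ).le)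

theorem expMajorant_eq (hβ : 0 < β) {α : ℝ} {ω : ℤ × Bool → ℝ} (h : expMajorant L m β α ω < ∞) :
    expMajorant L m β α ω =
      ENNReal.ofReal (Real.exp (expRate L β * holderNorm L m β α ω ^ 2)) := by
  have hε := expRate_pos (L := L) hβ
  have h1 : 1 ≤ (expMajorant L m β α ω).toReal := by
    have := ENNReal.toReal_mono h.ne (one_le_expMajorant hβ α ω)
    simpa using this
  rw [holderNorm, Real.sq_sqrt (div_nonneg (Real.log_nonneg h1) hε.le), mul_div_cancel₀ _ hε.ne',
    Real.exp_log (by linarith), ENNReal.ofReal_toReal h.ne]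

theorem holderNorm_nonneg (α : ℝ) (ω : ℤ × Bool → ℝ) : 0 ≤ holderNorm L m β α ω :=
  Real.sqrt_nonneg _

theorem measurable_holderNorm (α : ℝ) : Measurable (holderNorm L m β α) := by
  unfold holderNorm
  have := measurable_expMajorant (L := L) (m := m) (β := β) α
  fun_prop

/-- Put `c = 2 ^ (1 - 2 α)`, and let `b` be the block norm and `y` the Hölder norm. The `j`-th term
of the majorant gives `2 ^ j b² ≤ y² + c ^ j - 1`. If the bound failed, then `c ^ j y² < 2 ^ j b²`,
hence `(c ^ j - 1) (y² - 1) < 0`. But `c ≥ 1`, and the constant term of the majorant forces `y ≥ 1`.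
-/
theorem norm_blockField_le (hβ : 0 < β) {α : ℝ} (hα : α < 1 / 2) {ω : ℤ × Bool → ℝ}
    (h : expMajorant L m β α ω < ∞) (j : ℕ) :
    ‖blockField L m β j ω‖ ≤ ((2 : ℝ) ^ (-α)) ^ j * holderNorm L m β α ω := by
  have hε := expRate_pos (L := L) hβ
  set ε := expRate L β
  set y := holderNorm L m β α ω
  set b := ‖blockField L m β j ω‖
  set c : ℝ := 2 ^ (1 - 2 * α)
  set d : ℝ := (2 : ℝ) ^ (-α)
  have hd : 0 < d := Real.rpow_pos_of_pos (by norm_num) _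
  have hy : 0 ≤ y := holderNorm_nonneg _ _
  have hcd : c = 2 * d ^ 2 := by
    simp only [c, d]
    rw [← Real.rpow_natCast, ← Real.rpow_mul (by norm_num), sub_eq_add_neg,
      Real.rpow_add (by norm_num), Real.rpow_one]
    congr 2; push_cast; ring
  by_contra hlt
  push Not at hlt
  have hb0 : 0 ≤ d ^ j * y := by positivity
  have hsq : (d ^ j * y) ^ 2 < b ^ 2 := by gcongr
  have e1 : ENNReal.ofReal (Real.exp ε) ≤ expMajorant L m β α ω := le_self_add
  have e2 : ENNReal.ofReal (Real.exp (-(ε * (c ^ j - 1)))) *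
      ENNReal.ofReal (Real.exp (ε * 2 ^ j * b ^ 2)) ≤ expMajorant L m β α ω :=
    le_trans (ENNReal.le_tsum j) le_add_self
  rw [expMajorant_eq hβ h] at e1 e2
  rw [← ENNReal.ofReal_mul (Real.exp_pos _).le, ← Real.exp_add,
    ENNReal.ofReal_le_ofReal_iff (Real.exp_pos _).le, Real.exp_le_exp] at e2
  rw [ENNReal.ofReal_le_ofReal_iff (Real.exp_pos _).le, Real.exp_le_exp] at e1
  have hy1 : 1 ≤ y ^ 2 := by
    change ε ≤ ε * y ^ 2 at e1
    nlinarith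
  have e3 : -(c ^ j - 1) + 2 ^ j * b ^ 2 ≤ y ^ 2 := by
    change -(ε * (c ^ j - 1)) + ε * 2 ^ j * b ^ 2 ≤ ε * y ^ 2 at e2
    have : ε * (-(c ^ j - 1) + 2 ^ j * b ^ 2) ≤ ε * y ^ 2 := by linarith
    exact le_of_mul_le_mul_left this hε
  have e4 : (2 : ℝ) ^ j * (d ^ j * y) ^ 2 = c ^ j * y ^ 2 := by
    rw [hcd, mul_pow, mul_pow, ← pow_mul, ← pow_mul, mul_comm j 2]; ring
  have e5 : c ^ j * y ^ 2 < 2 ^ j * b ^ 2 := by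
    rw [← e4]; gcongr
  have hc1 : 1 ≤ c ^ j :=
    one_le_pow₀ (Real.one_le_rpow (by norm_num) (by linarith))
  nlinarith [mul_nonneg (sub_nonneg.2 hc1) (sub_nonneg.2 hy1)]

end RandomSeries

/-! ### Convergence of the series, Parseval for its mass, and correlation -/

section Convergence

variable {L m β : ℝ} [hL : Fact (0 < L)]

theorem summable_norm_blockField (hβ : 0 < β) {α : ℝ} (hα0 : 0 < α) (hα : α < 1 / 2)
    {ω : ℤ × Bool → ℝ} (h : expMajorant L m β α ω < ∞) :
    Summable fun j => ‖blockField L m β j ω‖ := by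
  have hd : (2 : ℝ) ^ (-α) < 1 := Real.rpow_lt_one_of_one_lt_of_neg (by norm_num) (by linarith)
  exact Summable.of_nonneg_of_le (fun _ => norm_nonneg _) (norm_blockField_le hβ hα h)
    ((summable_geometric_of_lt_one (by positivity) hd).mul_right _)

theorem hasSum_blockField (hβ : 0 < β) {α : ℝ} (hα0 : 0 < α) (hα : α < 1 / 2)
    {ω : ℤ × Bool → ℝ} (h : expMajorant L m β α ω < ∞) :
    HasSum (fun j => blockField L m β j ω) (tailField L m β ω) :=
  (summable_norm_blockField hβ hα0 hα h).of_norm.hasSum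

variable (L m β) in
/-- The complex Fourier coefficient of the Gaussian series. -/
def coeff (ω : ℤ × Bool → ℝ) (k : ℤ) : ℂ := amp L m β k * (ω (k, false) + ω (k, true) * Complex.I)

theorem sum_dir (ω : ℤ × Bool → ℝ) (k : ℤ) :
    ∑ b : Bool, ω (k, b) • dir L m β (k, b) = coeff L m β ω k • modeField L k := by
  ext x
  simp [dir, coeff]
  ring

theorem sum_product_dir (s : Finset ℤ) (ω : ℤ × Bool → ℝ) :
    ∑ i ∈ s ×ˢ Finset.univ, ω i • dir L m β i = ∑ k ∈ s, coeff L m β ω k • modeField L k := by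
  rw [Finset.sum_product]
  exact Finset.sum_congr rfl fun k _ => sum_dir ω k

theorem innerCLM_mode_modeField (j k : ℤ) :
    innerCLM (mode L j) (integrable_mode j) (modeField L k) = if j = k then 1 else 0 := by
  rw [innerCLM_apply, ← innerL2_mode_mode (L := L)]
  congr 1; ext x; simp

theorem innerL2_mode_blockField (ω : ℤ × Bool → ℝ) (j : ℕ) (k : ℤ) :
    innerL2 L (mode L k) (blockField L m β j ω) =
      if k ∈ block j then coeff L m β ω k else 0 := by
  rw [← innerCLM_apply _ (integrable_mode k), blockField, sum_product_dir, map_sum]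
  simp_rw [map_smul, innerCLM_mode_modeField]
  simp

theorem innerL2_mode_tailField (hβ : 0 < β) {α : ℝ} (hα0 : 0 < α) (hα : α < 1 / 2)
    {ω : ℤ × Bool → ℝ} (h : expMajorant L m β α ω < ∞) (k : ℤ) :
    innerL2 L (mode L k) (tailField L m β ω) = if k = 0 then 0 else coeff L m β ω k := by
  have h1 := (hasSum_blockField hβ hα0 hα h).mapL (innerCLM (mode L k) (integrable_mode k))
  simp_rw [innerCLM_apply, innerL2_mode_blockField] at h1
  refine h1.unique ?_
  split_ifs with hk
  · subst hk
    simp [mem_block]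
  · have h2 := hasSum_single (f := fun j => if k ∈ block j then coeff L m β ω k else 0)
      (Nat.log 2 k.natAbs) fun j hj => if_neg fun hb => hj (mem_block.1 hb).2.symm
    rwa [if_pos (mem_block.2 ⟨hk, rfl⟩)] at h2

theorem norm_coeff_sq (ω : ℤ × Bool → ℝ) (k : ℤ) : ‖coeff L m β ω k‖ ^ 2 =
    amp L m β k ^ 2 * (ω (k, false) ^ 2 + ω (k, true) ^ 2) := by
  rw [coeff, norm_mul, mul_pow, Complex.norm_real, Real.norm_eq_abs, sq_abs,
    ← Complex.normSq_eq_norm_sq (_ + _), Complex.normSq_add_mul_I]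

theorem innerL2_mode_add_tailField (hβ : 0 < β) {α : ℝ} (hα0 : 0 < α) (hα : α < 1 / 2)
    {ω : ℤ × Bool → ℝ} (h : expMajorant L m β α ω < ∞) (z : ℂ) (k : ℤ) :
    innerL2 L (mode L k) (z • modeField L 0 + tailField L m β ω : Field L) =
      if k = 0 then z else coeff L m β ω k := by
  rw [← innerCLM_apply _ (integrable_mode k), map_add, map_smul, innerCLM_mode_modeField,
    innerCLM_apply, innerL2_mode_tailField hβ hα0 hα h]
  split_ifs <;> simp

theorem N_nonneg (φ : Field L) : 0 ≤ N L φ := by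
  rw [integral_norm_sq_eq]; exact integral_nonneg fun _ => by positivity

/-- Parseval separates the mass of the zero mode from that of the others. This additivity is what
makes the conditioning explicit. -/
theorem ofReal_N_eq (hβ : 0 < β) {α : ℝ} (hα0 : 0 < α) (hα : α < 1 / 2)
    {ω : ℤ × Bool → ℝ} (h : expMajorant L m β α ω < ∞) (z : ℂ) :
    ENNReal.ofReal (N L (z • modeField L 0 + tailField L m β ω)) =
      ENNReal.ofReal (‖z‖ ^ 2) + tailMass L m β ω := by
  have h1 := hasSum_norm_innerL2_mode_sq (z • modeField L 0 + tailField L m β ω)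
  rw [← h1.tsum_eq, ENNReal.ofReal_tsum_of_nonneg (fun _ => by positivity) h1.summable,
    ENNReal.tsum_eq_add_tsum_ite 0, tailMass]
  simp_rw [innerL2_mode_add_tailField hβ hα0 hα h]
  simp only [if_true]
  congr 1
  refine tsum_congr fun k => ?_
  split_ifs
  · rfl
  · rw [norm_coeff_sq]

theorem tailMass_lt_top (hβ : 0 < β) {α : ℝ} (hα0 : 0 < α) (hα : α < 1 / 2)
    {ω : ℤ × Bool → ℝ} (h : expMajorant L m β α ω < ∞) : tailMass L m β ω < ∞ := by
  have h1 := ofReal_N_eq hβ hα0 hα h 0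
  refine lt_of_le_of_lt ?_ (ENNReal.ofReal_lt_top (r := N L (0 • modeField L 0 + tailField L m β ω)))
  have h2 : (0 : ℂ) • modeField L 0 = (0 : Field L) := zero_smul _ _
  rw [zero_smul, ← h2, h1]
  exact le_add_self

theorem N_eq (hβ : 0 < β) {α : ℝ} (hα0 : 0 < α) (hα : α < 1 / 2)
    {ω : ℤ × Bool → ℝ} (h : expMajorant L m β α ω < ∞) (z : ℂ) :
    N L (z • modeField L 0 + tailField L m β ω) = ‖z‖ ^ 2 + (tailMass L m β ω).toReal := by
  have h1 := congrArg ENNReal.toReal (ofReal_N_eq hβ hα0 hα h z)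
  rwa [ENNReal.toReal_ofReal (N_nonneg _), ENNReal.toReal_add ENNReal.ofReal_ne_top
    (tailMass_lt_top hβ hα0 hα h).ne, ENNReal.toReal_ofReal (by positivity)] at h1

theorem aemeasurable_tailField (hm : 0 < m) (hβ : 0 < β) :
    AEMeasurable (tailField L m β) (whiteNoise (ℤ × Bool)) := by
  refine aemeasurable_of_tendsto_metrizable_ae atTop
    (f := fun J ω => ∑ j ∈ Finset.range J, blockField L m β j ω) (fun J => ?_) ?_
  · have := fun j => measurable_blockField (L := L) (m := m) (β := β) j
    fun_prop
  -- Any order in `(0, 1/2)` would do; `1 / 4` is used wherever only convergence matters.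
  · filter_upwards [ae_expMajorant_lt_top (L := L) hm hβ (by norm_num : (1 / 4 : ℝ) < 1 / 2)] with ω hω
    exact (hasSum_blockField hβ (by norm_num) (by norm_num) hω).tendsto_sum_nat

/-! ### Correlation of the majorant with decreasing functions -/

theorem measurable_tailMass : Measurable (tailMass L m β) := by
  unfold tailMass
  refine Measurable.tsum fun k => ?_
  split_ifs <;> fun_prop

theorem tailMass_update_le (i : ℤ × Bool) (ω : ℤ × Bool → ℝ) {a b : ℝ} (hab : |a| ≤ |b|) :
    tailMass L m β (Function.update ω i a) ≤ tailMass L m β (Function.update ω i b) := by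
  have hsq : ∀ k, Function.update ω i a k ^ 2 ≤ Function.update ω i b k ^ 2 := fun k => by
    by_cases hk : k = i
    · subst hk; simpa using sq_le_sq.2 hab
    · simp [Function.update_of_ne hk]
  unfold tailMass
  gcongr with k
  split_ifs
  · exact le_rfl
  · exact ENNReal.ofReal_le_ofReal
      (mul_le_mul_of_nonneg_left (add_le_add (hsq _) (hsq _)) (sq_nonneg _))

theorem absAnti_tailMass {g : ℝ≥0∞ → ℝ≥0∞} (hg : Antitone g) :
    AbsAnti fun ω => g (tailMass L m β ω) :=
  fun i ω _ _ hab => hg (tailMass_update_le i ω hab)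

theorem blockField_update (j : ℕ) (i : ℤ × Bool) (ω : ℤ × Bool → ℝ) :
    ∃ v w : Field L, ∀ a, blockField L m β j (Function.update ω i a) = v + a • w := by
  by_cases hi : i ∈ block j ×ˢ (Finset.univ : Finset Bool)
  · refine ⟨∑ k ∈ (block j ×ˢ Finset.univ).erase i, ω k • dir L m β k, dir L m β i, fun a => ?_⟩
    rw [blockField, ← Finset.add_sum_erase _ _ hi, Function.update_self, add_comm]
    congr 1
    refine Finset.sum_congr rfl fun k hk => ?_
    rw [Function.update_of_ne (Finset.ne_of_mem_erase hk)]
  · refine ⟨blockField L m β j ω, 0, fun a => ?_⟩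
    rw [smul_zero, add_zero]
    refine Finset.sum_congr rfl fun k hk => ?_
    rw [Function.update_of_ne (by rintro rfl; exact hi hk)]

theorem convexOn_exp_norm_sq {E : Type*} [NormedAddCommGroup E] [NormedSpace ℝ E] {c : ℝ}
    (hc : 0 ≤ c) (v w : E) :
    ConvexOn ℝ Set.univ fun a : ℝ => Real.exp (c * ‖v + a • w‖ ^ 2) := by
  have h1 : ConvexOn ℝ Set.univ fun a : ℝ => ‖v + a • w‖ := by
    refine ⟨convex_univ, fun a _ b _ s t hs ht hst => ?_⟩
    have : v + (s • a + t • b) • w = s • (v + a • w) + t • (v + b • w) := by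
      have hv : v = (s + t) • v := by rw [hst, one_smul]
      conv_lhs => rw [hv]
      simp only [smul_eq_mul]; module
    change ‖v + (s • a + t • b) • w‖ ≤ s • ‖v + a • w‖ + t • ‖v + b • w‖
    rw [this]
    refine (norm_add_le _ _).trans_eq ?_
    rw [norm_smul, norm_smul, Real.norm_of_nonneg hs, Real.norm_of_nonneg ht]; rfl
  have h2 : ConvexOn ℝ Set.univ fun a : ℝ => c * ‖v + a • w‖ ^ 2 :=
    (h1.pow (fun _ _ => norm_nonneg _) 2).smul hc
  refine ⟨convex_univ, fun a ha b hb s t hs ht hst => ?_⟩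
  exact (Real.exp_le_exp.2 (h2.2 ha hb hs ht hst)).trans
    (convexOn_exp.2 (Set.mem_univ _) (Set.mem_univ _) hs ht hst)

/-- A block is affine in each coordinate, so the exponential of its squared norm is convex in that
coordinate. -/
theorem evenMono_exp_blockField (j : ℕ) {c : ℝ} (hc : 0 ≤ c) :
    EvenMono fun ω => ENNReal.ofReal (Real.exp (c * ‖blockField L m β j ω‖ ^ 2)) := by
  intro i ω a b hab
  obtain ⟨v, w, h⟩ := blockField_update (L := L) (m := m) (β := β) j i ω
  simp only [h]
  rw [← ENNReal.ofReal_add (by positivity) (by positivity),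
    ← ENNReal.ofReal_add (by positivity) (by positivity)]
  exact ENNReal.ofReal_le_ofReal (add_neg_le_of_convexOn (convexOn_exp_norm_sq hc v w) hab)

theorem lintegral_add_tsum_mul_le {Ω : Type*} [MeasurableSpace Ω] {μ : Measure Ω}
    [IsProbabilityMeasure μ] (c : ℝ≥0∞) (w : ℕ → ℝ≥0∞) {F : ℕ → Ω → ℝ≥0∞} {H : Ω → ℝ≥0∞}
    (hF : ∀ j, Measurable (F j)) (hH : Measurable H)
    (h : ∀ j, ∫⁻ ω, F j ω * H ω ∂μ ≤ (∫⁻ ω, F j ω ∂μ) * ∫⁻ ω, H ω ∂μ) :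
    ∫⁻ ω, (c + ∑' j, w j * F j ω) * H ω ∂μ ≤
      (∫⁻ ω, c + ∑' j, w j * F j ω ∂μ) * ∫⁻ ω, H ω ∂μ := by
  have e1 : ∀ ω, (c + ∑' j, w j * F j ω) * H ω = c * H ω + ∑' j, w j * (F j ω * H ω) := fun ω => by
    rw [add_mul, ← ENNReal.tsum_mul_right]; simp_rw [mul_assoc]
  have hm : ∀ j, Measurable fun ω => w j * (F j ω * H ω) := fun j =>
    ((hF j).mul hH).const_mul (w j)
  simp_rw [e1]
  rw [lintegral_add_left (hH.const_mul c), lintegral_add_left measurable_const,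
    lintegral_const_mul _ hH, lintegral_const, measure_univ, mul_one, add_mul,
    lintegral_tsum (fun j => (hm j).aemeasurable),
    lintegral_tsum (fun j => ((hF j).const_mul (w j)).aemeasurable), ← ENNReal.tsum_mul_right]
  refine add_le_add le_rfl (ENNReal.tsum_le_tsum fun j => ?_)
  have hm' : Measurable fun ω => F j ω * H ω := (hF j).mul hH
  rw [lintegral_const_mul _ hm', lintegral_const_mul _ (hF j), mul_assoc]
  exact mul_le_mul' le_rfl (h j)

/-- The majorant depends on infinitely many coordinates, but each term of its series on finitely
many. The correlation inequality holds term by term and survives summation with nonnegative weights.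
-/
theorem lintegral_expMajorant_mul_le (hβ : 0 < β) (α : ℝ) {H : (ℤ × Bool → ℝ) → ℝ≥0∞}
    (hH : Measurable H) (hHa : AbsAnti H) :
    ∫⁻ ω, expMajorant L m β α ω * H ω ∂(whiteNoise (ℤ × Bool)) ≤
      (∫⁻ ω, expMajorant L m β α ω ∂(whiteNoise (ℤ × Bool))) *
        ∫⁻ ω, H ω ∂(whiteNoise (ℤ × Bool)) := by
  have hε := expRate_pos (L := L) hβ
  have hF : ∀ j : ℕ, Measurable fun ω : ℤ × Bool → ℝ =>
      ENNReal.ofReal (Real.exp (expRate L β * 2 ^ j * ‖blockField L m β j ω‖ ^ 2)) := fun j => by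
    have := measurable_blockField (L := L) (m := m) (β := β) j
    fun_prop
  refine lintegral_add_tsum_mul_le _ _ hF hH fun j => ?_
  refine lintegral_mul_le_of_evenMono_of_absAnti (block j ×ˢ Finset.univ) (hF j) hH ?_
    (evenMono_exp_blockField j (by positivity)) hHa
  intro x y hxy
  have : blockField L m β j x = blockField L m β j y :=
    Finset.sum_congr rfl fun k hk => by rw [hxy k hk]
  simp only [this]

end Convergence

/-! ### Existence of the reference measure -/

section ReferenceMeasure

variable {L m β : ℝ} [hL : Fact (0 < L)]

/-- The frequencies of the partial sums of the Gaussian series. -/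
def freqs (J : ℕ) : Finset ℤ := insert 0 ((Finset.range J).biUnion block)

variable (L m β) in
/-- The full Gaussian series. -/
def gaussField (ω : ℤ × Bool → ℝ) : Field L :=
  coeff L m β ω 0 • modeField L 0 + tailField L m β ω

variable (L m β) in
/-- The partial sums of the Gaussian series. -/
def partialField (J : ℕ) (ω : ℤ × Bool → ℝ) : Field L :=
  ∑ i ∈ freqs J ×ˢ Finset.univ, ω i • dir L m β i

theorem partialField_eq (J : ℕ) (ω : ℤ × Bool → ℝ) :
    partialField L m β J ω = coeff L m β ω 0 • modeField L 0 +
      ∑ j ∈ Finset.range J, blockField L m β j ω := by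
  rw [partialField, sum_product_dir, freqs, Finset.sum_insert (by simp [mem_block]),
    Finset.sum_biUnion]
  · congr 1
    exact Finset.sum_congr rfl fun j _ => by rw [blockField, sum_product_dir]
  · intro i _ j _ hij
    refine Finset.disjoint_left.2 fun k h1 h2 => hij ?_
    rw [← (mem_block.1 h1).2, (mem_block.1 h2).2]

theorem tendsto_freqs : Tendsto freqs atTop atTop := by
  refine tendsto_atTop_finset_of_monotone (fun a b hab => ?_) fun k => ?_
  · exact Finset.insert_subset_insert _
      (Finset.biUnion_subset_biUnion_of_subset_left _ (Finset.range_mono hab))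
  · by_cases hk : k = 0
    · exact ⟨0, by simp [freqs, hk]⟩
    · refine ⟨Nat.log 2 k.natAbs + 1, Finset.mem_insert_of_mem (Finset.mem_biUnion.2
        ⟨Nat.log 2 k.natAbs, by simp, mem_block.2 ⟨hk, rfl⟩⟩)⟩

variable (L m β) in
/-- A square integrable bound for the partial sums of the Gaussian series. -/
def fieldBound (ω : ℤ × Bool → ℝ) : ℝ :=
  ‖dir L m β (0, false)‖ * |ω (0, false)| + ‖dir L m β (0, true)‖ * |ω (0, true)| +
    (1 - (2 : ℝ) ^ (-(1 / 4) : ℝ))⁻¹ * holderNorm L m β (1 / 4) ω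

theorem norm_partialField_le (hβ : 0 < β) {ω : ℤ × Bool → ℝ}
    (h : expMajorant L m β (1 / 4) ω < ∞) (J : ℕ) :
    ‖partialField L m β J ω‖ ≤ fieldBound L m β ω := by
  have hd : (2 : ℝ) ^ (-(1 / 4) : ℝ) < 1 :=
    Real.rpow_lt_one_of_one_lt_of_neg (by norm_num) (by norm_num)
  rw [partialField_eq, ← sum_dir]
  refine (norm_add_le _ _).trans (add_le_add ?_ ?_)
  · refine (norm_sum_le _ _).trans_eq ?_
    rw [Fintype.sum_bool, norm_smul, norm_smul, add_comm]
    simp only [Real.norm_eq_abs]; ring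
  · refine (norm_sum_le _ _).trans ((Finset.sum_le_sum fun j _ =>
      norm_blockField_le hβ (by norm_num) h j).trans ?_)
    rw [← Finset.sum_mul]
    gcongr
    · exact holderNorm_nonneg _ _
    · rw [← tsum_geometric_of_lt_one (by positivity) hd]
      exact (summable_geometric_of_lt_one (by positivity) hd).sum_le_tsum _
        fun _ _ => by positivity

theorem tendsto_partialField (hβ : 0 < β) {ω : ℤ × Bool → ℝ}
    (h : expMajorant L m β (1 / 4) ω < ∞) :
    Tendsto (fun J => partialField L m β J ω) atTop (𝓝 (gaussField L m β ω)) := by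
  simp_rw [partialField_eq]
  exact ((hasSum_blockField hβ (by norm_num) (by norm_num) h).tendsto_sum_nat).const_add _

/-- From `x + 1 ≤ exp x`, the square is dominated by a multiple of the integrable majorant. -/
theorem memLp_holderNorm (hm : 0 < m) (hβ : 0 < β) {α : ℝ} (hα : α < 1 / 2) :
    MemLp (holderNorm L m β α) 2 (whiteNoise (ℤ × Bool)) := by
  have hε := expRate_pos (L := L) hβ
  rw [memLp_two_iff_integrable_sq (measurable_holderNorm α).aestronglyMeasurable]
  have hi : Integrable (fun ω => (expRate L β)⁻¹ * (expMajorant L m β α ω).toReal)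
      (whiteNoise (ℤ × Bool)) :=
    (integrable_toReal_of_lintegral_ne_top (measurable_expMajorant α).aemeasurable
      (lintegral_expMajorant_lt_top hm hβ hα).ne).const_mul _
  refine hi.mono' ((measurable_holderNorm α).pow_const 2).aestronglyMeasurable ?_
  filter_upwards [ae_expMajorant_lt_top (L := L) hm hβ hα] with ω hω
  rw [expMajorant_eq hβ hω, ENNReal.toReal_ofReal (Real.exp_pos _).le, Real.norm_eq_abs, abs_sq,
    inv_mul_eq_div, le_div_iff₀ hε]
  linarith [Real.add_one_le_exp (expRate L β * holderNorm L m β α ω ^ 2)]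

theorem memLp_fieldBound (hm : 0 < m) (hβ : 0 < β) :
    MemLp (fieldBound L m β) 2 (whiteNoise (ℤ × Bool)) := by
  have hc : ∀ i : ℤ × Bool, MemLp (fun ω : ℤ × Bool → ℝ => |ω i|) 2 (whiteNoise (ℤ × Bool)) :=
    fun i => ((memLp_id_gaussianReal' 2 (by norm_num)).comp_measurePreserving
      (measurePreserving_eval_infinitePi (fun _ : ℤ × Bool => gaussianReal 0 1) i)).abs
  exact (((hc _).const_mul _).add ((hc _).const_mul _)).add
    ((memLp_holderNorm hm hβ (by norm_num)).const_mul _)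

theorem aemeasurable_gaussField (hm : 0 < m) (hβ : 0 < β) :
    AEMeasurable (gaussField L m β) (whiteNoise (ℤ × Bool)) := by
  have := aemeasurable_tailField (L := L) hm hβ
  unfold gaussField coeff
  fun_prop

theorem integral_sq_sum_whiteNoise {ι : Type*} (s : Finset ι) (b : ι → ℝ) :
    ∫ ω, (∑ i ∈ s, ω i * b i) ^ 2 ∂(whiteNoise ι) = ∑ i ∈ s, b i ^ 2 := by
  have hmeas : Measurable fun ω : ι → ℝ => ∑ i ∈ s, ω i * b i := by fun_prop
  have h := integral_map (μ := whiteNoise ι) (φ := fun ω => ∑ i ∈ s, ω i * b i)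
    (f := fun x => x ^ 2) hmeas.aemeasurable (by fun_prop)
  rw [← h, map_sum_whiteNoise]
  have hv := variance_fun_id_gaussianReal (μ := 0) (v := (∑ i ∈ s, b i ^ 2).toNNReal)
  rw [variance_of_integral_eq_zero (by fun_prop) (by simp)] at hv
  rw [hv, Real.coe_toNNReal _ (Finset.sum_nonneg fun _ _ => sq_nonneg _)]

theorem dual_partialField (ℓ : Field L →L[ℝ] ℝ) (J : ℕ) (ω : ℤ × Bool → ℝ) :
    ℓ (partialField L m β J ω) = ∑ i ∈ freqs J ×ˢ Finset.univ, ω i * ℓ (dir L m β i) := by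
  simp [partialField]

theorem abs_dual_partialField_le (hβ : 0 < β) (ℓ : Field L →L[ℝ] ℝ) {ω : ℤ × Bool → ℝ}
    (h : expMajorant L m β (1 / 4) ω < ∞) (J : ℕ) :
    ℓ (partialField L m β J ω) ^ 2 ≤ ‖ℓ‖ ^ 2 * fieldBound L m β ω ^ 2 := by
  rw [← mul_pow, ← sq_abs]
  gcongr
  exact (ℓ.le_opNorm _).trans (by gcongr; exact norm_partialField_le hβ h J)

theorem tendsto_sum_dual_sq (hm : 0 < m) (hβ : 0 < β) (ℓ : Field L →L[ℝ] ℝ) :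
    Tendsto (fun J => ∑ i ∈ freqs J ×ˢ Finset.univ, ℓ (dir L m β i) ^ 2) atTop
      (𝓝 (∫ ω, ℓ (gaussField L m β ω) ^ 2 ∂(whiteNoise (ℤ × Bool)))) := by
  have hae := ae_expMajorant_lt_top (L := L) hm hβ (by norm_num : (1 / 4 : ℝ) < 1 / 2)
  have h := tendsto_integral_of_dominated_convergence (μ := whiteNoise (ℤ × Bool))
    (F := fun J ω => ℓ (partialField L m β J ω) ^ 2) (f := fun ω => ℓ (gaussField L m β ω) ^ 2)
    (fun ω => ‖ℓ‖ ^ 2 * fieldBound L m β ω ^ 2) (fun J => ?_)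
    ((memLp_fieldBound hm hβ).integrable_sq.const_mul _) (fun J => ?_) ?_
  · simp_rw [dual_partialField, integral_sq_sum_whiteNoise] at h
    exact h
  · have : Measurable fun ω => ℓ (partialField L m β J ω) ^ 2 := by
      simp_rw [dual_partialField]; fun_prop
    exact this.aestronglyMeasurable
  · filter_upwards [hae] with ω hω
    rw [Real.norm_eq_abs, abs_sq]
    exact abs_dual_partialField_le hβ ℓ hω J
  · filter_upwards [hae] with ω hω
    exact ((ℓ.continuous.tendsto _).comp (tendsto_partialField hβ hω)).pow 2

/-- The images of the partial sums are centred Gaussian variables whose variances converge, by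
`tendsto_sum_dual_sq`. They converge almost surely, so the characteristic functions pass to the
limit. -/
theorem map_dual_gaussField (hm : 0 < m) (hβ : 0 < β) (ℓ : Field L →L[ℝ] ℝ) :
    ((whiteNoise (ℤ × Bool)).map (gaussField L m β)).map ℓ =
      gaussianReal 0 (∫ ω, ℓ (gaussField L m β ω) ^ 2 ∂(whiteNoise (ℤ × Bool))).toNNReal := by
  have hae := ae_expMajorant_lt_top (L := L) hm hβ (by norm_num : (1 / 4 : ℝ) < 1 / 2)
  have hΦ := aemeasurable_gaussField (L := L) hm hβ
  have hℓ : Measurable ℓ := ℓ.continuous.measurable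
  rw [AEMeasurable.map_map_of_aemeasurable hℓ.aemeasurable hΦ]
  have hℓΦ : AEMeasurable (ℓ ∘ gaussField L m β) (whiteNoise (ℤ × Bool)) :=
    hℓ.comp_aemeasurable hΦ
  have : IsProbabilityMeasure ((whiteNoise (ℤ × Bool)).map (ℓ ∘ gaussField L m β)) :=
    Measure.isProbabilityMeasure_map hℓΦ
  refine Measure.ext_of_charFun (funext fun t => ?_)
  have key : ∀ J, charFun ((whiteNoise (ℤ × Bool)).map fun ω => ℓ (partialField L m β J ω)) t =
      Complex.exp (-(((∑ i ∈ freqs J ×ˢ Finset.univ, ℓ (dir L m β i) ^ 2 : ℝ) : ℂ)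
        * t ^ 2 / 2)) := fun J => by
    simp_rw [dual_partialField]
    rw [map_sum_whiteNoise, charFun_gaussianReal]
    congr 1
    rw [Real.coe_toNNReal _ (Finset.sum_nonneg fun _ _ => sq_nonneg _)]
    simp
  have lim1 : Tendsto (fun J => charFun ((whiteNoise (ℤ × Bool)).map
      fun ω => ℓ (partialField L m β J ω)) t) atTop
      (𝓝 (charFun ((whiteNoise (ℤ × Bool)).map (ℓ ∘ gaussField L m β)) t)) := by
    have hmJ : ∀ J, Measurable fun ω => ℓ (partialField L m β J ω) := fun J => by
      simp_rw [dual_partialField]; fun_prop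
    simp_rw [charFun_apply_real]
    rw [integral_map hℓΦ (by fun_prop)]
    have : ∀ J, ∫ x, Complex.exp (t * x * Complex.I) ∂((whiteNoise (ℤ × Bool)).map
        fun ω => ℓ (partialField L m β J ω)) = ∫ ω, Complex.exp
          (t * (ℓ (partialField L m β J ω) : ℝ) * Complex.I) ∂(whiteNoise (ℤ × Bool)) :=
      fun J => integral_map (hmJ J).aemeasurable (by fun_prop)
    simp_rw [this]
    refine tendsto_integral_of_dominated_convergence (fun _ => 1) (fun J => ?_)
      (integrable_const _) (fun J => ?_) ?_
    · have hc : Measurable fun x : ℝ => Complex.exp (t * x * Complex.I) := by fun_prop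
      exact (hc.comp (hmJ J)).aestronglyMeasurable
    · refine ae_of_all _ fun ω => ?_
      rw [← Complex.ofReal_mul, Complex.norm_exp_ofReal_mul_I]
    · filter_upwards [hae] with ω hω
      have h1 := (ℓ.continuous.tendsto _).comp (tendsto_partialField hβ hω)
      have hc : Continuous fun x : ℝ => Complex.exp (t * x * Complex.I) := by fun_prop
      exact (hc.tendsto _).comp h1
  have lim2 := tendsto_sum_dual_sq (L := L) hm hβ ℓ
  rw [charFun_gaussianReal, Real.coe_toNNReal _ (integral_nonneg fun _ => sq_nonneg _)]
  simp_rw [key] at lim1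
  refine tendsto_nhds_unique lim1 ?_
  have hc : Continuous fun x : ℝ => Complex.exp (-((x : ℂ) * t ^ 2 / 2)) := by fun_prop
  convert! (hc.tendsto _).comp lim2 using 3
  simp

variable (L m β) in
/-- The law of the Gaussian series. -/
def refMeasure : Measure (Field L) := (whiteNoise (ℤ × Bool)).map (gaussField L m β)

theorem integral_refMeasure_sq (hm : 0 < m) (hβ : 0 < β) (ℓ : Field L →L[ℝ] ℝ) :
    ∫ φ, ℓ φ ^ 2 ∂(refMeasure L m β) =
      ∫ ω, ℓ (gaussField L m β ω) ^ 2 ∂(whiteNoise (ℤ × Bool)) :=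
  integral_map (aemeasurable_gaussField hm hβ) (by fun_prop)

theorem integral_refMeasure (hm : 0 < m) (hβ : 0 < β) (ℓ : Field L →L[ℝ] ℝ) :
    ∫ φ, ℓ φ ∂(refMeasure L m β) = 0 := by
  have h := integral_map (μ := refMeasure L m β) (φ := ℓ) (f := fun x : ℝ => x)
    (by fun_prop) (by fun_prop)
  rw [← h, refMeasure, map_dual_gaussField hm hβ, integral_id_gaussianReal]

theorem isGaussian_refMeasure (hm : 0 < m) (hβ : 0 < β) : IsGaussian (refMeasure L m β) :=
  isGaussian_of_map_eq_gaussianReal fun ℓ => ⟨_, _, map_dual_gaussField hm hβ ℓ⟩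

/-- The directions `u_k` and `i u_k` pick out, up to sign, the real and the imaginary part of the
same coefficient. -/
theorem sum_bool_reInner_dir_sq (h : AddCircle L → ℂ) (hh : Integrable h) (k : ℤ) :
    ∑ b : Bool, reInnerCLM h hh (dir L m β (k, b)) ^ 2 =
      amp L m β k ^ 2 * ‖innerL2 L (mode L k) h‖ ^ 2 := by
  have hd : ∀ b, (innerL2 L h (dir L m β (k, b))) =
      ((amp L m β k : ℂ) * (bif b then Complex.I else 1)) * innerL2 L h (mode L k) := fun b => by
    rw [← innerCLM_apply h hh, dir, map_smul, smul_eq_mul, innerCLM_apply]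
    congr 2; ext x; simp
  have hc : ‖innerL2 L (mode L k) h‖ = ‖innerL2 L h (mode L k)‖ := by
    rw [innerL2_conj_symm, RCLike.norm_conj]
  simp only [reInnerCLM_apply, hd, Fintype.sum_bool, hc]
  rw [← Complex.normSq_eq_norm_sq, Complex.normSq_apply]
  simp
  ring

theorem isReferenceMeasure_refMeasure (hm : 0 < m) (hβ : 0 < β) :
    IsReferenceMeasure L m β (refMeasure L m β) := by
  refine ⟨isGaussian_refMeasure hm hβ, fun h hh => ?_, fun h hh => ?_⟩
  · exact integral_refMeasure hm hβ (reInnerCLM h (hh.integrable (by norm_num)))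
  · have hi : Integrable h := hh.integrable (by norm_num)
    have h1 := integral_refMeasure_sq (L := L) hm hβ (reInnerCLM h hi)
    have h2 := tendsto_sum_dual_sq (L := L) hm hβ (reInnerCLM h hi)
    rw [← h1] at h2
    simp only [reInnerCLM_apply] at h1 h2
    refine tendsto_nhds_unique h2 ?_
    have e : ∀ J, ∑ i ∈ freqs J ×ˢ (Finset.univ : Finset Bool), (innerL2 L h (dir L m β i)).re ^ 2 =
        ∑ k ∈ freqs J, amp L m β k ^ 2 * ‖innerL2 L (mode L k) h‖ ^ 2 := fun J => by
      rw [Finset.sum_product]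
      exact Finset.sum_congr rfl fun k _ => sum_bool_reInner_dir_sq h hi k
    simp_rw [e] at h2 ⊢
    have hmono : Monotone fun J => ∑ k ∈ freqs J, amp L m β k ^ 2 * ‖innerL2 L (mode L k) h‖ ^ 2 :=
      fun a b hab => Finset.sum_le_sum_of_subset_of_nonneg (Finset.insert_subset_insert _
        (Finset.biUnion_subset_biUnion_of_subset_left _ (Finset.range_mono hab)))
        fun _ _ _ => by positivity
    -- `covForm` is a `tsum`, which is `0` by convention without summability. The partial sums
    -- increase to the variance, so that variance bounds every finite sum.
    have hs : Summable fun k => amp L m β k ^ 2 * ‖innerL2 L (mode L k) h‖ ^ 2 := by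
      refine summable_of_sum_le (fun _ => by positivity) (c := ∫ φ, (innerL2 L h φ).re ^ 2
        ∂(refMeasure L m β)) fun u => ?_
      obtain ⟨J, hJ⟩ := (tendsto_freqs.eventually_ge_atTop u).exists
      exact (Finset.sum_le_sum_of_subset_of_nonneg hJ fun _ _ _ => by positivity).trans
        (hmono.ge_of_tendsto h2 J)
    have h3 := hs.hasSum.comp tendsto_freqs
    have : covForm L m β h = ∑' k, amp L m β k ^ 2 * ‖innerL2 L (mode L k) h‖ ^ 2 := by
      unfold covForm
      refine tsum_congr fun k => ?_
      rw [amp_sq hm hβ, div_eq_inv_mul]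
    rw [this]
    exact h3

end ReferenceMeasure

/-! ### Uniqueness of the reference measure -/

section Uniqueness

variable {L m β : ℝ} [hL : Fact (0 < L)]

/-- A real functional is the real part of a complex linear one, which the Riesz theorem represents
by an `L²` function. -/
theorem exists_inner_of_dual (ℓ : Lp ℂ 2 (volume : Measure (AddCircle L)) →L[ℝ] ℝ) :
    ∃ h : AddCircle L → ℂ, ∃ hh : MemLp h 2 (volume : Measure (AddCircle L)),
      ∀ φ : Field L, ℓ (ContinuousMap.toLp 2 volume ℂ φ) =
        reInnerCLM h (hh.integrable (by norm_num)) φ := by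
  set g : Lp ℂ 2 (volume : Measure (AddCircle L)) →L[ℂ] ℂ := StrongDual.extendRCLike ℓ
  set h := (InnerProductSpace.toDual ℂ (Lp ℂ 2 (volume : Measure (AddCircle L)))).symm g
  refine ⟨h, Lp.memLp h, fun φ => ?_⟩
  have h1 : ℓ (ContinuousMap.toLp 2 volume ℂ φ) = (g (ContinuousMap.toLp 2 volume ℂ φ)).re := by
    simp [g, StrongDual.extendRCLike_apply]
  have h2 : g (ContinuousMap.toLp 2 volume ℂ φ) = innerL2 L h φ := by
    rw [← InnerProductSpace.toDual_symm_apply (𝕜 := ℂ), L2.inner_def]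
    refine integral_congr_ae ?_
    filter_upwards [ContinuousMap.coeFn_toLp (p := 2) (𝕜 := ℂ) volume φ] with x hx
    rw [hx, RCLike.inner_apply, mul_comm]
  rw [h1, h2, reInnerCLM_apply]

theorem IsReferenceMeasure.charFunDual_eq {μ : Measure (Field L)}
    (hμ : IsReferenceMeasure L m β μ) {h : AddCircle L → ℂ}
    (hh : MemLp h 2 (volume : Measure (AddCircle L))) :
    charFunDual μ (reInnerCLM h (hh.integrable (by norm_num))) =
      Complex.exp (-(covForm L m β h / 2 : ℝ)) := by
  have := hμ.gaussian
  rw [IsGaussian.charFunDual_eq, variance_of_integral_eq_zero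
    (reInnerCLM h (hh.integrable (by norm_num))).continuous.measurable.aemeasurable
    (hμ.mean_zero h hh)]
  have h1 := hμ.mean_zero h hh
  have h2 := hμ.covariance h hh
  simp only [reInnerCLM_apply]
  rw [h2, integral_complex_ofReal, h1]
  congr 1
  push_cast
  ring

/-- The reference measure is determined by its covariance. -/
theorem IsReferenceMeasure.unique {μ μ' : Measure (Field L)}
    (hμ : IsReferenceMeasure L m β μ) (hμ' : IsReferenceMeasure L m β μ') : μ = μ' := by
  have := hμ.gaussian
  have := hμ'.gaussian
  let : MeasurableSpace (Lp ℂ 2 (volume : Measure (AddCircle L))) := borel _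
  have : BorelSpace (Lp ℂ 2 (volume : Measure (AddCircle L))) := ⟨rfl⟩
  set T : Field L →L[ℝ] Lp ℂ 2 (volume : Measure (AddCircle L)) :=
    (ContinuousMap.toLp 2 volume ℂ).restrictScalars ℝ
  -- The covariance only controls functionals that extend to `L²`, so the measures are compared
  -- there, where these exhaust the dual. By Lusin–Souslin the continuous injection `T` is a
  -- measurable embedding, and nothing is lost.
  have hT : MeasurableEmbedding T :=
    Continuous.measurableEmbedding T.continuous (ContinuousMap.toLp_injective (𝕜 := ℂ) volume)
  refine hT.map_injective ?_
  have : IsProbabilityMeasure (μ.map T) :=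
    Measure.isProbabilityMeasure_map T.continuous.measurable.aemeasurable
  have : IsProbabilityMeasure (μ'.map T) :=
    Measure.isProbabilityMeasure_map T.continuous.measurable.aemeasurable
  have : Fact ((2 : ℝ≥0∞) ≠ ∞) := ⟨by norm_num⟩
  refine Measure.ext_of_charFunDual (funext fun ℓ => ?_)
  obtain ⟨h, hh, hℓ⟩ := exists_inner_of_dual ℓ
  have : ℓ.comp T = reInnerCLM h (hh.integrable (by norm_num)) := by
    ext φ; exact hℓ φ
  rw [charFunDual_map, charFunDual_map, this, hμ.charFunDual_eq hh, hμ'.charFunDual_eq hh]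

end Uniqueness

/-! ### Polar coordinates for the zero mode -/

section Polar

/-- The uniform law of the phase. -/
def phaseLaw : Measure ℝ :=
  (ENNReal.ofReal (2 * Real.pi))⁻¹ • volume.restrict (Set.Ioo (-Real.pi) Real.pi)

/-- The exponential law of mean `s`. -/
def massLaw (s : ℝ) : Measure ℝ :=
  (volume.restrict (Set.Ioi 0)).withDensity fun r => ENNReal.ofReal (s⁻¹ * Real.exp (-(r / s)))

/-- The point of the complex plane of squared modulus `r` and phase `θ`. -/
def polarPoint (p : ℝ × ℝ) : ℂ := Real.sqrt p.2 * (Real.cos p.1 + Real.sin p.1 * Complex.I)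

theorem measurable_polarPoint : Measurable polarPoint := by unfold polarPoint; fun_prop

theorem norm_polarPoint_sq {p : ℝ × ℝ} (hp : 0 ≤ p.2) : ‖polarPoint p‖ ^ 2 = p.2 := by
  rw [polarPoint, ← Complex.normSq_eq_norm_sq, map_mul, Complex.normSq_ofReal,
    Complex.normSq_add_mul_I, Real.cos_sq_add_sin_sq, mul_one, Real.mul_self_sqrt hp]

instance isProbabilityMeasure_phaseLaw : IsProbabilityMeasure phaseLaw := by
  refine ⟨?_⟩
  have h : (0 : ℝ) < 2 * Real.pi := by positivity
  rw [phaseLaw, Measure.smul_apply, Measure.restrict_apply MeasurableSet.univ, Set.univ_inter,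
    Real.volume_Ioo, sub_neg_eq_add, ← two_mul, smul_eq_mul]
  exact ENNReal.inv_mul_cancel (by simpa using h) ENNReal.ofReal_ne_top

theorem lintegral_massLaw {s : ℝ} (g : ℝ → ℝ≥0∞) (hg : Measurable g) :
    ∫⁻ r, g r ∂(massLaw s) =
      ∫⁻ r in Set.Ioi 0, ENNReal.ofReal (s⁻¹ * Real.exp (-(r / s))) * g r := by
  rw [massLaw, lintegral_withDensity_eq_lintegral_mul _ (by fun_prop) hg]
  rfl

instance sFinite_massLaw (s : ℝ) : SFinite (massLaw s) := by unfold massLaw; infer_instance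

/-- Substitution `r = a² ρ²`; its Jacobian `2 a² ρ` supplies the factor `ρ` of the planar area
element. -/
theorem lintegral_massLaw_eq_radial {a : ℝ} (ha : 0 < a) (g : ℝ → ℝ≥0∞) (hg : Measurable g) :
    ∫⁻ r, g (Real.sqrt r) ∂(massLaw (2 * a ^ 2)) =
      ∫⁻ ρ in Set.Ioi 0, ENNReal.ofReal (ρ * Real.exp (-(ρ ^ 2 / 2))) * g (a * ρ) := by
  rw [lintegral_massLaw _ (by fun_prop)]
  have him : (fun ρ : ℝ => a ^ 2 * ρ ^ 2) '' Set.Ioi 0 = Set.Ioi 0 := by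
    ext r
    simp only [Set.mem_image, Set.mem_Ioi]
    constructor
    · rintro ⟨ρ, hρ, rfl⟩; positivity
    · intro hr
      refine ⟨Real.sqrt r / a, by positivity, ?_⟩
      rw [div_pow, Real.sq_sqrt hr.le]; field_simp
  have hd : ∀ ρ ∈ Set.Ioi (0 : ℝ), HasDerivWithinAt (fun ρ : ℝ => a ^ 2 * ρ ^ 2)
      (a ^ 2 * (2 * ρ)) (Set.Ioi 0) ρ := fun ρ _ => by
    have := ((hasDerivAt_pow 2 ρ).const_mul (a ^ 2)).hasDerivWithinAt (s := Set.Ioi 0)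
    simpa using this
  have hinj : Set.InjOn (fun ρ : ℝ => a ^ 2 * ρ ^ 2) (Set.Ioi 0) := by
    intro x hx y hy hxy
    have h2 : x ^ 2 = y ^ 2 := mul_left_cancel₀ (by positivity) hxy
    exact (pow_left_inj₀ (le_of_lt hx) (le_of_lt hy) two_ne_zero).1 h2
  conv_lhs => rw [← him]
  rw [lintegral_image_eq_lintegral_abs_deriv_mul measurableSet_Ioi hd hinj]
  refine setLIntegral_congr_fun measurableSet_Ioi fun ρ hρ => ?_
  have hρ' : (0 : ℝ) < ρ := hρ
  have hsq : Real.sqrt (a ^ 2 * ρ ^ 2) = a * ρ := by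
    rw [← mul_pow, Real.sqrt_sq (by positivity)]
  rw [hsq, ← mul_assoc, ← ENNReal.ofReal_mul (abs_nonneg _), abs_of_pos (by positivity)]
  congr 2
  have : a ^ 2 * ρ ^ 2 / (2 * a ^ 2) = ρ ^ 2 / 2 := by field_simp
  rw [this]
  field_simp

/-- A centered complex Gaussian variable in polar coordinates. -/
theorem map_gaussian_prod_eq_map_polarPoint {a : ℝ} (ha : 0 < a) :
    ((gaussianReal 0 1).prod (gaussianReal 0 1)).map
        (fun p : ℝ × ℝ => (a : ℂ) * (p.1 + p.2 * Complex.I)) =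
      (phaseLaw.prod (massLaw (2 * a ^ 2))).map polarPoint := by
  refine Measure.ext_of_lintegral _ fun f hf => ?_
  rw [lintegral_map hf (by fun_prop), lintegral_map hf measurable_polarPoint]
  have hpdf : (gaussianReal 0 1).prod (gaussianReal 0 1) = (volume : Measure (ℝ × ℝ)).withDensity
      fun p => ENNReal.ofReal ((2 * Real.pi)⁻¹ * Real.exp (-((p.1 ^ 2 + p.2 ^ 2) / 2))) := by
    rw [gaussianReal_of_var_ne_zero _ one_ne_zero,
      prod_withDensity (measurable_gaussianPDF 0 1) (measurable_gaussianPDF 0 1)]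
    rw [Measure.volume_eq_prod]
    congr 1
    ext p
    simp only [gaussianPDF, gaussianPDFReal]
    rw [← ENNReal.ofReal_mul (by positivity)]
    congr 1
    have h2 : √(2 * Real.pi) * √(2 * Real.pi) = 2 * Real.pi := Real.mul_self_sqrt (by positivity)
    have h3 : -((p.1 ^ 2 + p.2 ^ 2) / 2) = -p.1 ^ 2 / 2 + -p.2 ^ 2 / 2 := by ring
    rw [h3, Real.exp_add, ← h2, mul_inv]
    simp
    ring
  have hfp : Measurable fun p => f (polarPoint p) := hf.comp measurable_polarPoint
  rw [hpdf, lintegral_withDensity_eq_lintegral_mul _ (by fun_prop) (by fun_prop),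
    ← lintegral_comp_polarCoord_symm, polarCoord_target, Measure.volume_eq_prod,
    ← Measure.prod_restrict, lintegral_prod _ hfp.aemeasurable]
  have hr : ∀ θ : ℝ, ∫⁻ r, f (polarPoint (θ, r)) ∂(massLaw (2 * a ^ 2)) =
      ∫⁻ ρ in Set.Ioi 0, ENNReal.ofReal (ρ * Real.exp (-(ρ ^ 2 / 2))) *
        f (((a * ρ : ℝ) : ℂ) * (Real.cos θ + Real.sin θ * Complex.I)) := fun θ =>
    lintegral_massLaw_eq_radial ha
      (fun ρ => f ((ρ : ℂ) * (Real.cos θ + Real.sin θ * Complex.I))) (by fun_prop)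
  have hc : (ENNReal.ofReal (2 * Real.pi))⁻¹ = ENNReal.ofReal (2 * Real.pi)⁻¹ :=
    (ENNReal.ofReal_inv_of_pos (by positivity)).symm
  simp_rw [hr]
  rw [phaseLaw, lintegral_smul_measure, smul_eq_mul, hc, lintegral_lintegral_swap (by fun_prop),
    ← lintegral_const_mul _ (Measurable.lintegral_prod_right (by fun_prop)),
    lintegral_prod _ (by
      refine Measurable.aemeasurable ?_
      have := continuous_polarCoord_symm.measurable
      simp only [smul_eq_mul, Pi.mul_apply]
      fun_prop)]
  refine setLIntegral_congr_fun measurableSet_Ioi fun ρ hρ => ?_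
  have hρ' : (0 : ℝ) < ρ := hρ
  rw [← lintegral_const_mul _ (by fun_prop)]
  refine lintegral_congr fun θ => ?_
  simp only [polarCoord_symm_apply, Pi.mul_apply, smul_eq_mul]
  rw [← mul_assoc, ← mul_assoc, ← ENNReal.ofReal_mul hρ'.le, ← ENNReal.ofReal_mul (by positivity)]
  congr 2
  · have : (ρ * Real.cos θ) ^ 2 + (ρ * Real.sin θ) ^ 2 = ρ ^ 2 := by
      rw [mul_pow, mul_pow, ← mul_add, Real.cos_sq_add_sin_sq, mul_one]
    rw [this]; ring
  · push_cast; ring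

/-- Read off by comparing total masses in the polar identity with `s = 2 a²`. -/
theorem massLaw_univ {s : ℝ} (hs : 0 < s) : massLaw s Set.univ = 1 := by
  have hs' : s = 2 * (Real.sqrt (s / 2)) ^ 2 := by rw [Real.sq_sqrt (by positivity)]; ring
  have h := congrArg (fun μ => μ Set.univ)
    (map_gaussian_prod_eq_map_polarPoint (Real.sqrt_pos.2 (by positivity : 0 < s / 2)))
  rw [Measure.map_apply (by fun_prop) MeasurableSet.univ,
    Measure.map_apply measurable_polarPoint MeasurableSet.univ, Set.preimage_univ,
    Set.preimage_univ, measure_univ, ← Set.univ_prod_univ, Measure.prod_prod, measure_univ,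
    one_mul, ← hs'] at h
  exact h.symm

end Polar

/-! ### The field as phase and mass of the zero mode plus an independent tail -/

section Representation

variable {L m β : ℝ} [hL : Fact (0 < L)]

theorem tailField_update (b : Bool) (ω : ℤ × Bool → ℝ) (x : ℝ) :
    tailField L m β (Function.update ω (0, b) x) = tailField L m β ω := by
  unfold tailField
  refine tsum_congr fun j => Finset.sum_congr rfl fun i hi => ?_
  rw [Function.update_of_ne]
  rintro rfl
  exact (mem_block.1 (Finset.mem_product.1 hi).1).1 rfl

variable (L m β) in
/-- The field with zero mode of squared modulus `r` and phase `θ`, and remaining modes given by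
the Gaussian series. -/
def polarField (p : (ℤ × Bool → ℝ) × ℝ × ℝ) : Field L :=
  polarPoint p.2 • modeField L 0 + tailField L m β p.1

variable (L m β) in
/-- The mean squared modulus of the zero mode. -/
def meanMass : ℝ := 2 * amp L m β 0 ^ 2

theorem meanMass_pos (hm : 0 < m) (hβ : 0 < β) : 0 < meanMass L m β := by
  have := amp_pos (L := L) hm hβ 0
  unfold meanMass; positivity

theorem aemeasurable_smul_add_tailField (hm : 0 < m) (hβ : 0 < β) (ν : Measure ℂ) [SFinite ν] :
    AEMeasurable (fun p : (ℤ × Bool → ℝ) × ℂ =>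
      (p.2 • modeField L 0 + tailField L m β p.1 : Field L)) ((whiteNoise (ℤ × Bool)).prod ν) := by
  have := (aemeasurable_tailField (L := L) hm hβ).comp_fst (ν := ν)
  fun_prop

theorem aemeasurable_polarField (hm : 0 < m) (hβ : 0 < β) (ν : Measure (ℝ × ℝ)) [SFinite ν] :
    AEMeasurable (polarField L m β) ((whiteNoise (ℤ × Bool)).prod ν) := by
  have h1 := (aemeasurable_tailField (L := L) hm hβ).comp_fst (ν := ν)
  have h2 : Measurable fun p : (ℤ × Bool → ℝ) × ℝ × ℝ => polarPoint p.2 :=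
    measurable_polarPoint.comp measurable_snd
  exact (h2.smul_const _).aemeasurable.add h1

theorem map_comp_of_measurePreserving {X Y Z : Type*} [MeasurableSpace X] [MeasurableSpace Y]
    [MeasurableSpace Z] {μ : Measure X} {ν : Measure Y} {ψ : X → Y} {f : Y → Z}
    (hψ : MeasurePreserving ψ μ ν) (hf : AEMeasurable f ν) : ν.map f = μ.map (f ∘ ψ) := by
  rw [← AEMeasurable.map_map_of_aemeasurable (by rwa [hψ.map_eq]) hψ.measurable.aemeasurable,
    hψ.map_eq]

/-- The tail ignores both coordinates of frequency `0`. Overwriting them by fresh Gaussian variables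
keeps the law and exhibits the zero mode as a complex Gaussian independent of the tail, which is
then put in polar form. -/
theorem refMeasure_eq_map_polarField (hm : 0 < m) (hβ : 0 < β) :
    refMeasure L m β = ((whiteNoise (ℤ × Bool)).prod
      (phaseLaw.prod (massLaw (meanMass L m β)))).map (polarField L m β) := by
  set P := whiteNoise (ℤ × Bool)
  set γ := gaussianReal 0 1
  set c : ℝ × ℝ → ℂ := fun p => (amp L m β 0 : ℂ) * (p.1 + p.2 * Complex.I)
  have hc : Measurable c := by fun_prop
  set G : (ℤ × Bool → ℝ) × ℂ → Field L := fun p => p.2 • modeField L 0 + tailField L m β p.1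
  have hψ : MeasurePreserving (fun p : ((ℤ × Bool → ℝ) × ℝ) × ℝ =>
      Function.update (Function.update p.1.1 (0, false) p.1.2) (0, true) p.2) ((P.prod γ).prod γ) P :=
    (measurePreserving_update_whiteNoise (0, true)).comp
      ((measurePreserving_update_whiteNoise (0, false)).prod (MeasurePreserving.id γ))
  have hG : AEMeasurable G (P.prod ((γ.prod γ).map c)) :=
    aemeasurable_smul_add_tailField hm hβ _
  have hκ : MeasurePreserving (fun p : ((ℤ × Bool → ℝ) × ℝ) × ℝ => (p.1.1, c (p.1.2, p.2)))
      ((P.prod γ).prod γ) (P.prod ((γ.prod γ).map c)) :=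
    ((MeasurePreserving.id P).prod (hc.measurePreserving (γ.prod γ))).comp
      (measurePreserving_prodAssoc P γ γ)
  have h1 : refMeasure L m β = (P.prod ((γ.prod γ).map c)).map G := by
    rw [refMeasure, map_comp_of_measurePreserving hψ (aemeasurable_gaussField hm hβ),
      map_comp_of_measurePreserving hκ hG]
    congr 1
    funext p
    simp only [Function.comp_apply, gaussField, tailField_update, coeff, G, c]
    simp
  rw [h1]
  have hp : MeasurePreserving (fun p : (ℤ × Bool → ℝ) × ℝ × ℝ => (p.1, polarPoint p.2))
      (P.prod (phaseLaw.prod (massLaw (meanMass L m β)))) (P.prod ((γ.prod γ).map c)) := by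
    rw [map_gaussian_prod_eq_map_polarPoint (amp_pos hm hβ 0)]
    exact (MeasurePreserving.id P).prod (measurable_polarPoint.measurePreserving _)
  rw [map_comp_of_measurePreserving hp hG]
  rfl

end Representation

/-! ### The mass of the nonzero modes: atoms, exponential moments, small values -/

section TailMass

variable {L m β : ℝ} [hL : Fact (0 < L)]

variable (L m β) in
/-- The contribution of the mode `k` to `tailMass`. -/
def massTerm (k : ℤ) (ω : ℤ × Bool → ℝ) : ℝ≥0∞ :=
  if k = 0 then 0 else
    ENNReal.ofReal (amp L m β k ^ 2 * (ω (k, false) ^ 2 + ω (k, true) ^ 2))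

theorem tailMass_eq_tsum (ω : ℤ × Bool → ℝ) : tailMass L m β ω = ∑' k, massTerm L m β k ω := rfl

theorem measurable_massTerm (k : ℤ) : Measurable (massTerm L m β k) := by
  unfold massTerm; split_ifs <;> fun_prop

theorem massTerm_update_le (k : ℤ) (i : ℤ × Bool) (ω : ℤ × Bool → ℝ) {a b : ℝ}
    (hab : |a| ≤ |b|) :
    massTerm L m β k (Function.update ω i a) ≤ massTerm L m β k (Function.update ω i b) := by
  have hsq : ∀ k, Function.update ω i a k ^ 2 ≤ Function.update ω i b k ^ 2 := fun k => by
    by_cases hk : k = i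
    · subst hk; simpa using sq_le_sq.2 hab
    · simp [Function.update_of_ne hk]
  unfold massTerm
  split_ifs
  · exact le_rfl
  · exact ENNReal.ofReal_le_ofReal
      (mul_le_mul_of_nonneg_left (add_le_add (hsq _) (hsq _)) (sq_nonneg _))

theorem massTerm_update_of_ne {k : ℤ} {i : ℤ × Bool} (h : i.1 ≠ k) (ω : ℤ × Bool → ℝ) (x : ℝ) :
    massTerm L m β k (Function.update ω i x) = massTerm L m β k ω := by
  unfold massTerm
  rw [Function.update_of_ne, Function.update_of_ne] <;> (rintro rfl; exact h rfl)

/-- The tail mass has no atoms. -/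
theorem measure_tailMass_eq (hm : 0 < m) (hβ : 0 < β) {t : ℝ≥0∞} (ht : t ≠ ∞) :
    whiteNoise (ℤ × Bool) {ω | tailMass L m β ω = t} = 0 := by
  have hR := measurable_tailMass (L := L) (m := m) (β := β)
  have hS : MeasurableSet {ω | tailMass L m β ω = t} := hR (measurableSet_singleton t)
  have ha := amp_pos (L := L) hm hβ 1
  rw [← lintegral_indicator_one hS, lintegral_whiteNoise_update
    (measurable_one.indicator hS) ((1, false) : ℤ × Bool)]
  refine (lintegral_congr fun ω => ?_).trans lintegral_zero
  set b := ω (1, true) ^ 2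
  set r : ℝ≥0∞ := ∑' k, if k = 1 then 0 else massTerm L m β k ω
  have hu : ∀ x, tailMass L m β (Function.update ω (1, false) x) =
      ENNReal.ofReal (amp L m β 1 ^ 2 * (x ^ 2 + b)) + r := fun x => by
    rw [tailMass_eq_tsum, ENNReal.tsum_eq_add_tsum_ite 1]
    refine congrArg₂ (· + ·) ?_ ?_
    · simp [massTerm, b]
    · refine tsum_congr fun k => ?_
      split_ifs with hk
      · rfl
      · exact massTerm_update_of_ne (Ne.symm hk) ω x
  -- With all other coordinates frozen, the equation is quadratic in `x` and has at most two roots,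
  -- a null set for the Gaussian law.
  have hfin : {x : ℝ | tailMass L m β (Function.update ω (1, false) x) = t}.Finite := by
    by_cases hne : {x : ℝ | tailMass L m β (Function.update ω (1, false) x) = t}.Nonempty
    · obtain ⟨y, hy⟩ := hne
      refine Set.Finite.subset (Set.toFinite {y, -y}) fun x hx => ?_
      simp only [Set.mem_ofPred_eq, hu] at hx hy
      have hr : r ≠ ∞ := fun h => ht (by rw [← hx, h, add_top])
      have h1 := (ENNReal.add_left_inj hr).1 (hx.trans hy.symm)
      rw [ENNReal.ofReal_eq_ofReal_iff (by positivity) (by positivity)] at h1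
      have h2 : x ^ 2 + b = y ^ 2 + b := mul_left_cancel₀ (by positivity) h1
      exact sq_eq_sq_iff_eq_or_eq_neg.1 (by linarith)
    · rw [Set.not_nonempty_iff_eq_empty.1 hne]; exact Set.finite_empty
  have := nullSingletonClass_gaussianReal (μ := 0) (v := 1) one_ne_zero
  have h0 := hfin.measure_zero (gaussianReal 0 1)
  have hmeas : MeasurableSet {x : ℝ | tailMass L m β (Function.update ω (1, false) x) = t} :=
    hfin.measurableSet
  rw [← h0, ← lintegral_indicator_one hmeas]
  rfl

theorem summable_amp_sq (hm : 0 < m) (hβ : 0 < β) :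
    Summable fun k : ℤ => if k = 0 then 0 else amp L m β k ^ 2 := by
  refine Summable.of_nonneg_of_le (fun k => by split_ifs <;> positivity) (fun k => ?_)
    ((Real.summable_one_div_int_pow (p := 2)).2 (by norm_num) |>.mul_left (L ^ 2 / β))
  split_ifs with hk
  · simp [hk]
  · exact amp_sq_le hm hβ hk

theorem hasSum_toReal_massTerm {ω : ℤ × Bool → ℝ} (h : tailMass L m β ω < ∞) :
    HasSum (fun k => (if k = 0 then 0 else amp L m β k ^ 2) *
      (ω (k, false) ^ 2 + ω (k, true) ^ 2)) (tailMass L m β ω).toReal := by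
  rw [tailMass_eq_tsum] at h
  have h1 := ENNReal.hasSum_toReal h.ne
  rw [tailMass_eq_tsum, ENNReal.tsum_toReal_eq (fun k => ENNReal.ne_top_of_tsum_ne_top h.ne k)]
  convert! h1 using 2 with k
  unfold massTerm
  split_ifs
  · simp
  · rw [ENNReal.toReal_ofReal (by positivity)]

/-- Fatou along the partial sums: the bound for finitely many modes depends only on the sum of the
variances, and these decay like `k ^ (-2)`. -/
theorem lintegral_exp_tailMass_lt_top (hm : 0 < m) (hβ : 0 < β) {c t : ℝ} (hc : 0 ≤ c)
    (ht0 : 0 < t) (ht : t < 1 / 2) (hct : ∀ k ≠ 0, c * amp L m β k ^ 2 ≤ t) :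
    ∫⁻ ω, ENNReal.ofReal (Real.exp (c * (tailMass L m β ω).toReal)) ∂(whiteNoise (ℤ × Bool))
      < ∞ := by
  set a : ℤ → ℝ := fun k => if k = 0 then 0 else amp L m β k ^ 2
  have ha : ∀ k, 0 ≤ a k := fun k => by simp only [a]; split_ifs <;> positivity
  have hat : ∀ k, c * a k ≤ t := fun k => by
    simp only [a]; split_ifs with hk
    · simpa using ht0.le
    · exact hct k hk
  set K := (gaussSqMoment t).toReal / t
  have hK : 0 ≤ K := div_nonneg ENNReal.toReal_nonneg ht0.le
  set f : ℕ → (ℤ × Bool → ℝ) → ℝ≥0∞ := fun J ω =>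
    ENNReal.ofReal (Real.exp (∑ i ∈ freqs J ×ˢ (Finset.univ : Finset Bool), c * a i.1 * ω i ^ 2))
  have hf : ∀ J, Measurable (f J) := fun J => by fun_prop
  have hlim : ∀ᵐ ω ∂(whiteNoise (ℤ × Bool)),
      ENNReal.ofReal (Real.exp (c * (tailMass L m β ω).toReal)) = liminf (fun J => f J ω) atTop := by
    filter_upwards [ae_expMajorant_lt_top (L := L) hm hβ (by norm_num : (1 / 4 : ℝ) < 1 / 2)]
      with ω hω
    have h1 := (hasSum_toReal_massTerm (tailMass_lt_top hβ (by norm_num) (by norm_num) hω)).mul_left c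
    have h2 := h1.comp tendsto_freqs
    refine (Tendsto.liminf_eq (ENNReal.tendsto_ofReal ((Real.continuous_exp.tendsto _).comp ?_))).symm
    refine h2.congr fun J => ?_
    simp only [Function.comp_apply]
    rw [Finset.sum_product]
    refine Finset.sum_congr rfl fun k _ => ?_
    simp only [Fintype.sum_bool, a]; ring
  rw [lintegral_congr_ae hlim]
  refine (lintegral_liminf_le hf).trans_lt ?_
  refine lt_of_le_of_lt (b := ENNReal.ofReal (Real.exp (K * (2 * (c * ∑' k, a k))))) ?_
    ENNReal.ofReal_lt_top
  refine liminf_le_of_frequently_le' (Frequently.of_forall fun J => ?_)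
  refine (lintegral_exp_sum_mul_sq_le (freqs J ×ˢ Finset.univ) (fun i : ℤ × Bool => c * a i.1)
    (fun i => mul_nonneg hc (ha _)) ht0 ht fun i => hat _).trans ?_
  refine ENNReal.ofReal_le_ofReal (Real.exp_le_exp.2 (mul_le_mul_of_nonneg_left ?_ hK))
  rw [Finset.sum_product]
  simp only [Finset.sum_const, Finset.card_univ, Fintype.card_bool, nsmul_eq_mul]
  rw [← Finset.mul_sum, ← Finset.mul_sum]
  push_cast
  gcongr
  exact (summable_amp_sq hm hβ).sum_le_tsum _ fun k _ => ha k

/-- The relative size of the first nonzero mode. -/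
theorem exists_amp_ratio (hm : 0 < m) (hβ : 0 < β) :
    ∃ κ : ℝ, 0 < κ ∧ κ < 1 ∧ ∀ k : ℤ, k ≠ 0 → amp L m β k ^ 2 ≤ κ * amp L m β 0 ^ 2 := by
  have h0 : (0 : ℝ) < L := hL.out
  refine ⟨m ^ 2 / ((2 * Real.pi / L) ^ 2 + m ^ 2), by positivity, ?_, fun k hk => ?_⟩
  · rw [div_lt_one (by positivity)]
    have : 0 < (2 * Real.pi / L) ^ 2 := by positivity
    linarith
  · rw [amp_sq hm hβ, amp_sq hm hβ]
    have hk1 : (1 : ℝ) ≤ (k : ℝ) ^ 2 := by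
      have : (1 : ℤ) ≤ k ^ 2 := by
        have := Int.one_le_abs hk
        nlinarith [sq_abs k]
      exact_mod_cast this
    have e : m ^ 2 / ((2 * Real.pi / L) ^ 2 + m ^ 2) *
        (β * ((2 * Real.pi * ((0 : ℤ) : ℝ) / L) ^ 2 + m ^ 2))⁻¹ =
        (β * ((2 * Real.pi / L) ^ 2 + m ^ 2))⁻¹ := by
      simp only [Int.cast_zero, mul_zero, zero_div]
      field_simp
      simp
    rw [e]
    refine inv_anti₀ (by positivity)
      (mul_le_mul_of_nonneg_left (add_le_add ?_ le_rfl) hβ.le)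
    have : 2 * Real.pi * k / L = 2 * Real.pi / L * k := by ring
    rw [this, mul_pow]
    have : 0 ≤ (2 * Real.pi / L) ^ 2 := by positivity
    nlinarith

/-- Every nonzero mode has variance at most `κ < 1` times that of the zero mode, which leaves room
above the critical rate `1 / meanMass`. The choice of `q` is the midpoint of `1` and `1 / κ`; it
gives the Gaussian rate `(1 + κ) / 4 < 1 / 2`. -/
theorem exists_lintegral_exp_tailMass_lt_top (hm : 0 < m) (hβ : 0 < β) :
    ∃ q : ℝ, 1 < q ∧ ∫⁻ ω, ENNReal.ofReal
      (Real.exp (q / meanMass L m β * (tailMass L m β ω).toReal)) ∂(whiteNoise (ℤ × Bool)) < ∞ := by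
  obtain ⟨κ, hκ0, hκ1, hκ⟩ := exists_amp_ratio (L := L) hm hβ
  have ha := amp_pos (L := L) hm hβ 0
  have hq : 1 < (1 / κ + 1) / 2 := by
    have : 1 < 1 / κ := by rw [lt_div_iff₀ hκ0]; linarith
    linarith
  refine ⟨(1 / κ + 1) / 2, hq, lintegral_exp_tailMass_lt_top hm hβ
    (div_nonneg (by linarith) (meanMass_pos hm hβ).le) (t := (1 + κ) / 4) (by linarith)
    (by linarith) fun k hk => ?_⟩
  calc (1 / κ + 1) / 2 / meanMass L m β * amp L m β k ^ 2
      ≤ (1 / κ + 1) / 2 / meanMass L m β * (κ * amp L m β 0 ^ 2) := by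
        refine mul_le_mul_of_nonneg_left (hκ k hk) (div_nonneg (by linarith) (meanMass_pos hm hβ).le)
    _ = (1 + κ) / 4 := by unfold meanMass; field_simp; ring

theorem lintegral_tailMass_lt_top (hm : 0 < m) (hβ : 0 < β) :
    ∫⁻ ω, tailMass L m β ω ∂(whiteNoise (ℤ × Bool)) < ∞ := by
  obtain ⟨q, hq, h⟩ := exists_lintegral_exp_tailMass_lt_top (L := L) hm hβ
  set c := q / meanMass L m β
  have hc : 0 < c := div_pos (by linarith) (meanMass_pos hm hβ)
  refine lt_of_le_of_lt ?_ (ENNReal.mul_lt_top (ENNReal.ofReal_lt_top (r := c⁻¹)) h)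
  have hR := measurable_tailMass (L := L) (m := m) (β := β)
  rw [← lintegral_const_mul _ (by fun_prop)]
  refine lintegral_mono_ae ?_
  filter_upwards [ae_expMajorant_lt_top (L := L) hm hβ (by norm_num : (1 / 4 : ℝ) < 1 / 2)]
    with ω hω
  have hfin := tailMass_lt_top hβ (by norm_num) (by norm_num) hω
  rw [← ENNReal.ofReal_mul (by positivity), ← ENNReal.ofReal_toReal hfin.ne,
    ENNReal.toReal_ofReal ENNReal.toReal_nonneg]
  apply ENNReal.ofReal_le_ofReal
  rw [inv_mul_eq_div, le_div_iff₀ hc]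
  linarith [Real.add_one_le_exp (c * (tailMass L m β ω).toReal)]

theorem measure_box_pos {ι : Type*} (s : Finset ι) {δ : ℝ} (hδ : 0 < δ) :
    0 < whiteNoise ι {ω | ∀ i ∈ s, |ω i| < δ} := by
  have : {ω : ι → ℝ | ∀ i ∈ s, |ω i| < δ} = Set.pi s fun _ => Set.Ioo (-δ) δ := by
    ext ω; simp [Set.mem_pi, abs_lt]
  rw [this, Measure.infinitePi_pi _ fun _ _ => measurableSet_Ioo]
  refine pos_iff_ne_zero.2 (Finset.prod_ne_zero_iff.2 fun i _ h => ?_)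
  have := gaussianReal_absolutelyContinuous' 0 (v := 1) one_ne_zero h
  rw [Real.volume_Ioo] at this
  simp at this
  linarith

/-- The correlation inequality stands in for independence of `U` and `V`. If `U < h` and `V < h`
almost never hold together, then `V < h` forces `h ≤ U` almost surely, and `P (V < h) ≤ P (h ≤ U) P
(V < h) < P (V < h)`. -/
theorem measure_add_lt_pos {ι : Type*} [DecidableEq ι] {U V : (ι → ℝ) → ℝ≥0∞} {h : ℝ≥0∞}
    (hU : Measurable U) (hV : Measurable V) (s : Finset ι) (hUs : DependsOn U (s : Set ι))
    (hUm : ∀ i ω a b, |a| ≤ |b| → U (Function.update ω i a) ≤ U (Function.update ω i b))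
    (hVm : ∀ i ω a b, |a| ≤ |b| → V (Function.update ω i a) ≤ V (Function.update ω i b))
    (hPU : whiteNoise ι {ω | h ≤ U ω} ≠ 1) (hPV : whiteNoise ι {ω | V ω < h} ≠ 0) :
    0 < whiteNoise ι {ω | U ω + V ω < h + h} := by
  have hA : MeasurableSet {ω | h ≤ U ω} := measurableSet_le measurable_const hU
  have hB : MeasurableSet {ω | V ω < h} := measurableSet_lt hV measurable_const
  have hAi : Measurable fun u : ℝ≥0∞ => if h ≤ u then (1 : ℝ≥0∞) else 0 :=
    Measurable.ite measurableSet_Ici measurable_const measurable_const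
  have hBi : Measurable fun u : ℝ≥0∞ => if u < h then (1 : ℝ≥0∞) else 0 :=
    Measurable.ite measurableSet_Iio measurable_const measurable_const
  have hmono : ∀ i ω a b, |a| ≤ |b| →
      (if h ≤ U (Function.update ω i a) then (1 : ℝ≥0∞) else 0) ≤
        if h ≤ U (Function.update ω i b) then 1 else 0 := fun i ω a b hab => by
    have hle := hUm i ω a b hab
    split_ifs with ha hb
    · exact le_rfl
    · exact absurd (ha.trans hle) hb
    · exact zero_le
    · exact le_rfl
  have hcorr := lintegral_mul_le_of_evenMono_of_absAnti s
    (F := fun ω => if h ≤ U ω then 1 else 0) (H := fun ω => if V ω < h then 1 else 0)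
    (hAi.comp hU) (hBi.comp hV) (fun x y hxy => by simp only [hUs hxy])
    (fun i ω a b hab => add_le_add (hmono i ω a b hab) (hmono i ω _ _ (by simpa using hab)))
    (fun i ω a b hab => by
      have hle := hVm i ω a b hab
      simp only
      split_ifs with ha hb
      · exact le_rfl
      · exact absurd (hle.trans_lt ha) hb
      · exact zero_le
      · exact le_rfl)
  have e1 : ∫⁻ ω, (if h ≤ U ω then (1 : ℝ≥0∞) else 0) ∂(whiteNoise ι) =
      whiteNoise ι {ω | h ≤ U ω} := by
    rw [← lintegral_indicator_one hA]
    exact lintegral_congr fun ω => by simp [Set.indicator]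
  have e2 : ∫⁻ ω, (if V ω < h then (1 : ℝ≥0∞) else 0) ∂(whiteNoise ι) =
      whiteNoise ι {ω | V ω < h} := by
    rw [← lintegral_indicator_one hB]
    exact lintegral_congr fun ω => by simp [Set.indicator]
  have e3 : ∫⁻ ω, (if h ≤ U ω then (1 : ℝ≥0∞) else 0) * (if V ω < h then 1 else 0)
      ∂(whiteNoise ι) = whiteNoise ι ({ω | h ≤ U ω} ∩ {ω | V ω < h}) := by
    rw [← lintegral_indicator_one (hA.inter hB)]
    refine lintegral_congr fun ω => ?_
    simp only [Set.indicator, Set.mem_inter_iff, Set.mem_ofPred_eq, Pi.one_apply, ite_and]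
    split_ifs <;> simp
  rw [e1, e2, e3] at hcorr
  refine pos_iff_ne_zero.2 fun hzero => ?_
  have hsub : whiteNoise ι ({ω | V ω < h} \ {ω | h ≤ U ω}) = 0 := by
    refine measure_mono_null (fun ω hω => ?_) hzero
    simp only [Set.mem_sdiff, Set.mem_ofPred_eq, not_le] at hω ⊢
    exact ENNReal.add_lt_add hω.2 hω.1
  have h3 : whiteNoise ι {ω | V ω < h} ≤
      whiteNoise ι {ω | h ≤ U ω} * whiteNoise ι {ω | V ω < h} :=
    calc whiteNoise ι {ω | V ω < h} ≤ whiteNoise ι ({ω | V ω < h} ∩ {ω | h ≤ U ω}) +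
          whiteNoise ι ({ω | V ω < h} \ {ω | h ≤ U ω}) := measure_le_inter_add_sdiff _ _ _
      _ ≤ _ := by rw [hsub, add_zero, Set.inter_comm]; exact hcorr
  have h4 : whiteNoise ι {ω | h ≤ U ω} < 1 := lt_of_le_of_ne prob_le_one hPU
  have h5 := ENNReal.mul_lt_mul_left hPV (measure_ne_top _ _) h4
  rw [one_mul] at h5
  exact absurd h3 (not_le.2 h5)

theorem massTerm_congr (k : ℤ) {x y : ℤ × Bool → ℝ} (h : ∀ b, x (k, b) = y (k, b)) :
    massTerm L m β k x = massTerm L m β k y := by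
  unfold massTerm; rw [h, h]

theorem sum_massTerm_le (s : Finset ℤ) {δ : ℝ} {ω : ℤ × Bool → ℝ}
    (hω : ∀ i ∈ s ×ˢ (Finset.univ : Finset Bool), |ω i| < δ) :
    ∑ k ∈ s, massTerm L m β k ω ≤ ENNReal.ofReal (∑ k ∈ s, amp L m β k ^ 2 * (2 * δ ^ 2)) := by
  rw [ENNReal.ofReal_sum_of_nonneg fun _ _ => by positivity]
  refine Finset.sum_le_sum fun k hk => ?_
  unfold massTerm
  split_ifs
  · exact zero_le
  · refine ENNReal.ofReal_le_ofReal (mul_le_mul_of_nonneg_left ?_ (sq_nonneg _))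
    have hb : ∀ b, ω (k, b) ^ 2 ≤ δ ^ 2 := fun b => by
      rw [← sq_abs]
      have := hω (k, b) (by simp [hk])
      gcongr
    linarith [hb true, hb false]

theorem exists_lintegral_tsum_compl_lt {Ω κ : Type*} [Countable κ] [MeasurableSpace Ω] (P : Measure Ω)
    (T : κ → Ω → ℝ≥0∞) (hT : ∀ k, Measurable (T k)) (h : ∫⁻ ω, ∑' k, T k ω ∂P ≠ ∞)
    {ε : ℝ≥0∞} (hε : 0 < ε) :
    ∃ s : Finset κ, ∫⁻ ω, ∑' k : { x // x ∉ s }, T k ω ∂P < ε := by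
  have hsum : ∑' k, ∫⁻ ω, T k ω ∂P ≠ ∞ := by
    rwa [← lintegral_tsum fun k => (hT k).aemeasurable]
  obtain ⟨s, hs⟩ := ((ENNReal.tendsto_tsum_compl_atTop_zero hsum).eventually
    (gt_mem_nhds hε)).exists
  refine ⟨s, ?_⟩
  rwa [lintegral_tsum fun k => (hT _).aemeasurable]

theorem measure_lt_ne_zero_of_lintegral_lt {Ω : Type*} [MeasurableSpace Ω] (P : Measure Ω)
    [IsProbabilityMeasure P] {V : Ω → ℝ≥0∞} (hV : Measurable V) {h : ℝ≥0∞}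
    (hVint : ∫⁻ ω, V ω ∂P < h) : P {ω | V ω < h} ≠ 0 := fun h0 => by
  have h1 : P {ω | h ≤ V ω} = 1 := by
    have := (prob_compl_eq_one_iff (measurableSet_lt hV measurable_const) (μ := P)).2 h0
    rwa [Set.compl_ofPred, funext fun ω => propext (not_lt (a := V ω) (b := h))] at this
  have h3 := mul_meas_ge_le_lintegral (μ := P) hV h
  rw [h1, mul_one] at h3
  exact absurd (h3.trans_lt hVint) (lt_irrefl _)

theorem measure_le_sum_massTerm_ne_one (s : Finset ℤ) {t : ℝ} (ht : 0 < t) :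
    whiteNoise (ℤ × Bool) {ω | ENNReal.ofReal t ≤ ∑ k ∈ s, massTerm L m β k ω} ≠ 1 := fun h => by
  have hU : Measurable fun ω => ∑ k ∈ s, massTerm L m β k ω :=
    Finset.measurable_sum _ fun k _ => measurable_massTerm k
  set S := ∑ k ∈ s, amp L m β k ^ 2
  have hS : 0 ≤ S := Finset.sum_nonneg fun _ _ => sq_nonneg _
  -- On the box of half-width `δ` the sum is at most `2 δ² S ≤ t / 2`; the summand `1` covers `S =
  -- 0`.
  set δ := Real.sqrt (t / (4 * (1 + S)))
  have hδ : 0 < δ := Real.sqrt_pos.2 (by positivity)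
  have hδ2 : δ ^ 2 = t / (4 * (1 + S)) := Real.sq_sqrt (by positivity)
  have hbox := measure_box_pos (s ×ˢ (Finset.univ : Finset Bool)) hδ
  have hzero := (prob_compl_eq_zero_iff (measurableSet_le measurable_const hU)
    (μ := whiteNoise (ℤ × Bool))).2 h
  refine hbox.ne' (measure_mono_null ?_ hzero)
  intro ω hω
  have hle := sum_massTerm_le (L := L) (m := m) (β := β) s hω
  refine not_le.2 (hle.trans_lt ((ENNReal.ofReal_lt_ofReal_iff ht).2 ?_))
  rw [← Finset.sum_mul, hδ2]
  change S * _ < _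
  have e : S * (2 * (t / (4 * (1 + S)))) = t / 2 * (S / (1 + S)) := by field_simp; ring
  rw [e]
  have : S / (1 + S) ≤ 1 := (div_le_one (by linarith)).2 (by linarith)
  nlinarith

theorem tailMass_eq_sum_add_tsum (s : Finset ℤ) (ω : ℤ × Bool → ℝ) : tailMass L m β ω =
    ∑ k ∈ s, massTerm L m β k ω + ∑' k : { x // x ∉ s }, massTerm L m β k ω := by
  rw [tailMass_eq_tsum]
  have h := (ENNReal.summable.tsum_add_tsum_compl (s := (s : Set ℤ))
    (f := fun k => massTerm L m β k ω) ENNReal.summable)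
  rw [← h, Finset.tsum_subtype' s fun k => massTerm L m β k ω]
  congr 1

/-- The tail mass is small with positive probability. -/
theorem measure_tailMass_lt_pos (hm : 0 < m) (hβ : 0 < β) {t : ℝ} (ht : 0 < t) :
    0 < whiteNoise (ℤ × Bool) {ω | tailMass L m β ω < ENNReal.ofReal t} := by
  -- Finitely many modes are small on a box of positive probability; the rest have mean below `t /
  -- 2`, so Markov's inequality makes them small with positive probability.
  obtain ⟨s, hs⟩ := exists_lintegral_tsum_compl_lt (whiteNoise (ℤ × Bool)) (massTerm L m β)
    measurable_massTerm (lintegral_tailMass_lt_top hm hβ).ne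
    (ε := ENNReal.ofReal (t / 2)) (ENNReal.ofReal_pos.2 (by linarith))
  have hV : Measurable fun ω => ∑' k : { x // x ∉ s }, massTerm L m β k ω :=
    Measurable.tsum fun k => measurable_massTerm _
  have hU : Measurable fun ω => ∑ k ∈ s, massTerm L m β k ω :=
    Finset.measurable_sum _ fun k _ => measurable_massTerm k
  have hPB := measure_lt_ne_zero_of_lintegral_lt _ hV hs
  have hPA := measure_le_sum_massTerm_ne_one (L := L) (m := m) (β := β) s (half_pos ht)
  have hdep : DependsOn (fun ω => ∑ k ∈ s, massTerm L m β k ω)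
      ((s ×ˢ Finset.univ : Finset (ℤ × Bool)) : Set (ℤ × Bool)) := by
    intro x y hxy
    refine Finset.sum_congr rfl fun k hk => massTerm_congr k fun b => hxy (k, b) ?_
    exact Finset.mem_coe.2 (Finset.mem_product.2 ⟨hk, Finset.mem_univ b⟩)
  have key := measure_add_lt_pos hU hV (s ×ˢ Finset.univ) hdep
    (fun i ω a b hab => Finset.sum_le_sum fun k _ => massTerm_update_le k i ω hab)
    (fun i ω a b hab => ENNReal.tsum_le_tsum fun k => massTerm_update_le k i ω hab) hPA hPB
  have hh : ENNReal.ofReal (t / 2) + ENNReal.ofReal (t / 2) = ENNReal.ofReal t := by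
    rw [← ENNReal.ofReal_add (by linarith) (by linarith), add_halves]
  rw [hh] at key
  have e : {ω | tailMass L m β ω < ENNReal.ofReal t} = {ω | ∑ k ∈ s, massTerm L m β k ω +
      ∑' k : { x // x ∉ s }, massTerm L m β k ω < ENNReal.ofReal t} :=
    Set.ext fun ω => by
      rw [Set.mem_ofPred_eq, Set.mem_ofPred_eq, ← tailMass_eq_sum_add_tsum]
  rw [e]
  exact key

end TailMass

/-! ### Exponential moments of the tail given the total mass -/

section ShellWeight
variable {L m β : ℝ} [hL : Fact (0 < L)]

variable (L m β) in
/-- Up to normalization, the density of the law of the nonzero modes conditioned on total mass `n`. -/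
def shellWeight (n : ℝ) (ω : ℤ × Bool → ℝ) : ℝ≥0∞ :=
  if tailMass L m β ω < ENNReal.ofReal n then
    ENNReal.ofReal (Real.exp ((tailMass L m β ω).toReal / meanMass L m β)) else 0

theorem measurable_shellWeight (n : ℝ) : Measurable (shellWeight L m β n) := by
  have hR := measurable_tailMass (L := L) (m := m) (β := β)
  exact Measurable.ite (measurableSet_lt hR measurable_const) (by fun_prop) measurable_const

theorem indicator_le_shellWeight (hm : 0 < m) (hβ : 0 < β) {t n : ℝ} (htn : t ≤ n)
    (ω : ℤ × Bool → ℝ) :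
    (if tailMass L m β ω < ENNReal.ofReal t then 1 else 0) ≤ shellWeight L m β n ω := by
  unfold shellWeight
  split_ifs with h1 h2 h2
  · rw [← ENNReal.ofReal_one]
    exact ENNReal.ofReal_le_ofReal
      (Real.one_le_exp (div_nonneg ENNReal.toReal_nonneg (meanMass_pos hm hβ).le))
  · exact absurd (h1.trans_le (ENNReal.ofReal_le_ofReal htn)) h2
  · exact zero_le
  · exact zero_le

theorem measure_tailMass_lt_le_lintegral_shellWeight (hm : 0 < m) (hβ : 0 < β) {t n : ℝ}
    (htn : t ≤ n) : whiteNoise (ℤ × Bool) {ω | tailMass L m β ω < ENNReal.ofReal t} ≤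
      ∫⁻ ω, shellWeight L m β n ω ∂(whiteNoise (ℤ × Bool)) := by
  have hS : MeasurableSet {ω | tailMass L m β ω < ENNReal.ofReal t} :=
    measurableSet_lt measurable_tailMass measurable_const
  rw [← lintegral_indicator_one hS]
  refine lintegral_mono fun ω => le_trans ?_ (indicator_le_shellWeight hm hβ htn ω)
  simp [Set.indicator]

theorem lintegral_shellWeight_pos (hm : 0 < m) (hβ : 0 < β) {n : ℝ} (hn : 0 < n) :
    0 < ∫⁻ ω, shellWeight L m β n ω ∂(whiteNoise (ℤ × Bool)) :=
  (measure_tailMass_lt_pos hm hβ hn).trans_le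
    (measure_tailMass_lt_le_lintegral_shellWeight hm hβ le_rfl)

theorem shellWeight_le (hm : 0 < m) (hβ : 0 < β) {n : ℝ} (hn : 0 ≤ n) (ω : ℤ × Bool → ℝ) :
    shellWeight L m β n ω ≤ ENNReal.ofReal (Real.exp (n / meanMass L m β)) *
      (if tailMass L m β ω < ENNReal.ofReal n then 1 else 0) := by
  have hs := meanMass_pos (L := L) hm hβ
  unfold shellWeight
  split_ifs with h
  · rw [mul_one]
    have := ENNReal.toReal_le_of_le_ofReal hn h.le
    gcongr
  · exact zero_le

theorem lintegral_shellWeight_lt_top (hm : 0 < m) (hβ : 0 < β) {n : ℝ} (hn : 0 ≤ n) :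
    ∫⁻ ω, shellWeight L m β n ω ∂(whiteNoise (ℤ × Bool)) < ∞ := by
  refine lt_of_le_of_lt (lintegral_mono fun ω => (shellWeight_le hm hβ hn ω).trans
    (b := _) (c := ENNReal.ofReal (Real.exp (n / meanMass L m β))) ?_) ?_
  · exact (mul_le_mul' le_rfl (by split_ifs <;> simp)).trans (mul_one _).le
  · simp

/-- Given the total mass, the squared Hölder norm of the nonzero modes has an exponential moment,
uniformly in the total mass. -/
theorem exists_lintegral_exp_mul_shellWeight_le (hm : 0 < m) (hβ : 0 < β) {α : ℝ}
    (hα : α < 1 / 2) :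
    ∃ ε : ℝ, 0 < ε ∧ ∃ C : ℝ≥0∞, C ≠ ∞ ∧ ∀ n : ℝ, 0 < n →
      ∫⁻ ω, ENNReal.ofReal (Real.exp (ε * holderNorm L m β α ω ^ 2)) * shellWeight L m β n ω
          ∂(whiteNoise (ℤ × Bool)) ≤
        C * ∫⁻ ω, shellWeight L m β n ω ∂(whiteNoise (ℤ × Bool)) := by
  obtain ⟨q, hq, hQ⟩ := exists_lintegral_exp_tailMass_lt_top (L := L) hm hβ
  set P := whiteNoise (ℤ × Bool)
  set s := meanMass L m β
  have hs : 0 < s := meanMass_pos hm hβ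
  set ε₀ := expRate L β
  have hε₀ : 0 < ε₀ := expRate_pos hβ
  set M := ∫⁻ ω, expMajorant L m β α ω ∂P
  have hM : M < ∞ := lintegral_expMajorant_lt_top hm hβ hα
  set Q := ∫⁻ ω, ENNReal.ofReal (Real.exp (q / s * (tailMass L m β ω).toReal)) ∂P
  set p₀ := P {ω | tailMass L m β ω < ENNReal.ofReal 1}
  have hp₀ : p₀ ≠ 0 := (measure_tailMass_lt_pos hm hβ one_pos).ne'
  have hmaj := ae_expMajorant_lt_top (L := L) hm hβ hα
  -- With this `ε`, `ε y² + R / s` is the convex combination of `ε₀ y²` and `q R / s` with weights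
  -- `1 - 1/q` and `1/q`, hence at most the larger of the two.
  set ε := ε₀ * ((q - 1) / q)
  have hε : 0 < ε := mul_pos hε₀ (div_pos (by linarith) (by linarith))
  have hεle : ε ≤ ε₀ := by
    have : (q - 1) / q ≤ 1 := (div_le_one (by linarith)).2 (by linarith)
    nlinarith
  refine ⟨ε, hε, ENNReal.ofReal (Real.exp (1 / s)) * M + (M + Q) / p₀,
    ENNReal.add_ne_top.2 ⟨ENNReal.mul_ne_top ENNReal.ofReal_ne_top hM.ne,
      ENNReal.div_ne_top (ENNReal.add_ne_top.2 ⟨hM.ne, hQ.ne⟩) hp₀⟩, fun n hn => ?_⟩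
  have hR := measurable_tailMass (L := L) (m := m) (β := β)
  rw [add_mul]
  rcases le_or_gt n 1 with hn1 | hn1
  -- Small mass: `H ≤ shellWeight ≤ exp (1 / s) H` with `H` decreasing in the modulus of each
  -- coordinate. The correlation inequality leaves the factor `∫ H`, which matches the normalization
  -- however small it is.
  · refine le_trans ?_ le_self_add
    set H : (ℤ × Bool → ℝ) → ℝ≥0∞ := fun ω =>
      if tailMass L m β ω < ENNReal.ofReal n then 1 else 0
    have hHm : Measurable H :=
      Measurable.ite (measurableSet_lt hR measurable_const) measurable_const measurable_const
    have hHa : AbsAnti H := absAnti_tailMass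
      (g := fun x => if x < ENNReal.ofReal n then 1 else 0) fun a b hab => by
        dsimp only
        split_ifs with h1 h2 h2
        · exact le_rfl
        · exact absurd (hab.trans_lt h1) h2
        · exact zero_le
        · exact le_rfl
    calc _ ≤ ∫⁻ ω, ENNReal.ofReal (Real.exp (1 / s)) * (expMajorant L m β α ω * H ω) ∂P := by
          refine lintegral_mono_ae ?_
          filter_upwards [hmaj] with ω hω
          rw [expMajorant_eq hβ hω, mul_left_comm]
          refine mul_le_mul' (ENNReal.ofReal_le_ofReal (Real.exp_le_exp.2 ?_))
            ((shellWeight_le hm hβ hn.le ω).trans (mul_le_mul' (ENNReal.ofReal_le_ofReal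
              (Real.exp_le_exp.2 (div_le_div_of_nonneg_right hn1 hs.le))) le_rfl))
          exact mul_le_mul_of_nonneg_right hεle (sq_nonneg _)
      _ ≤ ENNReal.ofReal (Real.exp (1 / s)) * (M * ∫⁻ ω, H ω ∂P) := by
          rw [lintegral_const_mul' _ _ ENNReal.ofReal_ne_top]
          exact mul_le_mul' le_rfl (lintegral_expMajorant_mul_le hβ α hHm hHa)
      _ ≤ _ := by
          rw [← mul_assoc]
          exact mul_le_mul' le_rfl
            (lintegral_mono fun ω => indicator_le_shellWeight hm hβ le_rfl ω)
  -- Large mass: the normalization is at least `p₀`, so a bound of the numerator by `M + Q`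
  -- suffices.
  · refine le_trans ?_ le_add_self
    have h1 : p₀ ≤ ∫⁻ ω, shellWeight L m β n ω ∂P :=
      measure_tailMass_lt_le_lintegral_shellWeight hm hβ hn1.le
    calc _ ≤ ∫⁻ ω, (expMajorant L m β α ω +
            ENNReal.ofReal (Real.exp (q / s * (tailMass L m β ω).toReal))) ∂P := by
          refine lintegral_mono_ae ?_
          filter_upwards [hmaj] with ω hω
          set R := (tailMass L m β ω).toReal with hRdef
          set y := holderNorm L m β α ω
          have hw : shellWeight L m β n ω ≤ ENNReal.ofReal (Real.exp (R / s)) := by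
            unfold shellWeight; split_ifs
            exacts [le_rfl, zero_le]
          rw [expMajorant_eq hβ hω]
          refine (mul_le_mul' le_rfl hw).trans ?_
          rw [← ENNReal.ofReal_mul (Real.exp_pos _).le, ← Real.exp_add]
          have e1 : ε * y ^ 2 + ε₀ * y ^ 2 / q = ε₀ * y ^ 2 := by
            simp only [ε]; field_simp; ring
          rcases le_or_gt (q / s * R) (ε₀ * y ^ 2) with h | h
          · refine le_trans (ENNReal.ofReal_le_ofReal (Real.exp_le_exp.2 ?_)) le_self_add
            have : R / s ≤ ε₀ * y ^ 2 / q := by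
              rw [le_div_iff₀ (by linarith)]
              calc R / s * q = q / s * R := by ring
                _ ≤ _ := h
            linarith
          · refine le_trans (ENNReal.ofReal_le_ofReal (Real.exp_le_exp.2 ?_)) le_add_self
            have h2 : ε * y ^ 2 = (ε₀ * y ^ 2) * ((q - 1) / q) := by simp only [ε]; ring
            have h3 : (ε₀ * y ^ 2) * ((q - 1) / q) ≤ (q / s * R) * ((q - 1) / q) :=
              mul_le_mul_of_nonneg_right h.le (div_nonneg (by linarith) (by linarith))
            have h4 : (q / s * R) * ((q - 1) / q) + R / s = q / s * R := by
              field_simp; ring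
            linarith
      _ = M + Q := lintegral_add_left (measurable_expMajorant α) _
      _ = (M + Q) / p₀ * p₀ := (ENNReal.div_mul_cancel hp₀ (measure_ne_top _ _)).symm
      _ ≤ _ := mul_le_mul' le_rfl h1

end ShellWeight

/-! ### The truncated Fejér kernel as an approximate identity of mass `2π` -/

section Fejer

/-- The Dirichlet kernel. -/
def dirichlet (k : ℕ) (t : ℝ) : ℝ := ∑ j ∈ Finset.Icc (-(k : ℤ)) (k : ℤ), Real.cos (j * t)

theorem Icc_neg_natCast_succ (k : ℕ) : Finset.Icc (-((k + 1 : ℕ) : ℤ)) ((k + 1 : ℕ) : ℤ) =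
    insert (-((k + 1 : ℕ) : ℤ)) (insert ((k + 1 : ℕ) : ℤ) (Finset.Icc (-(k : ℤ)) (k : ℤ))) := by
  ext j
  simp only [Finset.mem_Icc, Finset.mem_insert]
  omega

theorem dirichlet_succ (k : ℕ) (t : ℝ) :
    dirichlet (k + 1) t = dirichlet k t + 2 * Real.cos ((k + 1) * t) := by
  unfold dirichlet
  rw [Icc_neg_natCast_succ, Finset.sum_insert, Finset.sum_insert]
  · push_cast
    rw [show (-((k : ℝ) + 1)) * t = -((k + 1) * t) by ring, Real.cos_neg]
    ring
  · simp
  · simp only [Finset.mem_Icc, Finset.mem_insert]; omega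

theorem one_sub_cos_mul_dirichlet (k : ℕ) (t : ℝ) :
    (1 - Real.cos t) * dirichlet k t = Real.cos (k * t) - Real.cos ((k + 1) * t) := by
  induction k with
  | zero => simp [dirichlet]
  | succ k ih =>
    rw [dirichlet_succ, mul_add, ih]
    push_cast
    have h1 : Real.cos ((k : ℝ) * t) = Real.cos ((k + 1) * t - t) := by congr 1; ring
    have h2 : Real.cos (((k : ℝ) + 1 + 1) * t) = Real.cos ((k + 1) * t + t) := by congr 1; ring
    rw [h1, h2, Real.cos_sub, Real.cos_add]
    ring

/-- Multiplication by `1 - cos t` makes both the Dirichlet sum and the sum over `k` telescope. This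
closed form gives positivity of the Fejér kernel and its decay away from the origin. -/
theorem one_sub_cos_mul_sum_dirichlet (l : ℕ) (t : ℝ) :
    (1 - Real.cos t) * ∑ k ∈ Finset.range l, dirichlet k t = 1 - Real.cos (l * t) := by
  induction l with
  | zero => simp
  | succ l ih =>
    rw [Finset.sum_range_succ, mul_add, ih, one_sub_cos_mul_dirichlet]
    push_cast; ring

theorem fejer_of_abs_le {l : ℕ} {t : ℝ} (ht : |t| ≤ Real.pi) :
    fejer l t = 1 / (l : ℝ) * ∑ k ∈ Finset.range l, dirichlet k t := if_pos ht

theorem fejer_of_lt_abs {l : ℕ} {t : ℝ} (ht : Real.pi < |t|) : fejer l t = 0 :=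
  if_neg (not_le.2 ht)

theorem one_sub_cos_mul_fejer {l : ℕ} {t : ℝ} (ht : |t| ≤ Real.pi) :
    (1 - Real.cos t) * fejer l t = 1 / (l : ℝ) * (1 - Real.cos (l * t)) := by
  rw [fejer_of_abs_le ht, mul_left_comm, one_sub_cos_mul_sum_dirichlet]

theorem fejer_nonneg (l : ℕ) (t : ℝ) : 0 ≤ fejer l t := by
  rcases lt_or_ge Real.pi |t| with h | h
  · rw [fejer_of_lt_abs h]
  · rcases (Real.cos_le_one t).lt_or_eq with hc | hc
    · have h1 := one_sub_cos_mul_fejer (l := l) h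
      have h2 : 0 ≤ 1 / (l : ℝ) * (1 - Real.cos (l * t)) :=
        mul_nonneg (by positivity) (by linarith [Real.cos_le_one (l * t)])
      rw [← h1] at h2
      exact nonneg_of_mul_nonneg_right h2 (by linarith)
    -- On `[-π, π]` the factor `1 - cos t` vanishes only at `0`, where all cosines equal `1`.
    · rw [abs_le] at h
      have : t = 0 := (Real.cos_eq_one_iff_of_lt_of_lt (by linarith [Real.pi_pos])
        (by linarith [Real.pi_pos])).1 hc
      subst this
      rw [fejer_of_abs_le (by simpa using Real.pi_pos.le)]
      exact mul_nonneg (by positivity) (Finset.sum_nonneg fun k _ => by simp [dirichlet])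

theorem measurable_fejer (l : ℕ) : Measurable (fejer l) := by
  unfold fejer
  exact Measurable.ite (measurableSet_le (by fun_prop) measurable_const) (by fun_prop)
    measurable_const

theorem fejer_le {l : ℕ} (hl : 0 < l) (t : ℝ) {δ : ℝ} (hδ : 0 < δ) (hδπ : δ ≤ Real.pi)
    (ht : δ ≤ |t|) : fejer l t ≤ 2 / (1 - Real.cos δ) / l := by
  have hl' : (0 : ℝ) < l := Nat.cast_pos.2 hl
  have hc : Real.cos δ < 1 := by
    rw [← Real.cos_zero]
    exact Real.cos_lt_cos_of_nonneg_of_le_pi le_rfl hδπ hδ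
  rcases lt_or_ge Real.pi |t| with h | h
  · rw [fejer_of_lt_abs h]
    exact div_nonneg (div_nonneg (by norm_num) (by linarith)) hl'.le
  · have h1 := one_sub_cos_mul_fejer (l := l) h
    have h2 : Real.cos t ≤ Real.cos δ := by
      rw [← Real.cos_abs t]
      exact Real.cos_le_cos_of_nonneg_of_le_pi hδ.le h ht
    have h3 : (1 - Real.cos δ) * fejer l t ≤ (1 - Real.cos t) * fejer l t :=
      mul_le_mul_of_nonneg_right (by linarith) (fejer_nonneg l t)
    rw [div_div, le_div_iff₀ (mul_pos (by linarith) hl')]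
    have h4 : (1 - Real.cos t) * fejer l t * l ≤ 2 := by
      rw [h1]
      have := Real.neg_one_le_cos (l * t)
      rw [mul_comm (1 / (l : ℝ)), mul_assoc, one_div_mul_cancel hl'.ne', mul_one]
      linarith
    calc fejer l t * ((1 - Real.cos δ) * l) = (1 - Real.cos δ) * fejer l t * l := by ring
      _ ≤ (1 - Real.cos t) * fejer l t * l := mul_le_mul_of_nonneg_right h3 hl'.le
      _ ≤ 2 := h4

theorem fejer_le_natCast (l : ℕ) (t : ℝ) : fejer l t ≤ 2 * l + 1 := by
  rcases lt_or_ge Real.pi |t| with h | h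
  · rw [fejer_of_lt_abs h]; positivity
  · rw [fejer_of_abs_le h]
    have h1 : ∀ k ∈ Finset.range l, dirichlet k t ≤ 2 * l + 1 := fun k hk => by
      have hk' : (k : ℝ) ≤ l := by exact_mod_cast (Finset.mem_range.1 hk).le
      refine (Finset.sum_le_card_nsmul _ _ 1 fun j _ => Real.cos_le_one _).trans ?_
      rw [Int.card_Icc, nsmul_eq_mul, mul_one, show ((k : ℤ) + 1 - -(k : ℤ)).toNat = 2 * k + 1 by omega]
      push_cast; linarith
    have h2 := Finset.sum_le_card_nsmul _ _ _ h1
    rw [Finset.card_range, nsmul_eq_mul] at h2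
    rcases Nat.eq_zero_or_pos l with rfl | hl
    · simp
    · have hl' : (0 : ℝ) < l := Nat.cast_pos.2 hl
      rw [one_div_mul_eq_div, div_le_iff₀ hl']
      linarith

theorem integral_cos_int_mul (j : ℤ) :
    ∫ t in (-Real.pi)..Real.pi, Real.cos (j * t) = if j = 0 then 2 * Real.pi else 0 := by
  split_ifs with hj
  · subst hj; simp; ring
  · have hj' : (j : ℝ) ≠ 0 := Int.cast_ne_zero.2 hj
    rw [intervalIntegral.integral_comp_mul_left (fun t => Real.cos t) hj', integral_cos,
      mul_neg, Real.sin_neg, Real.sin_int_mul_pi]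
    simp

theorem setIntegral_fejer {l : ℕ} (hl : 0 < l) :
    ∫ t in Set.Icc (-Real.pi) Real.pi, fejer l t = 2 * Real.pi := by
  have hl' : (0 : ℝ) < l := Nat.cast_pos.2 hl
  rw [setIntegral_congr_fun (g := fun t => 1 / (l : ℝ) * ∑ k ∈ Finset.range l, dirichlet k t)
    measurableSet_Icc fun t ht => fejer_of_abs_le (abs_le.2 ht), integral_Icc_eq_integral_Ioc,
    ← intervalIntegral.integral_of_le (by linarith [Real.pi_pos]),
    intervalIntegral.integral_const_mul, intervalIntegral.integral_finsetSum]
  · have : ∀ k ∈ Finset.range l, ∫ t in (-Real.pi)..Real.pi, dirichlet k t = 2 * Real.pi := by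
      intro k _
      unfold dirichlet
      rw [intervalIntegral.integral_finsetSum]
      · simp_rw [integral_cos_int_mul]
        rw [Finset.sum_ite_eq' _ (0 : ℤ), if_pos (by simp)]
      · intro j _
        exact Continuous.intervalIntegrable (by fun_prop) _ _
    rw [Finset.sum_congr rfl this, Finset.sum_const, Finset.card_range, nsmul_eq_mul]
    field_simp
  · intro k _
    exact Continuous.intervalIntegrable (by unfold dirichlet; fun_prop) _ _

theorem integrable_fejer (l : ℕ) : Integrable (fejer l) := by
  rw [← integrableOn_univ]
  refine IntegrableOn.of_forall_sdiff_eq_zero (s := Set.Icc (-Real.pi) Real.pi) ?_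
    MeasurableSet.univ fun t ht => fejer_of_lt_abs ?_
  · refine Measure.integrableOn_of_bounded (M := 2 * l + 1) (by simp)
      (measurable_fejer l).aestronglyMeasurable (ae_of_all _ fun t => ?_)
    rw [Real.norm_of_nonneg (fejer_nonneg l t)]
    exact fejer_le_natCast l t
  · by_contra h
    exact ht.2 (abs_le.1 (not_lt.1 h))

theorem integral_fejer {l : ℕ} (hl : 0 < l) : ∫ t, fejer l t = 2 * Real.pi := by
  rw [← setIntegral_fejer hl, setIntegral_eq_integral_of_forall_compl_eq_zero]
  intro t ht
  exact fejer_of_lt_abs (not_le.1 fun h => ht (abs_le.1 h))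

theorem tendstoUniformlyOn_fejer {u : Set ℝ} (hu : IsOpen u) (h0 : 0 ∈ u) :
    TendstoUniformlyOn (fun l t => (2 * Real.pi)⁻¹ * fejer l t) 0 atTop uᶜ := by
  obtain ⟨δ', hδ', hball⟩ := Metric.isOpen_iff.1 hu 0 h0
  set δ := min δ' Real.pi
  have hδ : 0 < δ := lt_min hδ' Real.pi_pos
  have hsub : ∀ t ∈ uᶜ, δ ≤ |t| := fun t ht => by
    by_contra h
    refine ht (hball ?_)
    rw [Metric.mem_ball, Real.dist_eq, sub_zero]
    exact (not_le.1 h).trans_le (min_le_left _ _)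
  have hlim : Tendsto (fun l : ℕ => (2 * Real.pi)⁻¹ * (2 / (1 - Real.cos δ) / l)) atTop (𝓝 0) := by
    have := (tendsto_const_div_atTop_nhds_zero_nat (2 / (1 - Real.cos δ))).const_mul
      (2 * Real.pi)⁻¹
    rwa [mul_zero] at this
  rw [Metric.tendstoUniformlyOn_iff]
  intro ε hε
  filter_upwards [hlim.eventually (gt_mem_nhds hε), eventually_gt_atTop 0] with l hl hl0 t ht
  rw [Pi.zero_apply, dist_zero_left, Real.norm_of_nonneg
    (mul_nonneg (by positivity) (fejer_nonneg l t))]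
  refine lt_of_le_of_lt ?_ hl
  exact mul_le_mul_of_nonneg_left (fejer_le hl0 t hδ (min_le_right _ _) (hsub t ht))
    (by positivity)

/-- Only continuity at the point `a` is asked of `g`, because the exponential density jumps at `0`.
The truncation to `[-π, π]` keeps periodic copies of the peak from contributing. -/
theorem tendsto_integral_fejer_mul {g : ℝ → ℝ} (hg : Integrable g) {a : ℝ}
    (ha : ContinuousAt g a) :
    Tendsto (fun l : ℕ => ∫ r, fejer l (a - r) * g r) atTop (𝓝 (2 * Real.pi * g a)) := by
  have key := tendsto_integral_peak_smul_of_integrable_of_tendsto (E := ℝ) (μ := volume) (x₀ := (0 : ℝ))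
    (φ := fun (l : ℕ) t => (2 * Real.pi)⁻¹ * fejer l t) (g := fun t => g (a - t)) (a := g a)
    (l := atTop) (t := Set.Icc (-Real.pi) Real.pi) measurableSet_Icc
    (Icc_mem_nhds (by linarith [Real.pi_pos]) Real.pi_pos) (by simp)
    (Eventually.of_forall fun l t => mul_nonneg (by positivity) (fejer_nonneg l t))
    (fun u hu h0 => tendstoUniformlyOn_fejer hu h0) ?_
    (Eventually.of_forall fun l => ((measurable_fejer l).const_mul _).aestronglyMeasurable)
    (hg.comp_sub_left a) ?_
  · have h2 := key.const_mul (2 * Real.pi)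
    refine h2.congr fun l => ?_
    rw [← integral_const_mul, ← integral_sub_left_eq_self
      (fun t => 2 * Real.pi * (((2 * Real.pi)⁻¹ * fejer l t) • g (a - t))) volume a]
    refine integral_congr_ae (ae_of_all _ fun r => ?_)
    have : (2 * Real.pi) ≠ 0 := by positivity
    simp only [smul_eq_mul, sub_sub_cancel]
    field_simp
  · refine tendsto_const_nhds.congr' ?_
    filter_upwards [eventually_gt_atTop 0] with l hl
    rw [integral_const_mul, setIntegral_fejer hl, inv_mul_cancel₀ (by positivity)]
  · have h3 : Tendsto (fun t : ℝ => a - t) (𝓝 0) (𝓝 a) := by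
      have : Continuous fun t : ℝ => a - t := by fun_prop
      simpa using this.tendsto 0
    exact ha.tendsto.comp h3

/-- The kernel is nonnegative of fixed mass, so the bound is uniform in `l`; it provides the
domination in the outer integral. -/
theorem abs_integral_fejer_mul_le {g : ℝ → ℝ} {B : ℝ} (hB : ∀ r, |g r| ≤ B) {l : ℕ} (hl : 0 < l)
    (a : ℝ) : |∫ r, fejer l (a - r) * g r| ≤ 2 * Real.pi * B := by
  have h1 : Integrable fun r => fejer l (a - r) * B :=
    ((integrable_fejer l).comp_sub_left a).mul_const B
  rw [← Real.norm_eq_abs]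
  refine (norm_integral_le_of_norm_le h1 (ae_of_all _ fun r => ?_)).trans ?_
  · rw [norm_mul, Real.norm_of_nonneg (fejer_nonneg l _)]
    exact mul_le_mul_of_nonneg_left (hB r) (fejer_nonneg l _)
  · rw [integral_mul_const, integral_sub_left_eq_self (fejer l) volume a, integral_fejer hl]

end Fejer

/-! ### Test functions against the exponential density -/

section MassDensity

/-- The exponential density of mean `s` multiplied by `F`. -/
def massDensityMul (s : ℝ) (F : ℝ → ℝ) : ℝ → ℝ :=
  (Set.Ioi 0).indicator fun r => s⁻¹ * Real.exp (-(r / s)) * F r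

theorem integral_massLaw {s : ℝ} (hs : 0 < s) (F : ℝ → ℝ) :
    ∫ r, F r ∂(massLaw s) = ∫ r, massDensityMul s F r := by
  rw [massLaw, integral_withDensity_eq_integral_toReal_smul (by fun_prop)
    (ae_of_all _ fun _ => ENNReal.ofReal_lt_top), massDensityMul,
    integral_indicator measurableSet_Ioi]
  refine integral_congr_ae (ae_of_all _ fun r => ?_)
  dsimp only
  rw [ENNReal.toReal_ofReal (by positivity), smul_eq_mul]

theorem abs_massDensityMul_le {s : ℝ} (hs : 0 < s) {F : ℝ → ℝ} {B : ℝ} (hB : ∀ r, |F r| ≤ B)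
    (r : ℝ) : |massDensityMul s F r| ≤ s⁻¹ * B := by
  have hB0 : 0 ≤ B := (abs_nonneg _).trans (hB 0)
  unfold massDensityMul
  by_cases hr : r ∈ Set.Ioi (0 : ℝ)
  · rw [Set.indicator_of_mem hr, abs_mul, abs_of_nonneg (by positivity)]
    have h1 : Real.exp (-(r / s)) ≤ 1 := Real.exp_le_one_iff.2 (by
      have := div_nonneg (le_of_lt hr) hs.le; linarith)
    have h2 : s⁻¹ * Real.exp (-(r / s)) ≤ s⁻¹ := by
      have := inv_pos.2 hs; nlinarith
    exact mul_le_mul h2 (hB r) (abs_nonneg _) (inv_pos.2 hs).le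
  · rw [Set.indicator_of_notMem hr, abs_zero]; have := inv_pos.2 hs; positivity

theorem integrable_massDensityMul {s : ℝ} (hs : 0 < s) {F : ℝ → ℝ} (hF : Measurable F) {B : ℝ}
    (hB : ∀ r, |F r| ≤ B) : Integrable (massDensityMul s F) := by
  unfold massDensityMul
  rw [integrable_indicator_iff measurableSet_Ioi]
  have h1 := (exp_neg_integrableOn_Ioi 0 (inv_pos.2 hs)).const_mul s⁻¹
  have h2 : IntegrableOn (fun r : ℝ => s⁻¹ * Real.exp (-(r / s))) (Set.Ioi 0) := by
    refine h1.congr (ae_of_all _ fun r => ?_)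
    dsimp only
    congr 2; field_simp
  exact Integrable.mul_bdd (c := B) h2 hF.aestronglyMeasurable (ae_of_all _ fun r => hB r)

theorem continuousAt_massDensityMul {s : ℝ} {F : ℝ → ℝ} (hF : Continuous F) {a : ℝ}
    (ha : a ≠ 0) : ContinuousAt (massDensityMul s F) a := by
  rcases lt_or_gt_of_ne ha with h | h
  · refine (continuousAt_const (x := a) (y := (0 : ℝ))).congr ?_
    filter_upwards [gt_mem_nhds h] with r hr
    rw [massDensityMul, Set.indicator_of_notMem fun h' => lt_asymm (Set.mem_Ioi.1 h') hr]
  · have : ContinuousAt (fun r => s⁻¹ * Real.exp (-(r / s)) * F r) a := by fun_prop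
    refine this.congr ?_
    filter_upwards [lt_mem_nhds h] with r hr
    rw [massDensityMul, Set.indicator_of_mem (Set.mem_Ioi.2 hr)]

end MassDensity

/-! ### The conditioned measure in explicit form -/

section Shell
variable {L m β : ℝ} [hL : Fact (0 < L)]

theorem continuous_normPow {p : ℝ} (hp : 0 ≤ p) : Continuous (normPow L p) := by
  rw [continuous_iff_continuousAt]
  intro φ
  refine MeasureTheory.continuousAt_of_dominated (bound := fun _ => (‖φ‖ + 1) ^ p) ?_ ?_
    (integrable_const _) ?_
  · refine Eventually.of_forall fun ψ => Continuous.aestronglyMeasurable ?_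
    exact (ψ.continuous.norm).rpow_const fun _ => Or.inr hp
  · filter_upwards [Metric.ball_mem_nhds φ one_pos] with ψ hψ
    refine ae_of_all _ fun x => ?_
    rw [Real.norm_of_nonneg (by positivity)]
    refine Real.rpow_le_rpow (norm_nonneg _) ((ψ.norm_coe_le_norm x).trans ?_) hp
    have := norm_sub_norm_le ψ φ
    rw [Metric.mem_ball, dist_eq_norm] at hψ
    linarith
  · refine ae_of_all _ fun x => ?_
    have h1 : Continuous fun ψ : Field L => ψ x := continuous_eval_const x
    exact ((h1.norm).rpow_const fun _ => Or.inr hp).continuousAt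

variable (L m β) in
/-- The field with nonzero modes given by `p.1`, zero mode of phase `p.2` and total mass `n`. -/
def shellField (n : ℝ) (p : (ℤ × Bool → ℝ) × ℝ) : Field L :=
  polarField L m β (p.1, p.2, n - (tailMass L m β p.1).toReal)

theorem aemeasurable_shellField (hm : 0 < m) (hβ : 0 < β) (n : ℝ) :
    AEMeasurable (shellField L m β n) ((whiteNoise (ℤ × Bool)).prod phaseLaw) := by
  have h1 := (aemeasurable_tailField (L := L) hm hβ).comp_fst (ν := phaseLaw)
  have hR := measurable_tailMass (L := L) (m := m) (β := β)
  have h2 : Measurable fun p : (ℤ × Bool → ℝ) × ℝ =>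
      polarPoint (p.2, n - (tailMass L m β p.1).toReal) :=
    measurable_polarPoint.comp (by fun_prop)
  exact (h2.smul_const _).aemeasurable.add h1

theorem N_polarField (hβ : 0 < β) {α : ℝ} (hα0 : 0 < α) (hα : α < 1 / 2) {ω : ℤ × Bool → ℝ}
    (h : expMajorant L m β α ω < ∞) (θ : ℝ) {r : ℝ} (hr : 0 ≤ r) :
    N L (polarField L m β (ω, θ, r)) = r + (tailMass L m β ω).toReal := by
  rw [polarField, N_eq hβ hα0 hα h, norm_polarPoint_sq hr]

theorem continuous_polarField (ω : ℤ × Bool → ℝ) (θ : ℝ) :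
    Continuous fun r => polarField L m β (ω, θ, r) := by
  have : Continuous fun r => polarPoint (θ, r) := by unfold polarPoint; fun_prop
  exact (this.smul (continuous_const (y := modeField L 0))).add
    (continuous_const (y := tailField L m β ω))

variable (L m β) in
/-- The reference measure conditioned on total mass `n`. -/
def shellMeasure (n : ℝ) : Measure (Field L) :=
  (∫⁻ ω, shellWeight L m β n ω ∂(whiteNoise (ℤ × Bool)))⁻¹ •
    (((whiteNoise (ℤ × Bool)).prod phaseLaw).withDensity
      fun p => shellWeight L m β n p.1).map (shellField L m β n)

theorem lintegral_shellMeasure (hm : 0 < m) (hβ : 0 < β) (n : ℝ) {F : Field L → ℝ≥0∞}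
    (hF : Measurable F) :
    ∫⁻ φ, F φ ∂(shellMeasure L m β n) =
      (∫⁻ ω, shellWeight L m β n ω ∂(whiteNoise (ℤ × Bool)))⁻¹ *
        ∫⁻ p, shellWeight L m β n p.1 * F (shellField L m β n p)
          ∂((whiteNoise (ℤ × Bool)).prod phaseLaw) := by
  have h1 := aemeasurable_shellField (L := L) hm hβ n
  have hw : Measurable fun p : (ℤ × Bool → ℝ) × ℝ => shellWeight L m β n p.1 :=
    (measurable_shellWeight n).comp measurable_fst
  rw [shellMeasure, lintegral_smul_measure, smul_eq_mul, lintegral_map' hF.aemeasurable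
    (h1.mono_ac (withDensity_absolutelyContinuous _ _))]
  exact congrArg _ (lintegral_withDensity_eq_lintegral_mul₀ hw.aemeasurable
    (hF.comp_aemeasurable h1))

theorem lintegral_comp_fst_phaseLaw {H : (ℤ × Bool → ℝ) → ℝ≥0∞} (hH : AEMeasurable H (whiteNoise (ℤ × Bool))) :
    ∫⁻ p, H p.1 ∂((whiteNoise (ℤ × Bool)).prod phaseLaw) = ∫⁻ ω, H ω ∂(whiteNoise (ℤ × Bool)) := by
  rw [lintegral_prod _ hH.comp_fst]
  simp

theorem isProbabilityMeasure_shellMeasure (hm : 0 < m) (hβ : 0 < β) {n : ℝ} (hn : 0 < n) :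
    IsProbabilityMeasure (shellMeasure L m β n) := by
  refine ⟨?_⟩
  rw [← lintegral_one, lintegral_shellMeasure hm hβ n measurable_const]
  simp_rw [mul_one]
  rw [lintegral_comp_fst_phaseLaw (measurable_shellWeight n).aemeasurable]
  exact ENNReal.inv_mul_cancel (lintegral_shellWeight_pos hm hβ hn).ne'
    (lintegral_shellWeight_lt_top hm hβ hn.le).ne

theorem integral_shellMeasure (hm : 0 < m) (hβ : 0 < β) {n : ℝ} (f : Field L →ᵇ ℝ) :
    ∫ φ, f φ ∂(shellMeasure L m β n) =
      (∫⁻ ω, shellWeight L m β n ω ∂(whiteNoise (ℤ × Bool))).toReal⁻¹ *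
        ∫ p, (shellWeight L m β n p.1).toReal * f (shellField L m β n p)
          ∂((whiteNoise (ℤ × Bool)).prod phaseLaw) := by
  have h1 := aemeasurable_shellField (L := L) hm hβ n
  have hw : Measurable fun p : (ℤ × Bool → ℝ) × ℝ => shellWeight L m β n p.1 :=
    (measurable_shellWeight n).comp measurable_fst
  rw [shellMeasure, integral_smul_measure, integral_map
    (h1.mono_ac (withDensity_absolutelyContinuous _ _))
    f.continuous.measurable.aestronglyMeasurable,
    integral_withDensity_eq_integral_toReal_smul hw (ae_of_all _ fun p => ?_), ENNReal.toReal_inv]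
  · rfl
  · unfold shellWeight
    split_ifs
    exacts [ENNReal.ofReal_lt_top, ENNReal.zero_lt_top]

end Shell

/-! ### Weak convergence of the Fejér-weighted measures -/

section Conditioning
variable {L m β : ℝ} [hL : Fact (0 < L)]

theorem isProbabilityMeasure_massLaw {s : ℝ} (hs : 0 < s) : IsProbabilityMeasure (massLaw s) :=
  ⟨massLaw_univ hs⟩

theorem refMeasure_eq_map_prod (hm : 0 < m) (hβ : 0 < β) :
    AEMeasurable (fun p : ((ℤ × Bool → ℝ) × ℝ) × ℝ => polarField L m β (p.1.1, p.1.2, p.2))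
      (((whiteNoise (ℤ × Bool)).prod phaseLaw).prod (massLaw (meanMass L m β))) ∧
    refMeasure L m β = (((whiteNoise (ℤ × Bool)).prod phaseLaw).prod
      (massLaw (meanMass L m β))).map fun p => polarField L m β (p.1.1, p.1.2, p.2) := by
  have hψ := measurePreserving_prodAssoc (whiteNoise (ℤ × Bool)) phaseLaw
    (massLaw (meanMass L m β))
  have h := aemeasurable_polarField (L := L) hm hβ (phaseLaw.prod (massLaw (meanMass L m β)))
  refine ⟨?_, ?_⟩
  · rw [← hψ.map_eq] at h
    exact h.comp_measurable hψ.measurable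
  · rw [refMeasure_eq_map_polarField hm hβ]
    exact map_comp_of_measurePreserving hψ h

/-- Additivity of the mass turns the weight into a convolution kernel in the mass `r` of the zero
mode, centred at `n - R`. -/
theorem integral_fejer_mul_polarField (hm : 0 < m) (hβ : 0 < β) {α : ℝ} (hα0 : 0 < α)
    (hα : α < 1 / 2) {ω : ℤ × Bool → ℝ} (h : expMajorant L m β α ω < ∞) (θ n : ℝ) (l : ℕ)
    (f : Field L →ᵇ ℝ) :
    ∫ r, fejer l (n - N L (polarField L m β (ω, θ, r))) * f (polarField L m β (ω, θ, r))
        ∂(massLaw (meanMass L m β)) =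
      ∫ r, fejer l (n - (tailMass L m β ω).toReal - r) *
        massDensityMul (meanMass L m β) (fun r => f (polarField L m β (ω, θ, r))) r := by
  rw [integral_massLaw (meanMass_pos hm hβ)]
  refine integral_congr_ae (ae_of_all _ fun r => ?_)
  dsimp only [massDensityMul]
  by_cases hr : r ∈ Set.Ioi (0 : ℝ)
  · rw [Set.indicator_of_mem hr, Set.indicator_of_mem hr, N_polarField hβ hα0 hα h θ (le_of_lt hr),
      sub_sub, add_comm r]
    ring
  · rw [Set.indicator_of_notMem hr, Set.indicator_of_notMem hr, mul_zero]

/-- The density at `n - R` splits as `s⁻¹ exp (-n / s) · exp (R / s)`: the first factor disappears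
on normalizing, the second is the shell weight. Both sides vanish for `R ≥ n`. -/
theorem massDensityMul_shell (hm : 0 < m) (hβ : 0 < β) {ω : ℤ × Bool → ℝ}
    (h : tailMass L m β ω ≠ ∞) (θ : ℝ) {n : ℝ} (hn : 0 < n) (f : Field L →ᵇ ℝ) :
    massDensityMul (meanMass L m β) (fun r => f (polarField L m β (ω, θ, r)))
      (n - (tailMass L m β ω).toReal) =
    (meanMass L m β)⁻¹ * Real.exp (-(n / meanMass L m β)) *
      ((shellWeight L m β n ω).toReal * f (shellField L m β n (ω, θ))) := by
  have hs := meanMass_pos (L := L) hm hβ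
  set s := meanMass L m β
  have hiff : tailMass L m β ω < ENNReal.ofReal n ↔ 0 < n - (tailMass L m β ω).toReal := by
    rw [sub_pos, ← ENNReal.ofReal_lt_ofReal_iff hn, ENNReal.ofReal_toReal h]
  unfold massDensityMul shellWeight
  by_cases hr : 0 < n - (tailMass L m β ω).toReal
  · rw [Set.indicator_of_mem (Set.mem_Ioi.2 hr), if_pos (hiff.2 hr),
      ENNReal.toReal_ofReal (Real.exp_pos _).le]
    have : Real.exp (-((n - (tailMass L m β ω).toReal) / s)) =
        Real.exp (-(n / s)) * Real.exp ((tailMass L m β ω).toReal / s) := by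
      rw [← Real.exp_add]; congr 1; ring
    rw [this]
    simp only [shellField]
    ring
  · rw [Set.indicator_of_notMem (fun h' => hr (Set.mem_Ioi.1 h')), if_neg (fun h' => hr (hiff.1 h'))]
    simp

theorem continuous_N : Continuous (N L) := continuous_normPow (by norm_num)

/-- With phase and tail frozen, the integral over the mass of the zero mode converges by the
approximate identity unless `n - R = 0`, the jump of the density. That event is null since `R` has
no atoms. -/
theorem tendsto_integral_fejer_refMeasure (hm : 0 < m) (hβ : 0 < β) {n : ℝ} (hn : 0 < n)
    (f : Field L →ᵇ ℝ) :
    Tendsto (fun l : ℕ => ∫ φ, fejer l (n - N L φ) * f φ ∂(refMeasure L m β)) atTop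
      (𝓝 (2 * Real.pi * ((meanMass L m β)⁻¹ * Real.exp (-(n / meanMass L m β))) *
        ∫ p, (shellWeight L m β n p.1).toReal * f (shellField L m β n p)
          ∂((whiteNoise (ℤ × Bool)).prod phaseLaw))) := by
  have hs := meanMass_pos (L := L) hm hβ
  set s := meanMass L m β
  set E := massLaw s
  set Q := (whiteNoise (ℤ × Bool)).prod phaseLaw
  have : IsProbabilityMeasure E := isProbabilityMeasure_massLaw hs
  obtain ⟨hmeas, heq⟩ := refMeasure_eq_map_prod (L := L) hm hβ
  have hFm : ∀ l : ℕ, Measurable fun φ : Field L => fejer l (n - N L φ) * f φ := fun l =>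
    ((measurable_fejer l).comp (measurable_const.sub continuous_N.measurable)).mul
      f.continuous.measurable
  have hint : ∀ l : ℕ, Integrable (fun p : ((ℤ × Bool → ℝ) × ℝ) × ℝ =>
      fejer l (n - N L (polarField L m β (p.1.1, p.1.2, p.2))) *
        f (polarField L m β (p.1.1, p.1.2, p.2))) (Q.prod E) := fun l => by
    refine Integrable.of_bound ((hFm l).comp_aemeasurable hmeas).aestronglyMeasurable
      ((2 * l + 1) * ‖f‖) (ae_of_all _ fun p => ?_)
    rw [norm_mul, Real.norm_of_nonneg (fejer_nonneg l _)]
    exact mul_le_mul (fejer_le_natCast l _) (f.norm_coe_le_norm _) (norm_nonneg _) (by positivity)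
  have hrepr : ∀ l : ℕ, ∫ φ, fejer l (n - N L φ) * f φ ∂(refMeasure L m β) =
      ∫ q, ∫ r, fejer l (n - N L (polarField L m β (q.1, q.2, r))) *
        f (polarField L m β (q.1, q.2, r)) ∂E ∂Q := fun l => by
    rw [heq, integral_map hmeas (hFm l).aestronglyMeasurable, integral_prod _ (hint l)]
  simp_rw [hrepr]
  rw [← integral_const_mul]
  have hα0 : (0 : ℝ) < 1 / 4 := by norm_num
  have hα : (1 / 4 : ℝ) < 1 / 2 := by norm_num
  have hgood : ∀ᵐ q ∂Q, expMajorant L m β (1 / 4) q.1 < ∞ :=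
    Measure.quasiMeasurePreserving_fst.ae (ae_expMajorant_lt_top (L := L) hm hβ hα)
  have hne' : ∀ᵐ ω ∂(whiteNoise (ℤ × Bool)), tailMass L m β ω ≠ ENNReal.ofReal n := by
    rw [ae_iff]
    simpa using measure_tailMass_eq (L := L) hm hβ (ENNReal.ofReal_ne_top (r := n))
  have hne : ∀ᵐ q ∂Q, tailMass L m β q.1 ≠ ENNReal.ofReal n :=
    Measure.quasiMeasurePreserving_fst.ae hne'
  refine tendsto_integral_filter_of_dominated_convergence
    (fun _ => 2 * Real.pi * (s⁻¹ * ‖f‖))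
    (Eventually.of_forall fun l => (hint l).integral_prod_left.aestronglyMeasurable) ?_
    (integrable_const _) ?_
  · filter_upwards [eventually_gt_atTop 0] with l hl
    filter_upwards [hgood] with q hq
    rw [integral_fejer_mul_polarField hm hβ hα0 hα hq]
    exact abs_integral_fejer_mul_le
      (abs_massDensityMul_le hs fun r => f.norm_coe_le_norm _) hl _
  · filter_upwards [hgood, hne] with q hq hqn
    refine Tendsto.congr
      (fun l => (integral_fejer_mul_polarField hm hβ hα0 hα hq q.2 n l f).symm) ?_
    have hR := (tailMass_lt_top hβ hα0 hα hq).ne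
    rw [mul_assoc, ← massDensityMul_shell hm hβ hR q.2 hn f]
    have hF : Continuous fun r => f (polarField L m β (q.1, q.2, r)) :=
      f.continuous.comp (continuous_polarField q.1 q.2)
    refine tendsto_integral_fejer_mul (integrable_massDensityMul hs hF.measurable
      fun r => f.norm_coe_le_norm _) (continuousAt_massDensityMul hF ?_)
    rw [sub_ne_zero]
    intro h
    exact hqn (by rw [h, ENNReal.ofReal_toReal hR])

theorem integral_approxConditioned (μ : Measure (Field L)) [IsFiniteMeasure μ] (n : ℝ) (l : ℕ)
    (f : Field L →ᵇ ℝ) :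
    ∫ φ, f φ ∂(approxConditioned L μ n l) =
      (∫ φ, fejer l (n - N L φ) * (1 : Field L →ᵇ ℝ) φ ∂μ)⁻¹ *
        ∫ φ, fejer l (n - N L φ) * f φ ∂μ := by
  have hK : Measurable fun φ : Field L => fejer l (n - N L φ) :=
    (measurable_fejer l).comp (measurable_const.sub continuous_N.measurable)
  rw [approxConditioned, integral_smul_measure, integral_withDensity_eq_integral_toReal_smul
    hK.ennreal_ofReal (ae_of_all _ fun _ => ENNReal.ofReal_lt_top), ENNReal.toReal_inv,
    smul_eq_mul]
  congr 2
  · rw [← integral_toReal hK.ennreal_ofReal.aemeasurable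
      (ae_of_all _ fun _ => ENNReal.ofReal_lt_top)]
    refine integral_congr_ae (ae_of_all _ fun φ => ?_)
    simp [ENNReal.toReal_ofReal (fejer_nonneg l _)]
  · refine funext fun φ => ?_
    simp [ENNReal.toReal_ofReal (fejer_nonneg l _)]

theorem isConditionedOnNorm_shellMeasure (hm : 0 < m) (hβ : 0 < β) {n : ℝ} (hn : 0 < n) :
    IsConditionedOnNorm L (refMeasure L m β) n (shellMeasure L m β n) := by
  refine ⟨isProbabilityMeasure_shellMeasure hm hβ hn, fun f => ?_⟩
  have := (isReferenceMeasure_refMeasure (L := L) hm hβ).gaussian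
  have hs := meanMass_pos (L := L) hm hβ
  simp_rw [integral_approxConditioned]
  have hf := tendsto_integral_fejer_refMeasure (L := L) hm hβ hn f
  have h1 := tendsto_integral_fejer_refMeasure (L := L) hm hβ hn 1
  set c := 2 * Real.pi * ((meanMass L m β)⁻¹ * Real.exp (-(n / meanMass L m β)))
  have hc : 0 < c := by positivity
  set W := ∫⁻ ω, shellWeight L m β n ω ∂(whiteNoise (ℤ × Bool))
  have hW : 0 < W.toReal := ENNReal.toReal_pos (lintegral_shellWeight_pos hm hβ hn).ne'
    (lintegral_shellWeight_lt_top hm hβ hn.le).ne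
  have hone := integral_shellMeasure (L := L) (n := n) hm hβ 1
  have := isProbabilityMeasure_shellMeasure (L := L) hm hβ hn
  have h3 : ∫ φ, (1 : Field L →ᵇ ℝ) φ ∂(shellMeasure L m β n) = 1 := by simp
  rw [h3, eq_comm, inv_mul_eq_one₀ hW.ne'] at hone
  rw [← hone] at h1
  -- The normalizing constant is the same integral with test function `1`, so the quotient of the
  -- two limits is free of the common factor `c`.
  have := (h1.inv₀ (mul_pos hc hW).ne').mul hf
  convert! this using 2
  rw [integral_shellMeasure hm hβ]
  change W.toReal⁻¹ * _ = _
  field_simp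

end Conditioning

/-! ### Interpolation of the sup norm between mass and Hölder-like norm -/

section SupBound
variable {L m β : ℝ} [hL : Fact (0 < L)]

theorem card_freqs_le (J : ℕ) : ((freqs J).card : ℝ) ≤ 3 * 2 ^ J := by
  have hsub : freqs J ⊆ Finset.Icc (-(2 ^ J : ℤ)) (2 ^ J) := by
    intro k hk
    rw [freqs, Finset.mem_insert, Finset.mem_biUnion] at hk
    rw [Finset.mem_Icc, ← abs_le]
    rcases hk with rfl | ⟨j, hj, hk⟩
    · simp
    · have h1 := Nat.lt_pow_succ_log_self (b := 2) (by norm_num) k.natAbs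
      rw [(mem_block.1 hk).2] at h1
      have h2 : 2 ^ (j + 1) ≤ 2 ^ J := Nat.pow_le_pow_right (by norm_num) (Finset.mem_range.1 hj)
      rw [Int.abs_eq_natAbs]
      exact_mod_cast (h1.trans_le h2).le
  have h := Finset.card_le_card hsub
  rw [Int.card_Icc] at h
  have h1 : ((2 : ℤ) ^ J + 1 - -(2 ^ J)).toNat = 2 * 2 ^ J + 1 := by
    have : ((2 : ℤ) ^ J + 1 - -(2 ^ J)) = ((2 * 2 ^ J + 1 : ℕ) : ℤ) := by push_cast; ring
    rw [this, Int.toNat_natCast]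
  rw [h1] at h
  have h2 : ((freqs J).card : ℝ) ≤ 2 * 2 ^ J + 1 := by exact_mod_cast h
  have h3 : (1 : ℝ) ≤ 2 ^ J := one_le_pow₀ (by norm_num)
  linarith

theorem sum_freqs_eq (z : ℂ) (ω : ℤ × Bool → ℝ) (J : ℕ) :
    ∑ k ∈ freqs J, (if k = 0 then z else coeff L m β ω k) • modeField L k =
      z • modeField L 0 + ∑ j ∈ Finset.range J, blockField L m β j ω := by
  rw [freqs, Finset.sum_insert (by simp [mem_block]), Finset.sum_biUnion, if_pos rfl]
  · congr 1
    refine Finset.sum_congr rfl fun j _ => ?_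
    rw [blockField, sum_product_dir]
    exact Finset.sum_congr rfl fun k hk => by rw [if_neg (mem_block.1 hk).1]
  · intro i _ j _ hij
    refine Finset.disjoint_left.2 fun k h1 h2 => hij ?_
    rw [← (mem_block.1 h1).2, (mem_block.1 h2).2]

/-- Cut at frequency `2 ^ J`. The low part has at most `3 · 2 ^ J` modes and is controlled by
Cauchy–Schwarz and Parseval; the high blocks decay geometrically. -/
theorem norm_add_tailField_le (hβ : 0 < β) {α : ℝ} (hα0 : 0 < α) (hα : α < 1 / 2)
    {ω : ℤ × Bool → ℝ} (h : expMajorant L m β α ω < ∞) (z : ℂ) (J : ℕ) :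
    ‖z • modeField L 0 + tailField L m β ω‖ ≤
      Real.sqrt (3 * 2 ^ J / L * N L (z • modeField L 0 + tailField L m β ω)) +
        ((2 : ℝ) ^ (-α)) ^ J * holderNorm L m β α ω * (1 - (2 : ℝ) ^ (-α))⁻¹ := by
  have hL0 : 0 < L := hL.out
  set φ : Field L := z • modeField L 0 + tailField L m β ω
  set d : ℝ := 2 ^ (-α)
  have hd : d < 1 := Real.rpow_lt_one_of_one_lt_of_neg (by norm_num) (by linarith)
  have hd0 : 0 < d := by positivity
  set low : Field L := z • modeField L 0 + ∑ j ∈ Finset.range J, blockField L m β j ω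
  have hlow : ‖low‖ ≤ Real.sqrt (3 * 2 ^ J / L * N L φ) := by
    rw [ContinuousMap.norm_le _ (Real.sqrt_nonneg _)]
    intro x
    refine Real.le_sqrt_of_sq_le ?_
    have e : low x = ∑ k ∈ freqs J, innerL2 L (mode L k) φ * mode L k x := by
      simp only [low, ← sum_freqs_eq]
      rw [ContinuousMap.sum_apply]
      refine Finset.sum_congr rfl fun k _ => ?_
      rw [innerL2_mode_add_tailField hβ hα0 hα h]
      split_ifs <;> simp
    rw [e]
    refine (norm_sum_mode_sq_le _ _ x).trans ?_
    refine mul_le_mul (by gcongr; exact card_freqs_le J)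
      (sum_le_hasSum _ (fun _ _ => sq_nonneg _) (hasSum_norm_innerL2_mode_sq φ))
      (Finset.sum_nonneg fun _ _ => sq_nonneg _) (by positivity)
  have hhigh : ‖φ - low‖ ≤ d ^ J * holderNorm L m β α ω * (1 - d)⁻¹ := by
    have h1 := (hasSum_nat_add_iff' J).2 (hasSum_blockField hβ hα0 hα h)
    have h2 : φ - low = tailField L m β ω - ∑ j ∈ Finset.range J, blockField L m β j ω :=
      add_sub_add_left_eq_sub _ _ _
    rw [h2]
    refine h1.norm_le_of_bounded
      ((hasSum_geometric_of_lt_one hd0.le hd).mul_left (d ^ J * holderNorm L m β α ω)) fun j => ?_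
    refine (norm_blockField_le hβ hα h (j + J)).trans (le_of_eq ?_)
    rw [pow_add]; ring
  calc ‖φ‖ = ‖low + (φ - low)‖ := by rw [add_sub_cancel]
    _ ≤ _ := (norm_add_le _ _).trans (add_le_add hlow hhigh)

/-- Choose `2 ^ J` near `y ^ (2 / (2 α + 1))`, where `2 ^ (J / 2)` and `2 ^ (-α J) y` are of the
same size. -/
theorem exists_two_pow_balance {α : ℝ} (hα0 : 0 < α) {y : ℝ} (hy : 0 ≤ y) :
    ∃ J : ℕ, Real.sqrt (2 ^ J) ≤ 2 * (1 + y ^ (1 / (2 * α + 1))) ∧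
      ((2 : ℝ) ^ (-α)) ^ J * y ≤ y ^ (1 / (2 * α + 1)) := by
  set κ := 1 / (2 * α + 1)
  have hκ : 0 < κ := by positivity
  rcases hy.eq_or_lt with rfl | hy0
  · refine ⟨0, ?_, ?_⟩
    · rw [Real.zero_rpow hκ.ne']; norm_num
    · rw [Real.zero_rpow hκ.ne']; simp
  set Y := y ^ (2 * κ)
  have hY : 0 < Y := by positivity
  -- The maximum with `1` is needed because `J` is natural; `J + 1` is used so that the power
  -- exceeds `Y`, at the cost of a factor `2`.
  obtain ⟨J, hJ1, hJ2⟩ := exists_nat_pow_near (le_max_left 1 Y) (one_lt_two : (1 : ℝ) < 2)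
  have hYs : Real.sqrt Y = y ^ κ := by
    rw [Real.sqrt_eq_rpow, ← Real.rpow_mul hy]; congr 1; ring
  refine ⟨J + 1, ?_, ?_⟩
  · refine (Real.sqrt_le_left (by positivity)).2 ?_
    have h1 : max 1 Y ≤ (1 + y ^ κ) ^ 2 := by
      have h0 : 0 < y ^ κ := by positivity
      have hYsq : Y = (y ^ κ) ^ 2 := by rw [← hYs, Real.sq_sqrt hY.le]
      refine max_le (by nlinarith) (by rw [hYsq]; nlinarith)
    rw [pow_succ]
    nlinarith [sq_nonneg (1 + y ^ κ)]
  · have h1 : Y ≤ 2 ^ (J + 1) := (le_max_right _ _).trans hJ2.le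
    have h2 : ((2 : ℝ) ^ (-α)) ^ (J + 1) = ((2 : ℝ) ^ (J + 1)) ^ (-α) := by
      rw [← Real.rpow_natCast, ← Real.rpow_natCast, ← Real.rpow_mul (by norm_num),
        ← Real.rpow_mul (by norm_num), mul_comm]
    have h3 : ((2 : ℝ) ^ (J + 1)) ^ (-α) ≤ Y ^ (-α) :=
      Real.rpow_le_rpow_of_nonpos hY h1 (by linarith)
    have h4 : Y ^ (-α) * y = y ^ κ := by
      simp only [Y]
      rw [← Real.rpow_mul hy]
      nth_rewrite 2 [← Real.rpow_one y]
      rw [← Real.rpow_add hy0]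
      congr 1
      simp only [κ]; field_simp; ring
    rw [h2, ← h4]
    exact mul_le_mul_of_nonneg_right h3 hy

/-- Sup norm bound by interpolation between the `L²` norm and the Hölder-like norm. -/
theorem norm_add_tailField_le_rpow (hβ : 0 < β) {α : ℝ} (hα0 : 0 < α) (hα : α < 1 / 2)
    {ω : ℤ × Bool → ℝ} (h : expMajorant L m β α ω < ∞) (z : ℂ) {n : ℝ} (hn : 0 < n)
    (hN : N L (z • modeField L 0 + tailField L m β ω) = n) :
    ‖z • modeField L 0 + tailField L m β ω‖ ≤
      (2 * Real.sqrt (3 / L) + (1 - (2 : ℝ) ^ (-α))⁻¹) * Real.sqrt n *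
        (1 + (holderNorm L m β α ω / Real.sqrt n) ^ (1 / (2 * α + 1))) := by
  have hL0 : 0 < L := hL.out
  have hsn : 0 < Real.sqrt n := Real.sqrt_pos.2 hn
  set y := holderNorm L m β α ω / Real.sqrt n
  have hy : 0 ≤ y := div_nonneg (holderNorm_nonneg _ _) hsn.le
  obtain ⟨J, h1, h2⟩ := exists_two_pow_balance hα0 hy
  have hd : (2 : ℝ) ^ (-α) < 1 := Real.rpow_lt_one_of_one_lt_of_neg (by norm_num) (by linarith)
  set D := (1 - (2 : ℝ) ^ (-α))⁻¹
  have hD : 0 < D := inv_pos.2 (by linarith)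
  refine (norm_add_tailField_le hβ hα0 hα h z J).trans ?_
  rw [hN]
  have e1 : Real.sqrt (3 * 2 ^ J / L * n) = Real.sqrt (3 / L) * Real.sqrt n * Real.sqrt (2 ^ J) := by
    rw [← Real.sqrt_mul (by positivity), ← Real.sqrt_mul (by positivity)]
    congr 1; ring
  have e2 : holderNorm L m β α ω = Real.sqrt n * y := by simp only [y]; field_simp
  rw [e1, e2]
  set u := y ^ (1 / (2 * α + 1))
  have hu : 0 ≤ u := by positivity
  have i1 : Real.sqrt (3 / L) * Real.sqrt n * Real.sqrt (2 ^ J) ≤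
      Real.sqrt (3 / L) * Real.sqrt n * (2 * (1 + u)) := by gcongr
  have i2 : ((2 : ℝ) ^ (-α)) ^ J * (Real.sqrt n * y) * D ≤ Real.sqrt n * D * (1 + u) := by
    calc _ = Real.sqrt n * D * (((2 : ℝ) ^ (-α)) ^ J * y) := by ring
      _ ≤ Real.sqrt n * D * (1 + u) := by gcongr; linarith
  calc _ ≤ Real.sqrt (3 / L) * Real.sqrt n * (2 * (1 + u)) + Real.sqrt n * D * (1 + u) :=
        add_le_add i1 i2
    _ = _ := by ring

theorem normPow_le (φ : Field L) {p : ℝ} (hp : 2 ≤ p) :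
    normPow L p φ ≤ ‖φ‖ ^ (p - 2) * N L φ := by
  rw [integral_norm_sq_eq, ← integral_const_mul]
  refine integral_mono (Continuous.integrable_of_hasCompactSupport ?_ (.of_compactSpace _))
    (Continuous.integrable_of_hasCompactSupport (by fun_prop) (.of_compactSpace _)) fun x => ?_
  · exact φ.continuous.norm.rpow_const fun _ => Or.inr (by linarith)
  · have h1 : ‖φ x‖ ^ p = ‖φ x‖ ^ (p - 2) * ‖φ x‖ ^ 2 := by
      rcases (norm_nonneg (φ x)).eq_or_lt with h | h
      · rw [← h, Real.zero_rpow (by linarith)]; simp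
      · rw [← Real.rpow_natCast, ← Real.rpow_add h]; congr 1; push_cast; ring
    dsimp only
    rw [h1]
    exact mul_le_mul_of_nonneg_right (Real.rpow_le_rpow (norm_nonneg _) (φ.norm_coe_le_norm x)
      (by linarith)) (sq_nonneg _)

theorem normPow_nonneg (φ : Field L) (p : ℝ) : 0 ≤ normPow L p φ :=
  integral_nonneg fun _ => by positivity

theorem normPow_add_tailField_le (hβ : 0 < β) {α : ℝ} (hα0 : 0 < α) (hα : α < 1 / 2) :
    ∃ B : ℝ, 0 < B ∧ ∀ (ω : ℤ × Bool → ℝ), expMajorant L m β α ω < ∞ → ∀ (z : ℂ) (n : ℝ), 0 < n →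
      N L (z • modeField L 0 + tailField L m β ω) = n → ∀ p : ℝ, 2 < p → p < 6 →
      normPow L p (z • modeField L 0 + tailField L m β ω) ≤ B * n ^ (p / 2) *
        (1 + (holderNorm L m β α ω / Real.sqrt n) ^ ((p - 2) / (2 * α + 1))) := by
  have hL0 : 0 < L := hL.out
  set A := 2 * Real.sqrt (3 / L) + (1 - (2 : ℝ) ^ (-α))⁻¹
  have hd : (2 : ℝ) ^ (-α) < 1 := Real.rpow_lt_one_of_one_lt_of_neg (by norm_num) (by linarith)
  have hA : 0 < A := by
    have : 0 < (1 - (2 : ℝ) ^ (-α))⁻¹ := inv_pos.2 (by linarith)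
    positivity
  -- Since `p - 2 < 4`, the fourth power dominates `(2 A) ^ (p - 2)` for all `p` at once.
  refine ⟨(2 * (1 + A)) ^ (4 : ℝ), by positivity, fun ω h z n hn hN p hp2 hp6 => ?_⟩
  have hsn : 0 < Real.sqrt n := Real.sqrt_pos.2 hn
  set y := holderNorm L m β α ω / Real.sqrt n
  have hy : 0 ≤ y := div_nonneg (holderNorm_nonneg _ _) hsn.le
  have hsup := norm_add_tailField_le_rpow hβ hα0 hα h z hn hN
  have h1 := normPow_le (z • modeField L 0 + tailField L m β ω : Field L) hp2.le
  rw [hN] at h1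
  refine h1.trans ?_
  set u := y ^ (1 / (2 * α + 1))
  have hu : 0 ≤ u := by positivity
  have hur : u ^ (p - 2) = y ^ ((p - 2) / (2 * α + 1)) := by
    rw [← Real.rpow_mul hy]; congr 1; ring
  rw [← hur]
  have hr0 : 0 ≤ p - 2 := by linarith
  have h2 : ‖(z • modeField L 0 + tailField L m β ω : Field L)‖ ^ (p - 2) ≤
      A ^ (p - 2) * Real.sqrt n ^ (p - 2) * (1 + u) ^ (p - 2) := by
    rw [← Real.mul_rpow (by positivity) (by positivity),
      ← Real.mul_rpow (by positivity) (by positivity)]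
    exact Real.rpow_le_rpow (norm_nonneg _) hsup hr0
  have h3 : (1 + u) ^ (p - 2) ≤ 2 ^ (p - 2) * (1 + u ^ (p - 2)) := by
    have hmax : (1 + u) ^ (p - 2) ≤ (2 * max 1 u) ^ (p - 2) := by
      refine Real.rpow_le_rpow (by positivity) ?_ hr0
      linarith [le_max_left 1 u, le_max_right 1 u]
    refine hmax.trans ?_
    rw [Real.mul_rpow (by norm_num) (by positivity)]
    refine mul_le_mul_of_nonneg_left ?_ (by positivity)
    have hup : 0 ≤ u ^ (p - 2) := by positivity
    rcases max_choice 1 u with hm | hm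
    · rw [hm, Real.one_rpow]; linarith
    · rw [hm]; linarith
  have h4 : A ^ (p - 2) * 2 ^ (p - 2) ≤ (2 * (1 + A)) ^ (4 : ℝ) := by
    rw [← Real.mul_rpow hA.le (by norm_num)]
    refine (Real.rpow_le_rpow (z := p - 2) (by positivity)
      (by linarith : A * 2 ≤ 2 * (1 + A)) hr0).trans ?_
    exact Real.rpow_le_rpow_of_exponent_le (by linarith) (by linarith)
  have h5 : Real.sqrt n ^ (p - 2) * n = n ^ (p / 2) := by
    rw [Real.sqrt_eq_rpow, ← Real.rpow_mul hn.le]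
    nth_rewrite 2 [← Real.rpow_one n]
    rw [← Real.rpow_add hn]; congr 1; ring
  calc _ ≤ A ^ (p - 2) * Real.sqrt n ^ (p - 2) * (1 + u) ^ (p - 2) * n := by gcongr
    _ ≤ A ^ (p - 2) * Real.sqrt n ^ (p - 2) * (2 ^ (p - 2) * (1 + u ^ (p - 2))) * n := by gcongr
    _ = (A ^ (p - 2) * 2 ^ (p - 2)) * (Real.sqrt n ^ (p - 2) * n) * (1 + u ^ (p - 2)) := by ring
    _ ≤ _ := by rw [h5]; gcongr

end SupBound

/-! ### Young-type inequalities with uniform constants -/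

section Young

/-- If the quadratic term alone does not dominate, then `y ^ (2 - q) ≤ b / ε`, which bounds `y ^ q`.
-/
theorem mul_rpow_le_add {b ε y q : ℝ} (hb : 0 ≤ b) (hε : 0 < ε) (hy : 0 ≤ y) (hq0 : 0 < q)
    (hq2 : q < 2) : b * y ^ q ≤ ε * y ^ 2 + b * (b / ε) ^ (q / (2 - q)) := by
  rcases le_or_gt (b * y ^ q) (ε * y ^ 2) with h | h
  · have : 0 ≤ b * (b / ε) ^ (q / (2 - q)) := by positivity
    linarith
  · have h0 : 0 < y := by
      rcases hy.eq_or_lt with rfl | h0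
      · rw [Real.zero_rpow hq0.ne'] at h; simp at h
      · exact h0
    have h1 : y ^ (2 - q) ≤ b / ε := by
      rw [le_div_iff₀ hε]
      have e : y ^ 2 = y ^ (2 - q) * y ^ q := by
        rw [← Real.rpow_add h0, ← Real.rpow_natCast]; congr 1; push_cast; ring
      rw [e, ← mul_assoc] at h
      have := lt_of_mul_lt_mul_right h (by positivity)
      linarith
    have h2 : y ^ q ≤ (b / ε) ^ (q / (2 - q)) := by
      have h3 := Real.rpow_le_rpow (by positivity) h1 (div_nonneg hq0.le (by linarith : 0 ≤ 2 - q))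
      rwa [← Real.rpow_mul hy, mul_div_cancel₀ _ (by linarith : (2 : ℝ) - q ≠ 0)] at h3
    have h3 : 0 ≤ ε * y ^ 2 := by positivity
    have := mul_le_mul_of_nonneg_left h2 hb
    linarith

theorem rpow_le_mul_one_add_rpow {c t E' E M : ℝ} (hc : 0 < c) (ht : 0 ≤ t) (hE' : 0 < E')
    (hE : E' ≤ E) (hM : E' ≤ M) : (c * t) ^ E' ≤ max 1 c ^ M * (1 + t ^ E) := by
  rw [Real.mul_rpow hc.le ht]
  have h1 : c ^ E' ≤ max 1 c ^ M :=
    (Real.rpow_le_rpow hc.le (le_max_right _ _) hE'.le).trans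
      (Real.rpow_le_rpow_of_exponent_le (le_max_left _ _) hM)
  have h2 : t ^ E' ≤ 1 + t ^ E := by
    have : 0 ≤ t ^ E := by positivity
    rcases le_or_gt t 1 with h | h
    · have := Real.rpow_le_one ht h hE'.le
      linarith
    · have := Real.rpow_le_rpow_of_exponent_le h.le hE
      linarith
  exact mul_le_mul h1 h2 (by positivity) (by positivity)

end Young

/-! ### The exponential bound and the canonical Gibbs measure -/

section ExponentialBound
variable {L m β : ℝ} [hL : Fact (0 < L)]

/-- The second order `α' > α` keeps the constants uniform in `p`. Young's inequality with `α'`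
produces the exponent `(p - 2) / (4 α' + 4 - p)`, which stays below `M` as `p` approaches `4 α + 4`,
so the power of `B / ε` is bounded. Enlarging the exponent of `t = lam n ^ (p / 2 - 1)` to the one
belonging to `α` costs only the term linear in `lam`. -/
theorem div_mul_normPow_le (hβ : 0 < β) {α α' : ℝ} (hα0 : 0 < α) (hαα' : α < α') (hα : α' < 1 / 2)
    {ε : ℝ} (hε : 0 < ε) :
    ∃ C₁ C₂ : ℝ, ∀ (ω : ℤ × Bool → ℝ), expMajorant L m β α' ω < ∞ → ∀ (z : ℂ) (n : ℝ), 0 < n →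
      N L (z • modeField L 0 + tailField L m β ω) = n → ∀ p : ℝ, 2 < p → p < 4 * α + 4 →
      ∀ lam : ℝ, 0 ≤ lam →
      lam / p * normPow L p (z • modeField L 0 + tailField L m β ω) ≤
        C₁ * lam * n ^ (p / 2) + C₂ * lam ^ ((4 * α + 2) / (4 * α + 4 - p)) *
          n ^ ((2 * α * p + 2) / (4 * α + 4 - p)) + ε * holderNorm L m β α' ω ^ 2 := by
  obtain ⟨B, hB, hbound⟩ := normPow_add_tailField_le (L := L) (m := m) hβ (hα0.trans hαα') hα
  set M := (4 * α + 2) / (4 * α' - 4 * α)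
  set K := max 1 (B / ε) ^ M
  refine ⟨B + B * K, B * K, fun ω h z n hn hN p hp2 hp lam hlam => ?_⟩
  have hb := hbound ω h z n hn hN p hp2 (by linarith)
  have hsn : 0 < Real.sqrt n := Real.sqrt_pos.2 hn
  have hh0 := holderNorm_nonneg (L := L) (m := m) (β := β) α' ω
  set H := holderNorm L m β α' ω
  set y := H / Real.sqrt n
  have hy : 0 ≤ y := div_nonneg hh0 hsn.le
  have hny : n * y ^ 2 = H ^ 2 := by
    simp only [y]; rw [div_pow, Real.sq_sqrt hn.le]; field_simp
  set q := (p - 2) / (2 * α' + 1)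
  have hα'1 : 0 < 2 * α' + 1 := by linarith
  have hq0 : 0 < q := div_pos (by linarith) hα'1
  have hq2 : q < 2 := (div_lt_iff₀ hα'1).2 (by linarith)
  set t := lam * n ^ (p / 2 - 1)
  have ht : 0 ≤ t := by positivity
  have hnt : n * t = lam * n ^ (p / 2) := by
    simp only [t]
    rw [mul_left_comm]
    congr 1
    nth_rewrite 1 [← Real.rpow_one n]
    rw [← Real.rpow_add hn]; congr 1; ring
  have hden : 0 < 4 * α + 4 - p := by linarith
  have hden' : 0 < 4 * α' + 4 - p := by linarith
  have hE'eq : q / (2 - q) = (p - 2) / (4 * α' + 4 - p) := by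
    have : 2 - q = (4 * α' + 4 - p) / (2 * α' + 1) := by simp only [q]; field_simp; ring
    rw [this]; simp only [q]; field_simp
  set E := (p - 2) / (4 * α + 4 - p)
  have hyoung := mul_rpow_le_add (b := B * t) (by positivity) hε hy hq0 hq2
  have hpow : (B * t / ε) ^ (q / (2 - q)) ≤ K * (1 + t ^ E) := by
    rw [mul_div_right_comm]
    refine rpow_le_mul_one_add_rpow (by positivity) ht (div_pos hq0 (by linarith)) ?_ ?_
    · rw [hE'eq]
      exact div_le_div_of_nonneg_left (by linarith) hden (by linarith)
    · rw [hE'eq]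
      exact div_le_div₀ (by linarith) (by linarith) (by linarith) (by linarith)
  have hlast : n * t * t ^ E = lam ^ ((4 * α + 2) / (4 * α + 4 - p)) *
      n ^ ((2 * α * p + 2) / (4 * α + 4 - p)) := by
    have hsum : E + 1 = (4 * α + 2) / (4 * α + 4 - p) := by
      simp only [E]; rw [div_add_one hden.ne']; congr 1; ring
    rw [mul_assoc, mul_comm t, ← Real.rpow_add_one' ht (by
      rw [hsum]; exact (div_pos (by linarith) hden).ne'), hsum]
    simp only [t]
    rw [Real.mul_rpow hlam (by positivity), ← Real.rpow_mul hn.le, mul_left_comm]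
    congr 1
    nth_rewrite 1 [← Real.rpow_one n]
    rw [← Real.rpow_add hn]
    congr 1
    have := hden.ne'
    rw [eq_div_iff this, add_mul, mul_assoc, div_mul_cancel₀ _ this]
    ring
  have hp1 : lam / p ≤ lam := div_le_self hlam (by linarith)
  calc _ ≤ lam * normPow L p (z • modeField L 0 + tailField L m β ω) :=
        mul_le_mul_of_nonneg_right hp1 (normPow_nonneg _ _)
    _ ≤ lam * (B * n ^ (p / 2) * (1 + y ^ q)) := mul_le_mul_of_nonneg_left hb hlam
    _ = B * (lam * n ^ (p / 2)) + n * (B * t * y ^ q) := by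
        have : n * (B * t * y ^ q) = B * (n * t) * y ^ q := by ring
        rw [this, hnt]; ring
    _ ≤ B * (lam * n ^ (p / 2)) + n * (ε * y ^ 2 + B * t * (K * (1 + t ^ E))) := by
        refine add_le_add le_rfl (mul_le_mul_of_nonneg_left (hyoung.trans ?_) hn.le)
        exact add_le_add le_rfl (mul_le_mul_of_nonneg_left hpow (by positivity))
    _ = B * (lam * n ^ (p / 2)) + (B * K * (n * t) + B * K * (n * t * t ^ E)) +
          ε * (n * y ^ 2) := by ring
    _ = _ := by rw [hlast, hnt, hny]; ring

/-- The pathwise bound leaves `exp (ε y²)`, whose mean on the shell is bounded uniformly in `n`; `ε`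
is the one supplied by that moment bound at order `α'`, halfway between `α` and `1/2`. -/
theorem exists_lintegral_exp_normPow_le (hm : 0 < m) (hβ : 0 < β) {α : ℝ} (hα0 : 0 < α)
    (hα : α < 1 / 2) :
    ∃ C₁ C₂ C₃ : ℝ, 0 ≤ C₃ ∧ ∀ p : ℝ, 2 < p → p < 4 * α + 4 → ∀ lam n : ℝ, 0 < n → 0 ≤ lam →
      ∫⁻ φ, ENNReal.ofReal (Real.exp (lam / p * normPow L p φ)) ∂(shellMeasure L m β n) ≤
        ENNReal.ofReal (C₃ * Real.exp (C₁ * lam * n ^ (p / 2) +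
          C₂ * lam ^ ((4 * α + 2) / (4 * α + 4 - p)) *
            n ^ ((2 * α * p + 2) / (4 * α + 4 - p)))) := by
  set α' := (α + 1 / 2) / 2
  have h1 : α < α' := by simp only [α']; linarith
  have h2 : α' < 1 / 2 := by simp only [α']; linarith
  have h0 : 0 < α' := hα0.trans h1
  obtain ⟨ε, hε, C, hC, hmom⟩ := exists_lintegral_exp_mul_shellWeight_le (L := L) hm hβ h2
  obtain ⟨C₁, C₂, hdet⟩ := div_mul_normPow_le (L := L) (m := m) hβ hα0 h1 h2 hε
  refine ⟨C₁, C₂, C.toReal, ENNReal.toReal_nonneg, fun p hp2 hp lam n hn hlam => ?_⟩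
  have hFm : Measurable fun φ : Field L => ENNReal.ofReal (Real.exp (lam / p * normPow L p φ)) := by
    have := (continuous_normPow (L := L) (by linarith : 0 ≤ p)).measurable
    fun_prop
  rw [lintegral_shellMeasure hm hβ n hFm]
  set X := C₁ * lam * n ^ (p / 2) + C₂ * lam ^ ((4 * α + 2) / (4 * α + 4 - p)) *
    n ^ ((2 * α * p + 2) / (4 * α + 4 - p))
  set W := ∫⁻ ω, shellWeight L m β n ω ∂(whiteNoise (ℤ × Bool)) with hWdef
  have hW0 : W ≠ 0 := (lintegral_shellWeight_pos hm hβ hn).ne'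
  have hWt : W ≠ ∞ := (lintegral_shellWeight_lt_top hm hβ hn.le).ne
  have hgood : ∀ᵐ q ∂((whiteNoise (ℤ × Bool)).prod phaseLaw), expMajorant L m β α' q.1 < ∞ :=
    Measure.quasiMeasurePreserving_fst.ae (ae_expMajorant_lt_top (L := L) hm hβ h2)
  have hpt : ∫⁻ q, shellWeight L m β n q.1 * ENNReal.ofReal
        (Real.exp (lam / p * normPow L p (shellField L m β n q)))
          ∂((whiteNoise (ℤ × Bool)).prod phaseLaw) ≤
      ∫⁻ q, ENNReal.ofReal (Real.exp X) * (ENNReal.ofReal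
        (Real.exp (ε * holderNorm L m β α' q.1 ^ 2)) * shellWeight L m β n q.1)
          ∂((whiteNoise (ℤ × Bool)).prod phaseLaw) := by
    refine lintegral_mono_ae ?_
    filter_upwards [hgood] with q hq
    by_cases hR : tailMass L m β q.1 < ENNReal.ofReal n
    · have hR' : (tailMass L m β q.1).toReal ≤ n := ENNReal.toReal_le_of_le_ofReal hn.le hR.le
      have hN : N L (shellField L m β n q) = n := by
        rw [shellField, N_polarField hβ h0 h2 hq _ (by linarith)]; ring
      have := hdet q.1 hq _ n hn hN p hp2 hp lam hlam
      rw [mul_comm, ← mul_assoc, ← ENNReal.ofReal_mul (Real.exp_pos _).le, ← Real.exp_add]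
      exact mul_le_mul' (ENNReal.ofReal_le_ofReal (Real.exp_le_exp.2 this)) le_rfl
    · have : shellWeight L m β n q.1 = 0 := if_neg hR
      rw [this]; simp
  have hm2 : Measurable fun ω => ENNReal.ofReal
      (Real.exp (ε * holderNorm L m β α' ω ^ 2)) * shellWeight L m β n ω := by
    have h3 := measurable_holderNorm (L := L) (m := m) (β := β) α'
    have h4 := measurable_shellWeight (L := L) (m := m) (β := β) n
    fun_prop
  rw [lintegral_const_mul' _ _ ENNReal.ofReal_ne_top,
    lintegral_comp_fst_phaseLaw (H := fun ω => ENNReal.ofReal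
      (Real.exp (ε * holderNorm L m β α' ω ^ 2)) * shellWeight L m β n ω) hm2.aemeasurable] at hpt
  calc _ ≤ W⁻¹ * (ENNReal.ofReal (Real.exp X) * (C * W)) :=
        mul_le_mul' le_rfl (hpt.trans (mul_le_mul' le_rfl (hmom n hn)))
    _ = C * ENNReal.ofReal (Real.exp X) * (W⁻¹ * W) := by ring
    _ = _ := by
        rw [ENNReal.inv_mul_cancel hW0 hWt, mul_one, ENNReal.ofReal_mul ENNReal.toReal_nonneg,
          ENNReal.ofReal_toReal hC]

theorem measurable_exp_normPow {p : ℝ} (hp : 2 < p) (c : ℝ) :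
    Measurable fun φ : Field L => Real.exp (c * normPow L p φ) := by
  have := (continuous_normPow (L := L) (by linarith : 0 ≤ p)).measurable
  fun_prop

theorem integrable_exp_normPow (hm : 0 < m) (hβ : 0 < β) {p : ℝ} (hp2 : 2 < p) (hp6 : p < 6)
    (lam : ℝ) {n : ℝ} (hn : 0 < n) :
    Integrable (fun φ => Real.exp (lam / p * normPow L p φ)) (shellMeasure L m β n) := by
  have hmeas := (measurable_exp_normPow (L := L) hp2 (lam / p)).aestronglyMeasurable
    (μ := shellMeasure L m β n)
  have hprob := isProbabilityMeasure_shellMeasure (L := L) hm hβ hn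
  rcases le_or_gt 0 lam with hlam | hlam
  · obtain ⟨α, hα0, hα, hpα⟩ : ∃ α : ℝ, 0 < α ∧ α < 1 / 2 ∧ p < 4 * α + 4 :=
      -- For this choice both `α < 1 / 2` and `p < 4 α + 4` amount to `p < 6`.
      ⟨(p + 2) / 16, by linarith, by linarith, by linarith⟩
    obtain ⟨C₁, C₂, C₃, -, h⟩ := exists_lintegral_exp_normPow_le (L := L) hm hβ hα0 hα
    refine ⟨hmeas, ?_⟩
    rw [hasFiniteIntegral_iff_ofReal (ae_of_all _ fun _ => (Real.exp_pos _).le)]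
    exact (h p hp2 hpα lam n hn hlam).trans_lt ENNReal.ofReal_lt_top
  · refine Integrable.of_bound hmeas 1 (ae_of_all _ fun φ => ?_)
    rw [Real.norm_of_nonneg (Real.exp_pos _).le, Real.exp_le_one_iff]
    exact mul_nonpos_of_nonpos_of_nonneg (div_nonpos_of_nonpos_of_nonneg hlam.le (by linarith))
      (normPow_nonneg φ p)

theorem isProbabilityMeasure_canonicalGibbs (hm : 0 < m) (hβ : 0 < β) {p : ℝ} (hp2 : 2 < p)
    (hp6 : p < 6) (lam : ℝ) {n : ℝ} (hn : 0 < n) :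
    IsProbabilityMeasure (canonicalGibbs L m β p lam n (shellMeasure L m β n)) := by
  have hprob := isProbabilityMeasure_shellMeasure (L := L) hm hβ hn
  refine isProbabilityMeasure_tilted ?_
  have h := (integrable_exp_normPow (L := L) hm hβ hp2 hp6 (β * lam) hn).const_mul
    (Real.exp (β * (m ^ 2 * n / 2)))
  refine h.congr (ae_of_all _ fun φ => ?_)
  dsimp only
  rw [← Real.exp_add]
  congr 1; ring

end ExponentialBound

end FocusingNLS

end

/-! ### The main theorem -/

theorem mainTheorem2 (L m β : ℝ) [Fact (0 < L)] (hm : 0 < m) (hβ : 0 < β) :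
    (∃ μ : Measure (FocusingNLS.Field L), FocusingNLS.IsReferenceMeasure L m β μ) ∧
    ∀ μ : Measure (FocusingNLS.Field L), FocusingNLS.IsReferenceMeasure L m β μ →
      ∃ ν : ℝ → Measure (FocusingNLS.Field L),
        (∀ n : ℝ, 0 < n → FocusingNLS.IsConditionedOnNorm L μ n (ν n)) ∧
        (∀ p : ℝ, 2 < p → p < 6 → ∀ lam n : ℝ, 0 < n →
          Integrable (fun φ => Real.exp (lam / p * FocusingNLS.normPow L p φ)) (ν n) ∧
          IsProbabilityMeasure (FocusingNLS.canonicalGibbs L m β p lam n (ν n))) ∧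
        (∀ α : ℝ, 0 < α → α < 1 / 2 →
          ∃ C₁ C₂ C₃ : ℝ, ∀ p : ℝ, 2 < p → p < 4 * α + 4 → ∀ lam n : ℝ, 0 < n →
            (0 ≤ lam →
              ∫ φ, Real.exp (lam / p * FocusingNLS.normPow L p φ) ∂(ν n) <
                C₃ * Real.exp (C₁ * lam * n ^ (p / 2) +
                  C₂ * lam ^ ((4 * α + 2) / (4 * α + 4 - p)) *
                    n ^ ((2 * α * p + 2) / (4 * α + 4 - p)))) ∧
            (lam < 0 →
              ∫ φ, Real.exp (lam / p * FocusingNLS.normPow L p φ) ∂(ν n) ≤ 1)) := by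
  refine ⟨⟨_, FocusingNLS.isReferenceMeasure_refMeasure hm hβ⟩, fun μ hμ => ?_⟩
  -- By uniqueness, an arbitrary reference measure is the law of the random series.
  obtain rfl := hμ.unique (FocusingNLS.isReferenceMeasure_refMeasure hm hβ)
  refine ⟨FocusingNLS.shellMeasure L m β,
    fun n hn => FocusingNLS.isConditionedOnNorm_shellMeasure hm hβ hn,
    fun p hp2 hp6 lam n hn => ⟨FocusingNLS.integrable_exp_normPow hm hβ hp2 hp6 lam hn,
      FocusingNLS.isProbabilityMeasure_canonicalGibbs hm hβ hp2 hp6 lam hn⟩,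
    fun α hα0 hα => ?_⟩
  obtain ⟨C₁, C₂, C₃, hC₃, h⟩ :=
    FocusingNLS.exists_lintegral_exp_normPow_le (L := L) hm hβ hα0 hα
  -- The added `1` makes the inequality strict.
  refine ⟨C₁, C₂, C₃ + 1, fun p hp2 hp lam n hn => ⟨fun hlam => ?_, fun hlam => ?_⟩⟩
  · rw [integral_eq_lintegral_of_nonneg_ae (ae_of_all _ fun _ => (Real.exp_pos _).le)
      (FocusingNLS.measurable_exp_normPow hp2 _).aestronglyMeasurable]
    refine (ENNReal.toReal_le_of_le_ofReal (by positivity) (h p hp2 hp lam n hn hlam)).trans_lt ?_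
    rw [add_mul, one_mul]
    exact lt_add_of_pos_right _ (Real.exp_pos _)
  · have hprob := FocusingNLS.isProbabilityMeasure_shellMeasure (L := L) hm hβ hn
    refine (integral_mono (FocusingNLS.integrable_exp_normPow hm hβ hp2 (by linarith) lam hn)
      (integrable_const 1) fun φ => ?_).trans (by simp)
    rw [Real.exp_le_one_iff]
    exact mul_nonpos_of_nonpos_of_nonneg (div_nonpos_of_nonpos_of_nonneg hlam.le (by linarith))
      (FocusingNLS.normPow_nonneg φ p)
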